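/- **Setting.** Let $1\le k\le n-1$. Let $\mathcal A=\mathbb Z[X]/(X^2)$ with $\deg 1=-1$, $\deg X=1$, be the graded Frobenius ring with comultiplication $\Delta(1)=1\otimes X+X\otimes 1$, $\Delta(X)=X\otimes X$, and let $\mathcal F$ be the associated two-dimensional TQFT, $\mathcal F(\text{$r$ circles})=\mathcal A^{\otimes r}$. Write $\{m\}$ for the upward shift of the grading by $m$ and $W(b)$ for the reflection of a diagram $b$ in a horizontal line. For a finite ordered set $s$ of $2m$ points on a line, let $B(s)$ be the set of crossingless matchings of $s$ and let $H(s)=\bigoplus_{a,b\in B(s)}\mathcal F(W(b)a)\{m\}$ be Khovanov's arc ring: the product of $\mathcal F(W(c)b)$ and $\mathcal F(W(b')a)$ is zero for $b\ne b'$, and for $b=b'$ is induced by the minimal cobordism contracting $bW(b)$ to vertical lines. (For $s=\emptyset$, $H(s)=\mathbb Z$.) To a flat tangle $T$ with bottom endpoints $s$ and top endpoints $t$ one assigns the graded $(H(t),H(s))$-bimodule $\mathcal F(T)=\bigoplus_{a\in B(s),\,b\in B(t)}\mathcal F(W(b)Ta)\{|s|/2\}$, on which the rings act by the same contraction cobordisms.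 An admissible weight is a sequence $\lambda\in\{0,1,2\}^n$ with $\sum_i\lambda_i=2k$. Let $s(\lambda)$ be the set of positions $i$ with $\lambda_i=1$, let $H_\lambda=H(s(\lambda))$, let $\mathcal C(\lambda)$ be the category of finitely generated graded left $H_\lambda$-modules and degree-preserving homomorphisms, and let $\mathcal C=\bigoplus_\lambda\mathcal C(\lambda)$, the sum being over all admissible weights. For an admissible $\lambda$ and $a\in B(s(\lambda))$, the object of $\mathcal C(\lambda)$ $$Q_{\lambda,a}=\bigoplus_{b\in B(s(\lambda))}\mathcal F(W(b)a)=H_\lambda 1_a\{-|s(\lambda)|/2\}$$ is called a *balanced indecomposable projective* of $\mathcal C$. Let $2\omega_k=(2^k,0^{n-k})$, and let $Q_{2\omega_k}$ be $\mathbb Z$ in degree $0$ in $\mathcal C(2\omega_k)$; it is $Q_{2\omega_k,\emptyset}$, where $\emptyset$ is the empty matching. For $1\le i\le n-1$ let $\epsilon_i$ be the sequence with $1$ in position $i$, $-1$ in position $i+1$ and $0$ elsewhere. The functor $\mathcal F_i=\mathcal F_i^{(1)}:\mathcal C\to\mathcal C$ sends $\mathcal C(\lambda)$ to $\mathcal C(\lambda-\epsilon_i)$.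 It is zero on $\mathcal C(\lambda)$ if $\lambda-\epsilon_i$ is not admissible. Otherwise it is there the tensor product over $H_\lambda$ with the bimodule of the flat tangle that has bottom endpoints $s(\lambda)$ and top endpoints $s(\lambda-\epsilon_i)$, is vertical away from the positions $i,i+1$, and near them is: a line from $i$ to $i+1$ if $(\lambda_i,\lambda_{i+1})=(1,0)$, a line from $i+1$ to $i$ if $(2,1)$, a cup joining the top endpoints $i,i+1$ if $(2,0)$, a cap joining the bottom endpoints $i,i+1$ if $(1,1)$. The functor $\mathcal F_i^{(2)}:\mathcal C\to\mathcal C$ sends $\mathcal C(\lambda)$ to $\mathcal C(\lambda-2\epsilon_i)$; it is the equivalence given by $H_\lambda=H_{\lambda-2\epsilon_i}$ if $(\lambda_i,\lambda_{i+1})=(2,0)$, and zero otherwise. **Proposition.** Every balanced indecomposable projective of $\mathcal C$ is isomorphic in $\mathcal C$ to $$\mathcal F_{i_r}^{(j_r)}\cdots\mathcal F_{i_2}^{(j_2)}\mathcal F_{i_1}^{(j_1)}\,Q_{2\omega_k}$$ for some $r\ge 0$ and some sequences $i_1,\dots,i_r\in\{1,\dots,n-1\}$ and $j_1,\dots,j_r\in\{1,2\}$.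 -/

import Mathlib

/-!
Arc rings, their bimodules for flat tangles, and the categories and functors built from them.

Conventions.  `A = ℤ[X]/(X²)` with `1` in degree `-1` and `X` in degree `1`; multiplication
`m : A ⊗ A → A`, comultiplication `Δ(1) = 1 ⊗ X + X ⊗ 1`, `Δ(X) = X ⊗ X`.  The associated
two-dimensional TQFT sends a closed one-manifold to `A^{⊗ circles}`.

Combinatorial model.  A closed one-manifold is recorded by a finite set `V` of strands (short
pieces of the curve, together meeting every circle) and the permutation of `V` sending each strand
to the next one along the orientation; circles are the cycles of the permutation.
`A^{⊗ circles}` is the quotient of `ℤ[X_v | v ∈ V]` by `X_v² = 0` and by `X_u = X_v` for strands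
`u`, `v` on the same circle.
-/

namespace Arc

open MvPolynomial Equiv Equiv.Perm CategoryTheory
open scoped TensorProduct

noncomputable section

set_option linter.unusedSectionVars false

section Circles
variable {V : Type}

/-- The relations `X_v² = 0`, and `X_u = X_v` for related strands. -/
def circIdeal (r : Setoid V) : Ideal (MvPolynomial V ℤ) :=
  Ideal.span ({f | ∃ v, f = X v ^ 2} ∪ {f | ∃ u v, r u v ∧ f = X u - X v})

theorem sq_mem (r : Setoid V) (v : V) : (X v ^ 2 : MvPolynomial V ℤ) ∈ circIdeal r :=
  Ideal.subset_span (Or.inl ⟨v, rfl⟩)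

theorem sub_mem_of_rel {r : Setoid V} {u v : V} (h : r u v) :
    (X u - X v : MvPolynomial V ℤ) ∈ circIdeal r :=
  Ideal.subset_span (Or.inr ⟨u, v, h, rfl⟩)

theorem mul_mem_of_gens {W : Type} {r : Setoid W} {I : Ideal (MvPolynomial V ℤ)}
    (φ : MvPolynomial W ℤ →+* MvPolynomial V ℤ) {c : MvPolynomial V ℤ}
    (h1 : ∀ v, c * φ (X v) ^ 2 ∈ I) (h2 : ∀ u v, r u v → c * (φ (X u) - φ (X v)) ∈ I)
    {f : MvPolynomial W ℤ} (hf : f ∈ circIdeal r) : c * φ f ∈ I := by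
  refine Submodule.span_induction (p := fun f _ => c * φ f ∈ I) ?_ ?_ ?_ ?_ hf
  · rintro f (⟨v, rfl⟩ | ⟨u, v, h, rfl⟩)
    · simpa using h1 v
    · simpa using h2 u v h
  · simp
  · intro a b _ _ ha hb
    rw [map_add, mul_add]; exact I.add_mem ha hb
  · intro a b _ hb
    rw [smul_eq_mul, map_mul, mul_left_comm]; exact I.mul_mem_left _ hb

/-- The equivalence relation obtained from `r` by joining the classes of `p` and `q`. -/
def jn (r : Setoid V) (p q : V) : Setoid V where
  r u v := r u v ∨ (r u p ∧ r q v) ∨ (r u q ∧ r p v)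
  iseqv := by
    refine ⟨fun u => Or.inl (r.refl u), ?_, ?_⟩
    · rintro u v (h | ⟨h, h'⟩ | ⟨h, h'⟩)
      · exact Or.inl (r.symm h)
      · exact Or.inr (Or.inr ⟨r.symm h', r.symm h⟩)
      · exact Or.inr (Or.inl ⟨r.symm h', r.symm h⟩)
    · rintro u v w (h | ⟨h, h'⟩ | ⟨h, h'⟩) (k | ⟨k, k'⟩ | ⟨k, k'⟩)
      · exact Or.inl (r.trans h k)
      · exact Or.inr (Or.inl ⟨r.trans h k, k'⟩)
      · exact Or.inr (Or.inr ⟨r.trans h k, k'⟩)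
      · exact Or.inr (Or.inl ⟨h, r.trans h' k⟩)
      · exact Or.inl (r.trans h (r.trans (r.symm (r.trans h' k)) k'))
      · exact Or.inl (r.trans h k')
      · exact Or.inr (Or.inr ⟨h, r.trans h' k⟩)
      · exact Or.inl (r.trans h k')
      · exact Or.inl (r.trans h (r.trans (r.symm (r.trans h' k)) k'))

theorem le_jn (r : Setoid V) (p q : V) : r ≤ jn r p q := fun _ _ h => Or.inl h
theorem jn_rel (r : Setoid V) (p q : V) : jn r p q p q :=
  Or.inr (Or.inl ⟨r.refl p, r.refl q⟩)
theorem jn_le {r s : Setoid V} {p q : V} (h : r ≤ s) (hpq : s p q) : jn r p q ≤ s := by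
  rintro u v (k | ⟨k, k'⟩ | ⟨k, k'⟩)
  · exact h k
  · exact s.trans (h k) (s.trans hpq (h k'))
  · exact s.trans (h k) (s.trans (s.symm hpq) (h k'))

/-- Join the endpoints of all pairs in a list. -/
def conn (r : Setoid V) : List (V × V) → Setoid V
  | [] => r
  | e :: E => jn (conn r E) e.1 e.2

theorem le_conn (r : Setoid V) (E : List (V × V)) : r ≤ conn r E := by
  induction E with
  | nil => exact le_rfl
  | cons e E ih => exact ih.trans (le_jn _ _ _)

theorem conn_rel {r : Setoid V} {E : List (V × V)} {e : V × V} (he : e ∈ E) :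
    conn r E e.1 e.2 := by
  induction E with
  | nil => simp at he
  | cons e' E ih =>
    rcases List.mem_cons.1 he with rfl | h
    · exact jn_rel _ _ _
    · exact le_jn _ _ _ (ih h)

theorem conn_le {r s : Setoid V} {E : List (V × V)} (h : r ≤ s) (hE : ∀ e ∈ E, s e.1 e.2) :
    conn r E ≤ s := by
  induction E with
  | nil => exact h
  | cons e E ih =>
    exact jn_le (ih fun e' he' => hE e' (List.mem_cons_of_mem _ he')) (hE e List.mem_cons_self)

theorem conn_perm {r : Setoid V} {E E' : List (V × V)} (h : E.Perm E') : conn r E = conn r E' :=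
  le_antisymm (conn_le (le_conn _ _) fun _ he => conn_rel (h.mem_iff.1 he))
    (conn_le (le_conn _ _) fun _ he => conn_rel (h.mem_iff.2 he))

def edgeProd (E : List (V × V)) : MvPolynomial V ℤ := (E.map fun e => X e.1 + X e.2).prod

@[simp] theorem edgeProd_nil : edgeProd ([] : List (V × V)) = 1 := rfl
@[simp] theorem edgeProd_cons (e : V × V) (E : List (V × V)) :
    edgeProd (e :: E) = (X e.1 + X e.2) * edgeProd E := by simp [edgeProd]
theorem edgeProd_append (E E' : List (V × V)) :
    edgeProd (E ++ E') = edgeProd E * edgeProd E' := by simp [edgeProd]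
theorem edgeProd_perm {E E' : List (V × V)} (h : E.Perm E') : edgeProd E = edgeProd E' :=
  (h.map _).prod_eq

theorem edgeProd_sub_mem (r : Setoid V) (E : List (V × V)) {u v : V} (h : conn r E u v) :
    edgeProd E * (X u - X v) ∈ circIdeal r := by
  induction E generalizing u v with
  | nil => simpa using sub_mem_of_rel (r := r) h
  | cons e E ih =>
    obtain ⟨p, q⟩ := e
    simp only [edgeProd_cons]
    rcases h with h | ⟨h, h'⟩ | ⟨h, h'⟩
    · rw [mul_assoc]; exact Ideal.mul_mem_left _ _ (ih h)
    · have e1 : (X p + X q) * edgeProd E * (X u - X v) =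
        (X p + X q) * (edgeProd E * (X u - X p)) + (X p + X q) * (edgeProd E * (X q - X v))
          + edgeProd E * X p ^ 2 - edgeProd E * X q ^ 2 := by ring
      rw [e1]
      exact sub_mem (add_mem (add_mem (Ideal.mul_mem_left _ _ (ih h))
        (Ideal.mul_mem_left _ _ (ih h'))) (Ideal.mul_mem_left _ _ (sq_mem _ _)))
        (Ideal.mul_mem_left _ _ (sq_mem _ _))
    · have e1 : (X p + X q) * edgeProd E * (X u - X v) =
        (X p + X q) * (edgeProd E * (X u - X q)) + (X p + X q) * (edgeProd E * (X p - X v))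
          + edgeProd E * X q ^ 2 - edgeProd E * X p ^ 2 := by ring
      rw [e1]
      exact sub_mem (add_mem (add_mem (Ideal.mul_mem_left _ _ (ih h))
        (Ideal.mul_mem_left _ _ (ih h'))) (Ideal.mul_mem_left _ _ (sq_mem _ _)))
        (Ideal.mul_mem_left _ _ (sq_mem _ _))

theorem mul_mem_of_jn {r : Setoid V} {u v : V} {f : MvPolynomial V ℤ}
    (hf : f ∈ circIdeal (jn r u v)) : (X u + X v) * f ∈ circIdeal r := by
  refine mul_mem_of_gens (RingHom.id _) (fun w => Ideal.mul_mem_left _ _ (sq_mem _ _)) ?_ hf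
  intro a b h
  simpa using edgeProd_sub_mem r [(u, v)] h

theorem exists_edge {r : Setoid V} {E : List (V × V)} {u v : V} (h : conn r E u v)
    (hr : ¬ r u v) : ∃ e E', E.Perm (e :: E') ∧
      ((conn r E' u e.1 ∧ conn r E' e.2 v) ∨ (conn r E' u e.2 ∧ conn r E' e.1 v)) := by
  induction E with
  | nil => exact absurd h hr
  | cons e E ih =>
    by_cases h' : conn r E u v
    · obtain ⟨e', E', hp, hc⟩ := ih h'
      refine ⟨e', e :: E', (hp.cons e).trans (List.Perm.swap _ _ _), ?_⟩
      rcases hc with ⟨a, b⟩ | ⟨a, b⟩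
      · exact Or.inl ⟨le_jn _ _ _ a, le_jn _ _ _ b⟩
      · exact Or.inr ⟨le_jn _ _ _ a, le_jn _ _ _ b⟩
    · exact ⟨e, E, List.Perm.refl _, h.resolve_left h'⟩

open Classical in
theorem edge_lemma (n : ℕ) : ∀ (r : Setoid V) (E E' : List (V × V)), E.length = n →
    conn r E = conn r E' →
    (∀ w, E.countP (fun e => conn r E w e.1) = E'.countP (fun e => conn r E w e.1)) →
    edgeProd E - edgeProd E' ∈ circIdeal r := by
  induction n with
  | zero =>
    intro r E E' hn _ hc
    obtain rfl := List.length_eq_zero_iff.1 hn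
    have : E' = [] := by
      rcases E' with _ | ⟨e, E'⟩
      · rfl
      · have := hc e.1
        rw [List.countP_nil, List.countP_cons_of_pos (by simp)] at this
        omega
    simp [this]
  | succ n ih =>
    intro r E E' hn hconn hc
    by_cases hE : ∃ e ∈ E, ¬ r e.1 e.2
    · obtain ⟨⟨u, v⟩, he, hr⟩ := hE
      have hp := List.perm_cons_erase he
      set E1 := E.erase (u, v)
      have huv : conn r E' u v := by rw [← hconn]; exact conn_rel he
      obtain ⟨⟨p, q⟩, E2, hp', hpq⟩ := exists_edge huv hr
      have c1 : conn r E = conn (jn r u v) E1 := by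
        rw [conn_perm hp]
        exact le_antisymm (jn_le (conn_le ((le_jn _ _ _).trans (le_conn _ _)) fun _ h => conn_rel h)
            (le_conn _ _ (jn_rel _ _ _)))
          (conn_le (jn_le ((le_conn _ _).trans (le_jn _ _ _)) (jn_rel _ _ _))
            fun _ h => le_jn _ _ _ (conn_rel h))
      have c2 : conn r E' = conn (jn r u v) E2 := by
        have hle : conn r E2 ≤ conn (jn r u v) E2 :=
          conn_le ((le_jn _ _ _).trans (le_conn _ _)) fun _ h => conn_rel h
        have huv' : conn (jn r u v) E2 u v := le_conn _ _ (jn_rel _ _ _)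
        rw [conn_perm hp']
        refine le_antisymm (jn_le hle ?_) (conn_le (jn_le ((le_conn _ _).trans (le_jn _ _ _)) ?_)
            fun _ h => le_jn _ _ _ (conn_rel h))
        · rcases hpq with ⟨a, b⟩ | ⟨a, b⟩
          · exact Setoid.trans' _ (Setoid.symm' _ (hle a)) (Setoid.trans' _ huv' (Setoid.symm' _ (hle b)))
          · exact Setoid.trans' _ (hle b) (Setoid.trans' _ (Setoid.symm' _ huv') (hle a))
        · rcases hpq with ⟨a, b⟩ | ⟨a, b⟩
          · exact Or.inr (Or.inl ⟨a, b⟩)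
          · exact Or.inr (Or.inr ⟨a, b⟩)
      have hpqc : conn r E' p q := conn_rel (hp'.mem_iff.2 List.mem_cons_self)
      have hup : conn r E' u p := by
        have hle : conn r E2 ≤ conn r E' := by
          rw [conn_perm hp']; exact le_jn _ _ _
        rcases hpq with ⟨a, b⟩ | ⟨a, b⟩
        · exact hle a
        · exact Setoid.trans' _ (hle a) (Setoid.symm' _ hpqc)
      have key := ih (jn r u v) E1 E2 (by have := hp.length_eq; simp at this; omega)
        (by rw [← c1, ← c2, hconn]) (by
          intro w
          have h1 := hc w
          rw [hp.countP_eq, hp'.countP_eq, List.countP_cons, List.countP_cons] at h1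
          have : conn r E w u ↔ conn r E w p := by
            rw [hconn]
            exact ⟨fun h => Setoid.trans' _ h hup, fun h => Setoid.trans' _ h (Setoid.symm' _ hup)⟩
          simp only [this] at h1
          rw [← c1]; omega)
      have k1 := mul_mem_of_jn key
      rw [edgeProd_perm hp, edgeProd_perm hp', edgeProd_cons, edgeProd_cons]
      have k2 : (X u + X v) * edgeProd E2 - (X p + X q) * edgeProd E2 ∈ circIdeal r := by
        rcases hpq with ⟨a, b⟩ | ⟨a, b⟩
        · have := sub_mem (edgeProd_sub_mem r E2 a) (edgeProd_sub_mem r E2 b)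
          convert this using 1; ring
        · have := sub_mem (edgeProd_sub_mem r E2 a) (edgeProd_sub_mem r E2 b)
          convert this using 1; ring
      convert add_mem k1 k2 using 1
      ring
    · push Not at hE
      have c1 : conn r E = r := le_antisymm (conn_le le_rfl hE) (le_conn _ _)
      have hE' : ∀ e ∈ E', r e.1 e.2 := by
        intro e he
        rw [← c1, hconn]; exact conn_rel he
      have hval : ∀ (F : List (V × V)), (∀ e ∈ F, r e.1 e.2) →
          Ideal.Quotient.mk (circIdeal r) (edgeProd F) =
          ((F.map fun e => (Quotient.mk r e.1)).map fun c =>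
            Ideal.Quotient.mk (circIdeal r) (X c.out + X c.out)).prod := by
        intro F hF
        rw [edgeProd, map_list_prod, List.map_map, List.map_map]
        congr 1
        refine List.map_congr_left fun e he => ?_
        have h1 : r e.1 (Quotient.mk r e.1).out := Setoid.symm' _ (Quotient.mk_out e.1)
        simp only [Function.comp_apply]
        rw [Ideal.Quotient.eq]
        have := add_mem (sub_mem_of_rel h1) (sub_mem_of_rel (Setoid.trans' _ (Setoid.symm' _ (hF e he)) h1))
        convert this using 1; ring
      rw [← Ideal.Quotient.eq, hval E hE, hval E' hE']
      refine List.Perm.prod_eq (List.Perm.map _ ?_)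
      rw [List.perm_iff_count]
      intro c
      induction c using Quotient.inductionOn with
      | h w =>
        have := hc w
        rw [c1] at this
        rw [List.count_eq_countP, List.count_eq_countP, List.countP_map, List.countP_map]
        convert this using 2
        all_goals
          funext e
          simp only [Function.comp_apply, beq_eq_decide, decide_eq_decide]
          exact Quotient.eq.trans ⟨Setoid.symm' _, Setoid.symm' _⟩

end Circles

section Counting
variable {V W : Type}

/-- The number of classes of `r` that meet `O`. -/
def numCl (r : Setoid V) (O : Set V) : ℕ := (Quotient.mk r '' O).ncard

theorem numCl_congr {r : Setoid V} {r' : Setoid W} {O : Set V} {O' : Set W}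
    (f : V → W) (hf : ∀ v ∈ O, f v ∈ O') (h : ∀ u ∈ O, ∀ v ∈ O, r u v ↔ r' (f u) (f v))
    (hs : ∀ w ∈ O', ∃ v ∈ O, r' (f v) w) : numCl r O = numCl r' O' := by
  classical
  refine Set.ncard_congr (fun c _ => Quotient.mk r' (f (if hc : c ∈ Quotient.mk r '' O then hc.choose else c.out))) ?_ ?_ ?_
  · intro c hc
    simp only [hc, dif_pos]
    exact ⟨_, hf _ hc.choose_spec.1, rfl⟩
  · intro c d hc hd hcd
    simp only [hc, hd, dif_pos] at hcd
    rw [← hc.choose_spec.2, ← hd.choose_spec.2]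
    exact Quotient.sound ((h _ hc.choose_spec.1 _ hd.choose_spec.1).2 (Quotient.exact hcd))
  · rintro _ ⟨w, hw, rfl⟩
    obtain ⟨v, hv, hvw⟩ := hs w hw
    refine ⟨Quotient.mk r v, ⟨v, hv, rfl⟩, ?_⟩
    have hc : Quotient.mk r v ∈ Quotient.mk r '' O := ⟨v, hv, rfl⟩
    simp only [hc, dif_pos]
    refine Quotient.sound (Setoid.trans' _ ?_ hvw)
    exact (h _ hc.choose_spec.1 _ hv).1 (Quotient.exact hc.choose_spec.2)

theorem numCl_union [Finite V] {r : Setoid V} {O₁ O₂ : Set V}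
    (h : ∀ u ∈ O₁, ∀ v ∈ O₂, ¬ r u v) : numCl r (O₁ ∪ O₂) = numCl r O₁ + numCl r O₂ := by
  rw [numCl, Set.image_union, Set.ncard_union_eq _ (Set.toFinite _) (Set.toFinite _)]
  · rfl
  · rw [Set.disjoint_left]
    rintro _ ⟨u, hu, rfl⟩ ⟨v, hv, hvu⟩
    exact h u hu v hv (Setoid.symm' _ (Quotient.exact hvu))

theorem numCl_jn [Finite V] {r : Setoid V} {O : Set V} {p q : V} (h : ¬ r p q) (hp : p ∈ O)
    (hq : q ∈ O) : numCl r O = numCl (jn r p q) O + 1 := by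
  have h1 : O = (O \ {v | r q v}) ∪ (O ∩ {v | r q v}) := by
    rw [Set.sdiff_union_inter]
  rw [h1, numCl_union (r := r), ← h1]
  · congr 1
    · refine numCl_congr id (fun v hv => hv.1) ?_ ?_
      · intro u hu v hv
        refine ⟨fun k => Or.inl k, ?_⟩
        rintro (k | ⟨k, k'⟩ | ⟨k, k'⟩)
        · exact k
        · exact absurd k' hv.2
        · exact absurd (Setoid.symm' _ k) hu.2
      · intro w hw
        by_cases k : r q w
        · exact ⟨p, ⟨hp, fun k => h (Setoid.symm' _ k)⟩, Or.inr (Or.inl ⟨r.refl _, k⟩)⟩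
        · exact ⟨w, ⟨hw, k⟩, Setoid.refl' _ _⟩
    · rw [numCl, Set.ncard_eq_one]
      refine ⟨Quotient.mk r q, ?_⟩
      ext c
      constructor
      · rintro ⟨v, hv, rfl⟩
        exact Quotient.sound (Setoid.symm' _ hv.2)
      · rintro rfl
        exact ⟨q, ⟨hq, r.refl _⟩, rfl⟩
  · rintro u ⟨_, hu⟩ v ⟨_, hv⟩ k
    exact hu (Setoid.trans' _ hv (Setoid.symm' _ k))

theorem numCl_jn_of_notMem {r : Setoid V} {O : Set V} {p q : V} (hO : ∀ u v, r u v → u ∈ O → v ∈ O)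
    (hp : p ∉ O) (hq : q ∉ O) : numCl r O = numCl (jn r p q) O := by
  refine numCl_congr id (fun v hv => hv) ?_ (fun w hw => ⟨w, hw, Setoid.refl' _ _⟩)
  intro u hu v hv
  refine ⟨fun k => Or.inl k, ?_⟩
  rintro (k | ⟨k, k'⟩ | ⟨k, k'⟩)
  · exact k
  · exact absurd (hO _ _ k hu) hp
  · exact absurd (hO _ _ k hu) hq

end Counting

section Saddles
variable {V : Type} [Fintype V] [DecidableEq V]

theorem cyc_le {g : Perm V} {s : Setoid V} (h : ∀ v, s v (g v)) : SameCycle.setoid g ≤ s := by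
  intro u v huv
  obtain ⟨n, -, rfl⟩ := SameCycle.exists_pow_eq' (f := g) huv
  clear huv
  induction n with
  | zero => exact s.refl u
  | succ n ih =>
    rw [pow_succ', Perm.mul_apply]
    exact s.trans ih (h _)

theorem cyc_step (g : Perm V) (v : V) : SameCycle.setoid g v (g v) := ⟨1, by simp⟩

theorem cyc_closed {g : Perm V} {O : Set V} (h : ∀ v ∈ O, g v ∈ O) {u v : V}
    (huv : SameCycle g u v) (hu : u ∈ O) : v ∈ O := by
  obtain ⟨n, -, rfl⟩ := huv.exists_pow_eq'
  clear huv
  induction n with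
  | zero => exact hu
  | succ n ih => rw [pow_succ', Perm.mul_apply]; exact h _ ih

theorem merge_aux {g : Perm V} {p q : V} (h : ¬ g.SameCycle p q) :
    (g * swap p q).SameCycle p q := by
  by_contra hc
  set g1 := g * swap p q with hg1
  have key : ∀ n : ℕ, g1.SameCycle p ((g ^ (n + 1)) q) := by
    intro n
    induction n with
    | zero =>
      refine ⟨1, ?_⟩
      simp [hg1]
    | succ n ih =>
      refine ih.trans ⟨1, ?_⟩
      have h1 : (g ^ (n + 1)) q ≠ p := fun e => h ⟨-((n : ℤ) + 1), by rw [← e, zpow_neg]; exact (g ^ (n+1)).symm_apply_apply q⟩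
      have h2 : (g ^ (n + 1)) q ≠ q := fun e => hc (by rw [e] at ih; exact ih)
      rw [zpow_one, hg1, Perm.mul_apply, swap_apply_of_ne_of_ne h1 h2, ← Perm.mul_apply, ← pow_succ']
  have := key (orderOf g - 1)
  rw [Nat.sub_add_cancel (orderOf_pos g), pow_orderOf_eq_one] at this
  exact hc this

theorem split_aux {g : Perm V} {p q : V} (hpq : p ≠ q) (h : g.SameCycle p q) :
    ¬ (g * swap p q).SameCycle p q := by
  classical
  have hex : ∃ k : ℕ, (g ^ (k + 1)) p = q := by
    obtain ⟨n, -, hn⟩ := h.exists_pow_eq'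
    rcases n with _ | n
    · exact absurd hn hpq
    · exact ⟨n, hn⟩
  set k := Nat.find hex
  have hk : (g ^ (k + 1)) p = q := Nat.find_spec hex
  have hmin : ∀ j < k, (g ^ (j + 1)) p ≠ q := fun j hj => Nat.find_min hex hj
  let S : Set V := {v | ∃ j ≤ k, (g ^ (j + 1)) p = v}
  have hpS : p ∉ S := by
    rintro ⟨j, hj, e⟩
    rcases hj.lt_or_eq with hj | rfl
    · refine hmin (k - (j + 1)) (by omega) ?_
      rw [← hk]
      conv_rhs => rw [show k + 1 = (k - (j + 1) + 1) + (j + 1) by omega, pow_add, Perm.mul_apply, e]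
    · exact hpq (e.symm.trans hk)
  have hcl : ∀ v ∈ S, (g * swap p q) v ∈ S := by
    rintro v ⟨j, hj, rfl⟩
    by_cases hq : (g ^ (j + 1)) p = q
    · rw [hq]; exact ⟨0, Nat.zero_le _, by simp⟩
    · have hne : (g ^ (j + 1)) p ≠ p := fun e => hpS ⟨j, hj, e⟩
      have : j ≠ k := by rintro rfl; exact hq hk
      refine ⟨j + 1, by omega, ?_⟩
      rw [Perm.mul_apply, swap_apply_of_ne_of_ne hne hq, ← Perm.mul_apply, ← pow_succ']
  intro hc
  exact hpS (cyc_closed hcl hc.symm ⟨k, le_rfl, hk⟩)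

theorem cyc_merge {g : Perm V} {p q : V} (h : ¬ g.SameCycle p q) :
    SameCycle.setoid (g * swap p q) = jn (SameCycle.setoid g) p q := by
  apply le_antisymm
  · refine cyc_le fun v => ?_
    by_cases hp : v = p
    · subst hp
      simp only [Perm.mul_apply, swap_apply_left]
      exact Setoid.trans' _ (jn_rel _ _ _) (le_jn _ _ _ (cyc_step g _))
    · by_cases hq : v = q
      · subst hq
        simp only [Perm.mul_apply, swap_apply_right]
        exact Setoid.trans' _ (Setoid.symm' _ (jn_rel _ _ _)) (le_jn _ _ _ (cyc_step g _))
      · rw [Perm.mul_apply, swap_apply_of_ne_of_ne hp hq]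
        exact le_jn _ _ _ (cyc_step g _)
  · have hm : SameCycle.setoid (g * swap p q) p q := merge_aux h
    refine jn_le (cyc_le fun v => ?_) hm
    have hs := cyc_step (g * swap p q)
    by_cases hp : v = p
    · subst hp
      have := hs q
      simp only [Perm.mul_apply, swap_apply_right] at this
      exact Setoid.trans' _ hm this
    · by_cases hq : v = q
      · subst hq
        have := hs p
        simp only [Perm.mul_apply, swap_apply_left] at this
        exact Setoid.trans' _ (Setoid.symm' _ hm) this
      · have := hs v
        rwa [Perm.mul_apply, swap_apply_of_ne_of_ne hp hq] at this

theorem cyc_split {g : Perm V} {p q : V} (hpq : p ≠ q) (h : g.SameCycle p q) :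
    SameCycle.setoid g = jn (SameCycle.setoid (g * swap p q)) p q := by
  rw [← cyc_merge (split_aux hpq h), mul_assoc, swap_mul_self, mul_one]

open Classical in
/-- The value at `1 ⊗ ⋯ ⊗ 1` of a sequence of saddle cobordisms.  A saddle joining the strands `p` and
`q` of the curve `g` produces the curve `g * swap p q`: if `p`, `q` lie on different circles these
merge and the saddle acts by the multiplication of `A`, which sends `1 ⊗ 1` to `1`; if they lie on the
same circle it splits and the saddle acts by `Δ`, which sends `1` to `X_p + X_q`.  Both maps are linear
over multiplication by the `X_v`, so that their values at `1` determine them. -/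
def saddles : Perm V → List (V × V) → MvPolynomial V ℤ
  | _, [] => 1
  | g, e :: l => (if g.SameCycle e.1 e.2 then X e.1 + X e.2 else 1) * saddles (g * swap e.1 e.2) l

open Classical in
/-- The saddles in the sequence that split a circle. -/
def splits : Perm V → List (V × V) → List (V × V)
  | _, [] => []
  | g, e :: l => if g.SameCycle e.1 e.2 then e :: splits (g * swap e.1 e.2) l
      else splits (g * swap e.1 e.2) l

theorem saddles_eq (g : Perm V) (l : List (V × V)) : saddles g l = edgeProd (splits g l) := by
  induction l generalizing g with
  | nil => rfl
  | cons e l ih =>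
    rw [saddles, splits, ih]
    split_ifs <;> simp

theorem splits_subset (g : Perm V) (l : List (V × V)) : ∀ e ∈ splits g l, e ∈ l := by
  induction l generalizing g with
  | nil => simp [splits]
  | cons e l ih =>
    intro f hf
    rw [splits] at hf
    split_ifs at hf
    · rcases List.mem_cons.1 hf with rfl | h
      · simp
      · exact List.mem_cons_of_mem _ (ih _ _ h)
    · exact List.mem_cons_of_mem _ (ih _ _ hf)

/-- The curve after all the saddles. -/
def endPerm (g : Perm V) (l : List (V × V)) : Perm V := g * (l.map fun e => swap e.1 e.2).prod

theorem endPerm_cons (g : Perm V) (e : V × V) (l : List (V × V)) :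
    endPerm g (e :: l) = endPerm (g * swap e.1 e.2) l := by simp [endPerm, mul_assoc]

theorem conn_splits (g : Perm V) (l : List (V × V)) (hl : ∀ e ∈ l, e.1 ≠ e.2) :
    SameCycle.setoid g ≤ conn (SameCycle.setoid (endPerm g l)) (splits g l) ∧
    ∀ e ∈ l, conn (SameCycle.setoid (endPerm g l)) (splits g l) e.1 e.2 := by
  induction l generalizing g with
  | nil => simp [endPerm, splits, conn]
  | cons e l ih =>
    obtain ⟨h1, h2⟩ := ih (g * swap e.1 e.2) (fun e he => hl e (List.mem_cons_of_mem _ he))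
    rw [endPerm_cons]
    by_cases h : g.SameCycle e.1 e.2
    · rw [splits, if_pos h]
      constructor
      · rw [cyc_split (hl e (by simp)) h]
        exact jn_le (h1.trans (le_jn _ _ _)) (jn_rel _ _ _)
      · intro f hf
        rcases List.mem_cons.1 hf with rfl | hf
        · exact jn_rel _ _ _
        · exact le_jn _ _ _ (h2 f hf)
    · rw [cyc_merge h] at h1
      rw [splits, if_neg h]
      refine ⟨(le_jn _ _ _).trans h1, ?_⟩
      intro f hf
      rcases List.mem_cons.1 hf with rfl | hf
      · exact h1 (jn_rel _ _ _)
      · exact h2 f hf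

open Classical in
theorem count_splits (O : Set V) (g : Perm V) (l : List (V × V)) (hl : ∀ e ∈ l, e.1 ≠ e.2)
    (hlO : ∀ e ∈ l, e.1 ∈ O ↔ e.2 ∈ O) (hg : ∀ v ∈ O, g v ∈ O) :
    2 * (splits g l).countP (fun e => e.1 ∈ O) + numCl (SameCycle.setoid g) O =
      l.countP (fun e => e.1 ∈ O) + numCl (SameCycle.setoid (endPerm g l)) O := by
  induction l generalizing g with
  | nil => simp [endPerm, splits]
  | cons e l ih =>
    have he := hl e (by simp)
    have heO := hlO e (by simp)
    have hg' : ∀ v ∈ O, (g * swap e.1 e.2) v ∈ O := by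
      intro v hv
      rw [Perm.mul_apply]
      apply hg
      by_cases h1 : v = e.1
      · rw [h1, swap_apply_left, ← heO, ← h1]; exact hv
      · by_cases h2 : v = e.2
        · rw [h2, swap_apply_right, heO, ← h2]; exact hv
        · rwa [swap_apply_of_ne_of_ne h1 h2]
    have := ih (g * swap e.1 e.2) (fun e he => hl e (List.mem_cons_of_mem _ he))
      (fun e he => hlO e (List.mem_cons_of_mem _ he)) hg'
    rw [endPerm_cons, splits]
    by_cases hO : e.1 ∈ O
    · have hc : (e :: l).countP (fun e => e.1 ∈ O) = l.countP (fun e => e.1 ∈ O) + 1 :=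
        List.countP_cons_of_pos (by simpa using hO)
      split_ifs with h
      · have hc' : (e :: splits (g * swap e.1 e.2) l).countP (fun e => e.1 ∈ O) =
            (splits (g * swap e.1 e.2) l).countP (fun e => e.1 ∈ O) + 1 :=
          List.countP_cons_of_pos (by simpa using hO)
        have k := numCl_jn (r := SameCycle.setoid (g * swap e.1 e.2)) (split_aux he h) hO (heO.1 hO)
        rw [← cyc_split he h] at k
        omega
      · have k := numCl_jn (r := SameCycle.setoid g) h hO (heO.1 hO)
        rw [← cyc_merge h] at k
        omega
    · have hc : (e :: l).countP (fun e => e.1 ∈ O) = l.countP (fun e => e.1 ∈ O) :=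
        List.countP_cons_of_neg (by simpa using hO)
      have hc' : (e :: splits (g * swap e.1 e.2) l).countP (fun e => e.1 ∈ O) =
            (splits (g * swap e.1 e.2) l).countP (fun e => e.1 ∈ O) :=
          List.countP_cons_of_neg (by simpa using hO)
      split_ifs with h
      · have k := numCl_jn_of_notMem (r := SameCycle.setoid (g * swap e.1 e.2)) (O := O)
          (fun u v h hu => cyc_closed hg' h hu) hO (fun h => hO (heO.2 h))
        rw [← cyc_split he h] at k
        omega
      · have k := numCl_jn_of_notMem (r := SameCycle.setoid g) (O := O)
          (fun u v h hu => cyc_closed hg h hu) hO (fun h => hO (heO.2 h))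
        rw [← cyc_merge h] at k
        omega

theorem splits_eq_nil (g : Perm V) (l : List (V × V)) (hl : ∀ e ∈ l, e.1 ≠ e.2)
    (hd : l.Pairwise fun e f => f.1 ≠ e.1 ∧ f.1 ≠ e.2 ∧ f.2 ≠ e.1 ∧ f.2 ≠ e.2)
    (hf : ∀ e ∈ l, g e.1 = e.1 ∨ g e.2 = e.2) : splits g l = [] := by
  induction l generalizing g with
  | nil => rfl
  | cons e l ih =>
    rw [List.pairwise_cons] at hd
    have hne : ¬ g.SameCycle e.1 e.2 := by
      intro h
      rcases hf e (by simp) with k | k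
      · exact hl e (by simp) (h.eq_of_left k)
      · exact hl e (by simp) (h.eq_of_right k)
    rw [splits, if_neg hne]
    refine ih _ (fun e he => hl e (List.mem_cons_of_mem _ he)) hd.2 fun f hf' => ?_
    obtain ⟨h1, h2, h3, h4⟩ := hd.1 f hf'
    rw [Perm.mul_apply, Perm.mul_apply, swap_apply_of_ne_of_ne h1 h2,
      swap_apply_of_ne_of_ne h3 h4]
    exact hf f (List.mem_cons_of_mem _ hf')

end Saddles

section Contraction
variable {V S : Type} [Fintype V] [DecidableEq V] [Fintype S] [DecidableEq S]

/-- A fixed-point-free involution of the set of points `V`, matching points of opposite colours.  The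
colour is the parity of the position; it orients every arc. -/
structure Matching {V : Type} (col : V → Bool) where
  toPerm : Perm V
  invol : ∀ v, toPerm (toPerm v) = v
  col_ne : ∀ v, col (toPerm v) = !col v

variable {col : V → Bool}

/-- The closed curve obtained by gluing the arcs of `x`, placed above the points `V`, to the arcs of `z`,
placed below them: it leaves a point of colour `true` upwards along `x`, and a point of colour
`false` downwards along `z`. -/
def circ (x z : Matching col) : Perm V where
  toFun v := if col v then x.toPerm v else z.toPerm v
  invFun v := if col v then z.toPerm v else x.toPerm v
  left_inv v := by
    cases h : col v <;> simp [h, z.col_ne, x.col_ne, x.invol, z.invol]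
  right_inv v := by
    cases h : col v <;> simp [h, z.col_ne, x.col_ne, x.invol, z.invol]

theorem circ_apply (x z : Matching col) (v : V) :
    circ x z v = if col v then x.toPerm v else z.toPerm v := rfl

/-- The arcs of an involution, each oriented from colour `false` to colour `true`. -/
def arcs (col : V → Bool) (y : Perm V) : List (V × V) :=
  (Finset.univ.filter fun v => col v = false ∧ y v ≠ v).toList.map fun v => (v, y v)

/-- The value at `1` of the minimal cobordism that contracts a pair of mirror-image diagrams `y`, facing
each other, to the vertical lines, where `g` is the curve after the contraction; there is one saddle
for each arc of `y`. -/
def contr (col : V → Bool) (g y : Perm V) : MvPolynomial V ℤ := saddles (g * y) (arcs col y)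

theorem mem_arcs {y : Perm V} {e : V × V} :
    e ∈ arcs col y ↔ (col e.1 = false ∧ y e.1 ≠ e.1) ∧ e.2 = y e.1 := by
  obtain ⟨a, b⟩ := e
  simp only [arcs, List.mem_map, Finset.mem_toList, Finset.mem_filter, Finset.mem_univ, true_and,
    Prod.mk.injEq]
  constructor
  · rintro ⟨v, h, rfl, rfl⟩; exact ⟨h, rfl⟩
  · rintro ⟨h, rfl⟩; exact ⟨a, h, rfl, rfl⟩

theorem arcs_ne {y : Perm V} : ∀ e ∈ arcs col y, e.1 ≠ e.2 := by
  intro e he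
  rw [mem_arcs] at he
  rw [he.2]; exact he.1.2.symm

theorem prod_swap_aux {y : Perm V} (h1 : ∀ v, y (y v) = v)
    (h2 : ∀ v, y v ≠ v → col (y v) = !col v) (L : List V) (hL : L.Nodup)
    (hb : ∀ v ∈ L, col v = false ∧ y v ≠ v) (u : V) :
    ((L.map fun v => swap v (y v)).prod : Perm V) u = if u ∈ L ∨ y u ∈ L then y u else u := by
  induction L with
  | nil => simp
  | cons v L ih =>
    rw [List.nodup_cons] at hL
    have ih := ih hL.2 (fun w hw => hb w (List.mem_cons_of_mem _ hw))
    obtain ⟨hv, hyv⟩ := hb v (by simp)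
    have hcy := h2 v hyv
    rw [List.map_cons, List.prod_cons, Perm.mul_apply, ih]
    have hne : ∀ w ∈ L, w ≠ v ∧ w ≠ y v := by
      intro w hw
      refine ⟨fun e => hL.1 (e ▸ hw), fun e => ?_⟩
      have := (hb w (List.mem_cons_of_mem _ hw)).1
      rw [e, hcy, hv] at this
      simp at this
    by_cases hu : u ∈ L ∨ y u ∈ L
    · rw [if_pos hu, if_pos (by simp only [List.mem_cons]; tauto)]
      apply swap_apply_of_ne_of_ne
      · rcases hu with hu | hu
        · intro e; exact (hne u hu).2 (by rw [← e, h1])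
        · exact (hne _ hu).1
      · rcases hu with hu | hu
        · intro e; exact (hne u hu).1 (y.injective e)
        · exact (hne _ hu).2
    · rw [if_neg hu]
      by_cases huv : u = v
      · subst huv; simp
      · by_cases huy : u = y v
        · subst huy; simp [h1]
        · rw [swap_apply_of_ne_of_ne huv huy, if_neg]
          simp only [List.mem_cons]
          rintro ((h | h) | (h | h))
          · exact huv h
          · exact hu (Or.inl h)
          · exact huy (by rw [← h, h1])
          · exact hu (Or.inr h)

theorem fin_arcs {y : Perm V} (h1 : ∀ v, y (y v) = v)
    (h2 : ∀ v, y v ≠ v → col (y v) = !col v) (g : Perm V) : endPerm (g * y) (arcs col y) = g := by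
  have : (((arcs col y).map fun e => swap e.1 e.2).prod : Perm V) = y := by
    ext u
    rw [arcs, List.map_map]
    have := prod_swap_aux (col := col) h1 h2
      (Finset.univ.filter fun v => col v = false ∧ y v ≠ v).toList (Finset.nodup_toList _)
      (by simp) u
    refine Eq.trans this ?_
    simp only [Finset.mem_toList, Finset.mem_filter, Finset.mem_univ, true_and]
    split_ifs with h
    · rfl
    · by_contra hne
      have hne : y u ≠ u := fun e => hne e.symm
      apply h
      have hc := h2 u hne
      cases hu : col u
      · exact Or.inl ⟨rfl, hne⟩
      · exact Or.inr ⟨by rw [hc, hu]; rfl, fun e => hne (y.injective e)⟩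
  rw [endPerm, this, mul_assoc]
  have : y * y = 1 := by ext v; simp [h1]
  rw [this, mul_one]

theorem arcs_pairwise {y : Perm V}
    (h2 : ∀ v, y v ≠ v → col (y v) = !col v) :
    (arcs col y).Pairwise fun e f => f.1 ≠ e.1 ∧ f.1 ≠ e.2 ∧ f.2 ≠ e.1 ∧ f.2 ≠ e.2 := by
  rw [arcs, List.pairwise_map]
  refine List.Pairwise.imp_of_mem ?_ (Finset.nodup_toList _)
  intro a b ha hb hab
  simp only [Finset.mem_toList, Finset.mem_filter, Finset.mem_univ, true_and] at ha hb
  have ca := h2 a ha.2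
  have cb := h2 b hb.2
  rw [ha.1] at ca
  rw [hb.1] at cb
  refine ⟨hab.symm, fun e => ?_, fun e => ?_, fun e => hab (y.injective e).symm⟩
  · dsimp only at e
    rw [← e, hb.1] at ca; simp at ca
  · dsimp only at e
    rw [e, ha.1] at cb; simp at cb

/-- The situation in which a contraction takes place.  The points `S` sit inside `V` by `ι`; the
diagrams `x'` and `x` agree outside `S`, and on `S` they consist of the arcs of `b` and of `b'`
respectively.  The curve `q` on the points `S` is glued from `b` and `b'`; contracting the arcs of `b`
in it with the arcs of `b` in `x'` replaces `b` by `b'`. -/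
structure IsPort (ι : S → V) (x x' : Matching col) (b b' : S → S) (y : Perm V) (q : Perm S) :
    Prop where
  inj : Function.Injective ι
  hy : ∀ s, y (ι s) = ι (b s)
  hy' : ∀ v, (∀ s, ι s ≠ v) → y v = v
  hx : ∀ s, x.toPerm (ι s) = ι (b' s)
  hx' : ∀ s, x'.toPerm (ι s) = ι (b s)
  hxx : ∀ v, (∀ s, ι s ≠ v) → x'.toPerm v = x.toPerm v
  hq : ∀ s, q s = if col (ι s) then b' s else b s

namespace IsPort
variable {ι : S → V} {x x' : Matching col} {b b' : S → S} {y : Perm V} {q : Perm S}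

theorem bb (h : IsPort ι x x' b b' y q) (s : S) : b (b s) = s :=
  h.inj (by rw [← h.hx', ← h.hx', x'.invol])
theorem bb' (h : IsPort ι x x' b b' y q) (s : S) : b' (b' s) = s :=
  h.inj (by rw [← h.hx, ← h.hx, x.invol])
theorem colb (h : IsPort ι x x' b b' y q) (s : S) : col (ι (b s)) = !col (ι s) := by
  rw [← h.hx', x'.col_ne]
theorem colb' (h : IsPort ι x x' b b' y q) (s : S) : col (ι (b' s)) = !col (ι s) := by
  rw [← h.hx, x.col_ne]
theorem bne (h : IsPort ι x x' b b' y q) (s : S) : b s ≠ s := fun e => by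
  have := h.colb s
  rw [e] at this
  cases hc : col (ι s) <;> simp [hc] at this
theorem y_invol (h : IsPort ι x x' b b' y q) (v : V) : y (y v) = v := by
  by_cases hv : ∃ s, ι s = v
  · obtain ⟨s, rfl⟩ := hv
    rw [h.hy, h.hy, h.bb]
  · push Not at hv
    rw [h.hy' v hv, h.hy' v hv]
theorem y_ne_iff (h : IsPort ι x x' b b' y q) (v : V) : y v ≠ v ↔ ∃ s, ι s = v := by
  constructor
  · intro hv
    by_contra hc
    push Not at hc
    exact hv (h.hy' v hc)
  · rintro ⟨s, rfl⟩ e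
    rw [h.hy] at e
    exact h.bne s (h.inj e)
theorem y_col (h : IsPort ι x x' b b' y q) (v : V) (hv : y v ≠ v) : col (y v) = !col v := by
  obtain ⟨s, rfl⟩ := (h.y_ne_iff v).1 hv
  rw [h.hy, h.colb]

theorem unit (h : IsPort ι x x' b b' y q) (z : Matching col) (hbb : ∀ s, b s = b' s) :
    contr col (circ x z) y = 1 := by
  rw [contr, saddles_eq, splits_eq_nil, edgeProd_nil]
  · exact arcs_ne
  · exact arcs_pairwise h.y_col
  · intro e he
    rw [mem_arcs] at he
    obtain ⟨⟨hc, hm⟩, -⟩ := he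
    left
    obtain ⟨s, hs⟩ := (h.y_ne_iff _).1 hm
    rw [← hs, Perm.mul_apply, h.hy, circ_apply, h.colb, hs, hc]
    simp only [Bool.not_false, if_true]
    rw [h.hx, ← hbb, h.bb, hs]

def E (_ : IsPort ι x x' b b' y q) (z : Matching col) : List (V × V) :=
  splits (circ x z * y) (arcs col y)

theorem contr_eq (h : IsPort ι x x' b b' y q) (z : Matching col) :
    contr col (circ x z) y = edgeProd (h.E z) := saddles_eq _ _

theorem E_mem (h : IsPort ι x x' b b' y q) (z : Matching col) {e : V × V} (he : e ∈ h.E z) :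
    ∃ s, e = (ι s, ι (b s)) := by
  have := splits_subset _ _ _ he
  rw [mem_arcs] at this
  obtain ⟨⟨-, hm⟩, h2⟩ := this
  obtain ⟨s, hs⟩ := (h.y_ne_iff _).1 hm
  refine ⟨s, Prod.ext hs.symm ?_⟩
  rw [h2, ← hs, h.hy]

theorem conn_arc (h : IsPort ι x x' b b' y q) (z : Matching col) (s : S) :
    conn (SameCycle.setoid (circ x z)) (h.E z) (ι s) (ι (b s)) := by
  have key := (conn_splits (circ x z * y) (arcs col y) arcs_ne).2
  rw [fin_arcs h.y_invol h.y_col] at key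
  cases hc : col (ι s)
  · have := key (ι s, ι (b s)) (mem_arcs.2 ⟨⟨hc, (h.y_ne_iff _).2 ⟨s, rfl⟩⟩, (h.hy s).symm⟩)
    exact this
  · have := key (ι (b s), ι s) (mem_arcs.2 ⟨⟨by simp [h.colb, hc], (h.y_ne_iff _).2 ⟨_, rfl⟩⟩,
      by simp [h.hy, h.bb]⟩)
    exact Setoid.symm' _ this

end IsPort

theorem cyc_left (x z : Matching col) (v : V) :
    SameCycle.setoid (circ x z) v (x.toPerm v) := by
  cases hc : col v
  · have := cyc_step (circ x z) (x.toPerm v)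
    rw [circ_apply, x.col_ne, hc] at this
    simp only [Bool.not_false, if_true, x.invol] at this
    exact Setoid.symm' _ this
  · have := cyc_step (circ x z) v
    rw [circ_apply, hc] at this
    simpa using this

theorem cyc_right (x z : Matching col) (v : V) :
    SameCycle.setoid (circ x z) v (z.toPerm v) := by
  cases hc : col v
  · have := cyc_step (circ x z) v
    rw [circ_apply, hc] at this
    simpa using this
  · have := cyc_step (circ x z) (z.toPerm v)
    rw [circ_apply, z.col_ne, hc] at this
    simp only [Bool.not_true, z.invol] at this
    exact Setoid.symm' _ (by simpa using this)

theorem cyc_circ_le {x z : Matching col} {r : Setoid V} (hx : ∀ v, r v (x.toPerm v))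
    (hz : ∀ v, r v (z.toPerm v)) : SameCycle.setoid (circ x z) ≤ r := by
  refine cyc_le fun v => ?_
  rw [circ_apply]
  split_ifs
  · exact hx v
  · exact hz v

namespace IsPort
variable {ι : S → V} {x x' : Matching col} {b b' : S → S} {y : Perm V} {q : Perm S}

theorem cyc_le_conn (h : IsPort ι x x' b b' y q) (z : Matching col) :
    SameCycle.setoid (circ x' z) ≤ conn (SameCycle.setoid (circ x z)) (h.E z) := by
  refine cyc_circ_le (fun v => ?_) (fun v => le_conn _ _ (cyc_right x z v))
  by_cases hv : ∃ s, ι s = v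
  · obtain ⟨s, rfl⟩ := hv
    rw [h.hx']; exact h.conn_arc z s
  · push Not at hv
    rw [h.hxx v hv]; exact le_conn _ _ (cyc_left x z v)

theorem q_le (h : IsPort ι x x' b b' y q) {r : Setoid V} (hb : ∀ s, r (ι s) (ι (b s)))
    (hb' : ∀ s, r (ι s) (ι (b' s))) : SameCycle.setoid q ≤ r.comap ι := by
  refine cyc_le fun s => ?_
  rw [h.hq]
  split_ifs
  · exact hb' s
  · exact hb s

theorem q_le_conn (h : IsPort ι x x' b b' y q) (z : Matching col) :
    SameCycle.setoid q ≤ (conn (SameCycle.setoid (circ x z)) (h.E z)).comap ι :=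
  h.q_le (h.conn_arc z) fun s => by
    rw [← h.hx]; exact le_conn _ _ (cyc_left x z _)

theorem numCl_eq (h : IsPort ι x x' b b' y q) (z : Matching col) (O : Set V)
    (hx : ∀ v ∈ O, x.toPerm v ∈ O) (hy : ∀ v ∈ O, y v ∈ O) :
    numCl (SameCycle.setoid (circ x z * y)) O =
      numCl (SameCycle.setoid q) (ι ⁻¹' O) + numCl (SameCycle.setoid (circ x' z)) O := by
  classical
  set σ := circ x z * y with hσ
  set τ := circ x' z with hτ
  let B : Set V := {v | ∃ s, ι s = v ∧ col (ι s) = false}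
  have hB : ∀ s, col (ι s) = false → σ (ι s) = ι (b' (b s)) := by
    intro s hs
    rw [hσ, Perm.mul_apply, h.hy, circ_apply, h.colb, hs]
    simp [h.hx]
  have hBcl : ∀ v ∈ B, σ v ∈ B := by
    rintro _ ⟨s, rfl, hs⟩
    rw [hB s hs]
    exact ⟨_, rfl, by rw [h.colb', h.colb, hs]; rfl⟩
  have hW : ∀ v, v ∉ B → σ v ∉ B ∧ (σ v = τ v ∨ σ v = τ (τ v)) := by
    intro v hv
    by_cases hr : ∃ s, ι s = v
    · obtain ⟨s, rfl⟩ := hr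
      have hc : col (ι s) = true := by
        cases hc : col (ι s)
        · exact absurd ⟨s, rfl, hc⟩ hv
        · rfl
      have e1 : σ (ι s) = z.toPerm (ι (b s)) := by
        rw [hσ, Perm.mul_apply, h.hy, circ_apply, h.colb, hc]; simp
      have e2 : τ (ι s) = ι (b s) := by
        rw [hτ, circ_apply, hc]; simp [h.hx']
      have e3 : τ (ι (b s)) = z.toPerm (ι (b s)) := by
        rw [hτ, circ_apply, h.colb, hc]; simp
      refine ⟨?_, Or.inr (by rw [e1, e2, e3])⟩
      rintro ⟨t, ht, ht'⟩
      rw [ht, e1, z.col_ne, h.colb, hc] at ht'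
      simp at ht'
    · have hr' : ∀ s, ι s ≠ v := fun s hs => hr ⟨s, hs⟩
      have e1 : σ v = circ x z v := by rw [hσ, Perm.mul_apply, h.hy' v hr']
      have e2 : τ v = circ x z v := by
        rw [hτ, circ_apply, circ_apply, h.hxx v hr']
      refine ⟨?_, Or.inl (by rw [e1, e2])⟩
      rintro ⟨t, ht, ht'⟩
      rw [e1, circ_apply] at ht
      cases hc : col v
      · rw [hc] at ht
        rw [ht] at ht'
        simp [z.col_ne, hc] at ht'
      · rw [hc] at ht
        simp only [if_true] at ht
        exact hr' (b' t) (by rw [← h.hx, ht, x.invol])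
  have hO : O = (O ∩ B) ∪ (O \ B) := (Set.inter_union_sdiff O B).symm
  conv_lhs => rw [hO]
  rw [numCl_union]
  · congr 1
    · -- circles through the contracted black points
      let f : S → S := fun s => if col (ι s) then b' s else s
      have hf : ∀ s, col (ι (f s)) = false := by
        intro s
        cases hc : col (ι s) <;> simp [f, hc, h.colb']
      have hqf : ∀ s, SameCycle.setoid q s (f s) := by
        intro s
        cases hc : col (ι s)
        · simp only [f, hc]; exact Setoid.refl' _ _
        · have := cyc_step q s
          rw [h.hq, hc] at this
          simpa [f, hc] using this
      symm
      refine numCl_congr (fun s => ι (f s)) ?_ ?_ ?_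
      · intro s hs
        refine ⟨?_, f s, rfl, hf s⟩
        cases hc : col (ι s)
        · simpa [f, hc] using hs
        · simp only [f, hc, if_true]
          rw [← h.hx]; exact hx _ hs
      · intro s _ t _
        constructor
        · have : SameCycle.setoid q ≤ (SameCycle.setoid σ).comap (fun s => ι (f s)) := by
            refine cyc_le fun s => ?_
            change SameCycle.setoid σ (ι (f s)) (ι (f (q s)))
            cases hc : col (ι s)
            · have e : f (q s) = b' (b s) := by simp [f, h.hq, hc, h.colb]
              have e' : f s = s := by simp [f, hc]
              rw [e, e', ← hB s hc]
              exact cyc_step σ _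
            · have e : f (q s) = f s := by simp [f, h.hq, hc, h.colb']
              rw [e]
          exact fun k => this k
        · intro k
          have hcl : ∀ v ∈ {v | ∃ w, ι w = v ∧ col (ι w) = false ∧ SameCycle.setoid q (f s) w},
              σ v ∈ {v | ∃ w, ι w = v ∧ col (ι w) = false ∧ SameCycle.setoid q (f s) w} := by
            rintro _ ⟨w, rfl, hw, hsw⟩
            refine ⟨b' (b w), (hB w hw).symm, by rw [h.colb', h.colb, hw]; rfl, ?_⟩
            have e : q (q w) = b' (b w) := by
              rw [h.hq w, hw]
              simp [h.hq, h.colb, hw]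
            rw [← e]
            exact Setoid.trans' _ hsw (Setoid.trans' _ (cyc_step q _) (cyc_step q _))
          obtain ⟨w, hw, -, hsw⟩ := cyc_closed hcl k ⟨f s, rfl, hf s, Setoid.refl' _ _⟩
          rw [h.inj hw] at hsw
          exact Setoid.trans' _ (hqf s) (Setoid.trans' _ hsw (Setoid.symm' _ (hqf t)))
      · rintro _ ⟨hO', s, rfl, hs⟩
        refine ⟨s, hO', ?_⟩
        have : f s = s := by simp [f, hs]
        rw [this]
    · let f : V → V := fun v => if v ∈ B then y v else v
      have hf : ∀ v, f v ∉ B := by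
        intro v
        by_cases hv : v ∈ B
        · simp only [f, hv, if_true]
          obtain ⟨s, rfl, hs⟩ := hv
          rw [h.hy]
          rintro ⟨t, ht, ht'⟩
          rw [ht, h.colb, hs] at ht'
          simp at ht'
        · simp [f, hv]
      have hτf : ∀ v, SameCycle.setoid τ v (f v) := by
        intro v
        by_cases hv : v ∈ B
        · simp only [f, hv, if_true]
          obtain ⟨s, rfl, hs⟩ := hv
          rw [h.hy, ← h.hx']
          exact cyc_left x' z _
        · simp only [f, hv, if_false]
          exact Setoid.refl' _ _
      symm
      refine numCl_congr f ?_ ?_ ?_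
      · intro v hv
        refine ⟨?_, hf v⟩
        by_cases hvB : v ∈ B
        · simp only [f, hvB, if_true]; exact hy v hv
        · simpa [f, hvB] using hv
      · intro u _ v _
        constructor
        · have : SameCycle.setoid τ ≤ (SameCycle.setoid σ).comap f := by
            refine cyc_le fun v => ?_
            change SameCycle.setoid σ (f v) (f (τ v))
            by_cases hv : v ∈ B
            · obtain ⟨s, rfl, hs⟩ := hv
              have e1 : f (ι s) = ι (b s) := by
                simp only [f]; rw [if_pos ⟨s, rfl, hs⟩, h.hy]
              have e2 : τ (ι s) = z.toPerm (ι s) := by rw [hτ, circ_apply, hs]; simp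
              have e3 : f (z.toPerm (ι s)) = z.toPerm (ι s) := by
                simp only [f]; rw [if_neg]
                rintro ⟨t, ht, ht'⟩
                rw [ht, z.col_ne, hs] at ht'
                simp at ht'
              have e4 : σ (ι (b s)) = z.toPerm (ι s) := by
                rw [hσ, Perm.mul_apply, h.hy, h.bb, circ_apply, hs]; simp
              rw [e1, e2, e3, ← e4]
              exact cyc_step σ _
            · have e1 : f v = v := by simp [f, hv]
              rw [e1]
              by_cases hr : ∃ s, ι s = v
              · obtain ⟨s, rfl⟩ := hr
                have hc : col (ι s) = true := by
                  cases hc : col (ι s)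
                  · exact absurd ⟨s, rfl, hc⟩ hv
                  · rfl
                have e2 : τ (ι s) = ι (b s) := by
                  rw [hτ, circ_apply, hc]; simp [h.hx']
                have e3 : f (ι (b s)) = ι s := by
                  simp only [f]; rw [if_pos ⟨b s, rfl, by rw [h.colb, hc]; rfl⟩, h.hy, h.bb]
                rw [e2, e3]
              · have hr' : ∀ s, ι s ≠ v := fun s hs => hr ⟨s, hs⟩
                have e2 : σ v = circ x z v := by rw [hσ, Perm.mul_apply, h.hy' v hr']
                have e3 : τ v = circ x z v := by
                  rw [hτ, circ_apply, circ_apply, h.hxx v hr']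
                have e4 : f (τ v) = σ v := by
                  rw [e3, ← e2]
                  simp only [f]; rw [if_neg (hW v hv).1]
                rw [e4]
                exact cyc_step σ _
          exact fun k => this k
        · intro k
          have hcl : ∀ w ∈ {w | w ∉ B ∧ SameCycle.setoid τ (f u) w},
              σ w ∈ {w | w ∉ B ∧ SameCycle.setoid τ (f u) w} := by
            rintro w ⟨hw, huw⟩
            refine ⟨(hW w hw).1, ?_⟩
            rcases (hW w hw).2 with e | e
            · rw [e]; exact Setoid.trans' _ huw (cyc_step τ _)
            · rw [e]
              exact Setoid.trans' _ huw (Setoid.trans' _ (cyc_step τ _) (cyc_step τ _))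
          have := cyc_closed hcl k ⟨hf u, Setoid.refl' _ _⟩
          exact Setoid.trans' _ (hτf u) (Setoid.trans' _ this.2 (Setoid.symm' _ (hτf v)))
      · rintro w ⟨hw, hwB⟩
        refine ⟨w, hw, ?_⟩
        have : f w = w := by simp [f, hwB]
        rw [this]
  · rintro u ⟨_, hu⟩ v ⟨_, hv⟩ k
    exact hv (cyc_closed hBcl k hu)

open Classical in
theorem count_arcs (h : IsPort ι x x' b b' y q) (O : Set V) (hy : ∀ v ∈ O, y v ∈ O) :
    2 * (arcs col y).countP (fun e => e.1 ∈ O) = (ι ⁻¹' O).ncard := by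
  have e1 : (arcs col y).countP (fun e => e.1 ∈ O) = {s | ι s ∈ O ∧ col (ι s) = false}.ncard := by
    have e0 : ∀ (s : Finset V), s.toList.countP (fun v => decide (v ∈ O)) =
        (s.filter fun v => v ∈ O).card := by
      intro s
      rw [← Multiset.coe_countP, Finset.coe_toList, Multiset.countP_eq_card_filter]
      rfl
    rw [arcs, List.countP_map]
    refine (e0 _).trans ?_
    rw [← Set.ncard_coe_finset, ← Set.ncard_image_of_injective _ h.inj]
    congr 1
    ext v
    simp only [Finset.coe_filter, Set.mem_ofPred_eq, Finset.mem_filter, Finset.mem_univ, true_and,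
      Set.mem_image, h.y_ne_iff]
    constructor
    · rintro ⟨⟨h1, s, rfl⟩, h2⟩; exact ⟨s, ⟨h2, h1⟩, rfl⟩
    · rintro ⟨s, ⟨h2, h1⟩, rfl⟩; exact ⟨⟨h1, s, rfl⟩, h2⟩
  have hyO : ∀ s, ι s ∈ O → ι (b s) ∈ O := fun s hs => by rw [← h.hy]; exact hy _ hs
  have e2 : {s | ι s ∈ O ∧ col (ι s) = true}.ncard = {s | ι s ∈ O ∧ col (ι s) = false}.ncard := by
    refine Set.ncard_congr (fun s _ => b s) ?_ ?_ ?_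
    · rintro s ⟨h1, h2⟩; exact ⟨hyO s h1, by rw [h.colb, h2]; rfl⟩
    · intro s t _ _ e; rw [← h.bb s, ← h.bb t, e]
    · rintro s ⟨h1, h2⟩; exact ⟨b s, ⟨hyO s h1, by rw [h.colb, h2]; rfl⟩, h.bb s⟩
  have e3 : ι ⁻¹' O = {s | ι s ∈ O ∧ col (ι s) = false} ∪ {s | ι s ∈ O ∧ col (ι s) = true} := by
    ext s
    cases hc : col (ι s) <;> simp [hc]
  rw [e3, Set.ncard_union_eq, e2, e1]
  · ring
  · rw [Set.disjoint_left]
    rintro s ⟨_, h1⟩ ⟨_, h2⟩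
    rw [h1] at h2; simp at h2

open Classical in
theorem count (h : IsPort ι x x' b b' y q) (z : Matching col) (O : Set V)
    (hx : ∀ v ∈ O, x.toPerm v ∈ O) (hz : ∀ v ∈ O, z.toPerm v ∈ O) (hb : ∀ v ∈ O, y v ∈ O) :
    4 * (h.E z).countP (fun e => e.1 ∈ O) + 2 * numCl (SameCycle.setoid q) (ι ⁻¹' O)
      + 2 * numCl (SameCycle.setoid (circ x' z)) O =
    (ι ⁻¹' O).ncard + 2 * numCl (SameCycle.setoid (circ x z)) O := by
  have h1 := count_splits O (circ x z * y) (arcs col y) arcs_ne (by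
    intro e he
    rw [mem_arcs] at he
    rw [he.2]
    exact ⟨fun k => hb _ k, fun k => by have := hb _ k; rwa [h.y_invol] at this⟩) (by
    intro v hv
    rw [Perm.mul_apply, circ_apply]
    split_ifs
    · exact hx _ (hb _ hv)
    · exact hz _ (hb _ hv))
  rw [fin_arcs h.y_invol h.y_col, h.numCl_eq z O hx hb] at h1
  have h2 := h.count_arcs O hb
  change 2 * (h.E z).countP _ + _ = _ at h1
  omega

end IsPort

end Contraction

section Identities
variable {V S S₂ : Type} [Fintype V] [DecidableEq V] [Fintype S] [DecidableEq S]
  [Fintype S₂] [DecidableEq S₂] {col : V → Bool}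

theorem conn_append_le {r r' s : Setoid V} {E F : List (V × V)} (h : r' ≤ s)
    (hs : s = conn r (E ++ F) ∨ s = conn r (F ++ E)) : conn r' F ≤ s := by
  refine conn_le h fun e he => ?_
  rcases hs with rfl | rfl
  · exact conn_rel (List.mem_append_right _ he)
  · exact conn_rel (List.mem_append_left _ he)

theorem conn_append_left (r : Setoid V) (E F : List (V × V)) : conn r E ≤ conn r (E ++ F) :=
  conn_le (le_conn _ _) fun _ he => conn_rel (List.mem_append_left _ he)

theorem conn_append_right (r : Setoid V) (E F : List (V × V)) : conn r F ≤ conn r (E ++ F) :=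
  conn_le (le_conn _ _) fun _ he => conn_rel (List.mem_append_right _ he)

variable {ι : S → V} {κ : S₂ → V}

theorem closed_of_port {x x' : Matching col} {b b' : S → S} {y : Perm V} {q : Perm S}
    (h : IsPort ι x x' b b' y q) {J : Setoid V} (hb : ∀ s, J (ι s) (ι (b s))) (v : V) :
    J v (y v) := by
  by_cases hv : ∃ s, ι s = v
  · obtain ⟨s, rfl⟩ := hv
    rw [h.hy]; exact hb s
  · push Not at hv
    rw [h.hy' v hv]

theorem assoc_port {b b' b'' : S → S} {x₀ x₁ x₂ z : Matching col} {y₀ y₁ : Perm V}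
    {q₁₀ q₂₁ q₂₀ : Perm S} (h₁₀ : IsPort ι x₁ x₀ b b' y₀ q₁₀) (h₂₁ : IsPort ι x₂ x₁ b' b'' y₁ q₂₁)
    (h₂₀ : IsPort ι x₂ x₀ b b'' y₀ q₂₀) (E : List (S × S))
    (H1 : ∀ s, conn (SameCycle.setoid q₂₀) E s (b' s)) (H2 : ∀ e ∈ E, e.2 = b' e.1)
    (H3 : ∀ (O : Set S), (∀ s ∈ O, b s ∈ O) → (∀ s ∈ O, b' s ∈ O) → (∀ s ∈ O, b'' s ∈ O) →
      4 * E.countP (fun e => Classical.propDecidable (e.1 ∈ O) |>.decide)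
        + 2 * numCl (SameCycle.setoid q₂₁) O
        + 2 * numCl (SameCycle.setoid q₁₀) O = O.ncard + 2 * numCl (SameCycle.setoid q₂₀) O) :
    edgeProd (E.map (Prod.map ι ι)) * edgeProd (h₂₀.E z) - edgeProd (h₂₁.E z) * edgeProd (h₁₀.E z)
      ∈ circIdeal (SameCycle.setoid (circ x₂ z)) := by
  rw [← edgeProd_append, ← edgeProd_append]
  set c := SameCycle.setoid (circ x₂ z)
  set E₀ := E.map (Prod.map ι ι)
  set L := conn c (E₀ ++ h₂₀.E z) with hL
  set R := conn c (h₂₁.E z ++ h₁₀.E z) with hR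
  have Rb'' : ∀ s, R (ι s) (ι (b'' s)) := fun s => by
    rw [← h₂₁.hx]; exact le_conn _ _ (cyc_left _ _ _)
  have Rb' : ∀ s, R (ι s) (ι (b' s)) := fun s => conn_append_left _ _ _ (h₂₁.conn_arc z s)
  have R1 : SameCycle.setoid (circ x₁ z) ≤ R := (h₂₁.cyc_le_conn z).trans (conn_append_left _ _ _)
  have Rb : ∀ s, R (ι s) (ι (b s)) := fun s =>
    conn_append_le R1 (Or.inl hR) (h₁₀.conn_arc z s)
  have Lb'' : ∀ s, L (ι s) (ι (b'' s)) := fun s => by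
    rw [← h₂₁.hx]; exact le_conn _ _ (cyc_left _ _ _)
  have Lb : ∀ s, L (ι s) (ι (b s)) := fun s => conn_append_right _ _ _ (h₂₀.conn_arc z s)
  have Lb' : ∀ s, L (ι s) (ι (b' s)) := by
    have : conn (SameCycle.setoid q₂₀) E ≤ L.comap ι := by
      refine conn_le (h₂₀.q_le Lb Lb'') fun e he => ?_
      exact conn_rel (List.mem_append_left _ (List.mem_map.2 ⟨e, he, rfl⟩))
    exact fun s => this (H1 s)
  have hLR : L = R := by
    apply le_antisymm
    · refine conn_le (le_conn _ _) fun e he => ?_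
      rcases List.mem_append.1 he with he | he
      · obtain ⟨f, hf, rfl⟩ := List.mem_map.1 he
        have := Rb' f.1
        rw [← H2 f hf] at this
        exact this
      · obtain ⟨s, rfl⟩ := h₂₀.E_mem z he
        exact Rb s
    · refine conn_le (le_conn _ _) fun e he => ?_
      rcases List.mem_append.1 he with he | he
      · obtain ⟨s, rfl⟩ := h₂₁.E_mem z he
        exact Lb' s
      · obtain ⟨s, rfl⟩ := h₁₀.E_mem z he
        exact Lb s
  refine edge_lemma _ _ _ _ rfl hLR fun w => ?_
  rw [← hL]
  set O : Set V := {v | L w v} with hO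
  have cl : ∀ {f : V → V}, (∀ v, L v (f v)) → ∀ v ∈ O, f v ∈ O :=
    fun hf v hv => Setoid.trans' _ hv (hf v)
  have cx₂ : ∀ v, L v (x₂.toPerm v) := fun v => le_conn _ _ (cyc_left _ _ _)
  have cz : ∀ v, L v (z.toPerm v) := fun v => le_conn _ _ (cyc_right _ _ _)
  have cx₁ : ∀ v, L v (x₁.toPerm v) := fun v => by rw [hLR]; exact R1 (cyc_left _ _ _)
  have cy₀ := closed_of_port h₁₀ Lb
  have cy₁ := closed_of_port h₂₁ Lb'
  have k1 := h₁₀.count z O (cl cx₁) (cl cz) (cl cy₀)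
  have k2 := h₂₁.count z O (cl cx₂) (cl cz) (cl cy₁)
  have k3 := h₂₀.count z O (cl cx₂) (cl cz) (cl cy₀)
  have k4 := H3 (ι ⁻¹' O) (fun s hs => Setoid.trans' _ hs (Lb s))
    (fun s hs => Setoid.trans' _ hs (Lb' s)) (fun s hs => Setoid.trans' _ hs (Lb'' s))
  rw [List.countP_append, List.countP_append]
  have k5 : E₀.countP (fun e => Classical.propDecidable (L w e.1) |>.decide) =
      E.countP (fun e => Classical.propDecidable (e.1 ∈ ι ⁻¹' O) |>.decide) := by
    rw [List.countP_map]; rfl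
  change E₀.countP (fun e => Classical.propDecidable (L w e.1) |>.decide) +
    (h₂₀.E z).countP (fun e => Classical.propDecidable (e.1 ∈ O) |>.decide) =
    (h₂₁.E z).countP (fun e => Classical.propDecidable (e.1 ∈ O) |>.decide) +
    (h₁₀.E z).countP (fun e => Classical.propDecidable (e.1 ∈ O) |>.decide)
  rw [k5]
  omega

theorem comm_port {b b' : S → S} {a a' : S₂ → S₂} {x₀₀ x₁₀ x₀₁ x₁₁ z : Matching col}
    {y w : Perm V} {q : Perm S} {r : Perm S₂}
    (hL₀ : IsPort ι x₁₀ x₀₀ b b' y q) (hR₁ : IsPort κ x₁₁ x₁₀ a a' w r)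
    (hR₀ : IsPort κ x₀₁ x₀₀ a a' w r) (hL₁ : IsPort ι x₁₁ x₀₁ b b' y q) :
    edgeProd (hR₁.E z) * edgeProd (hL₀.E z) - edgeProd (hL₁.E z) * edgeProd (hR₀.E z)
      ∈ circIdeal (SameCycle.setoid (circ x₁₁ z)) := by
  rw [← edgeProd_append, ← edgeProd_append]
  set c := SameCycle.setoid (circ x₁₁ z)
  set L := conn c (hR₁.E z ++ hL₀.E z) with hL
  set R := conn c (hL₁.E z ++ hR₀.E z) with hR
  have La : ∀ s, L (κ s) (κ (a s)) := fun s => conn_append_left _ _ _ (hR₁.conn_arc z s)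
  have L10 : SameCycle.setoid (circ x₁₀ z) ≤ L :=
    (hR₁.cyc_le_conn z).trans (conn_append_left _ _ _)
  have Lb : ∀ s, L (ι s) (ι (b s)) := fun s => conn_append_le L10 (Or.inl hL) (hL₀.conn_arc z s)
  have Rb : ∀ s, R (ι s) (ι (b s)) := fun s => conn_append_left _ _ _ (hL₁.conn_arc z s)
  have R01 : SameCycle.setoid (circ x₀₁ z) ≤ R :=
    (hL₁.cyc_le_conn z).trans (conn_append_left _ _ _)
  have Ra : ∀ s, R (κ s) (κ (a s)) := fun s => conn_append_le R01 (Or.inl hR) (hR₀.conn_arc z s)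
  have hLR : L = R := by
    apply le_antisymm
    · refine conn_le (le_conn _ _) fun e he => ?_
      rcases List.mem_append.1 he with he | he
      · obtain ⟨s, rfl⟩ := hR₁.E_mem z he
        exact Ra s
      · obtain ⟨s, rfl⟩ := hL₀.E_mem z he
        exact Rb s
    · refine conn_le (le_conn _ _) fun e he => ?_
      rcases List.mem_append.1 he with he | he
      · obtain ⟨s, rfl⟩ := hL₁.E_mem z he
        exact Lb s
      · obtain ⟨s, rfl⟩ := hR₀.E_mem z he
        exact La s
  refine edge_lemma _ _ _ _ rfl hLR fun u => ?_
  rw [← hL]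
  set O : Set V := {v | L u v} with hO
  have cl : ∀ {f : V → V}, (∀ v, L v (f v)) → ∀ v ∈ O, f v ∈ O :=
    fun hf v hv => Setoid.trans' _ hv (hf v)
  have cx₁₁ : ∀ v, L v (x₁₁.toPerm v) := fun v => le_conn _ _ (cyc_left _ _ _)
  have cz : ∀ v, L v (z.toPerm v) := fun v => le_conn _ _ (cyc_right _ _ _)
  have cx₁₀ : ∀ v, L v (x₁₀.toPerm v) := fun v => L10 (cyc_left _ _ _)
  have cx₀₁ : ∀ v, L v (x₀₁.toPerm v) := fun v => by rw [hLR]; exact R01 (cyc_left _ _ _)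
  have cy := closed_of_port hL₀ Lb
  have cw := closed_of_port hR₁ La
  have k1 := hL₀.count z O (cl cx₁₀) (cl cz) (cl cy)
  have k2 := hR₁.count z O (cl cx₁₁) (cl cz) (cl cw)
  have k3 := hR₀.count z O (cl cx₀₁) (cl cz) (cl cw)
  have k4 := hL₁.count z O (cl cx₁₁) (cl cz) (cl cy)
  rw [List.countP_append, List.countP_append]
  change (hR₁.E z).countP (fun e => Classical.propDecidable (e.1 ∈ O) |>.decide) +
    (hL₀.E z).countP (fun e => Classical.propDecidable (e.1 ∈ O) |>.decide) =
    (hL₁.E z).countP (fun e => Classical.propDecidable (e.1 ∈ O) |>.decide) +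
    (hR₀.E z).countP (fun e => Classical.propDecidable (e.1 ∈ O) |>.decide)
  omega

/-- Bookkeeping of the number of circles, which gives the degree of the contraction. -/
theorem IsPort.length {x x' : Matching col} {b b' : S → S} {y : Perm V} {q : Perm S}
    (h : IsPort ι x x' b b' y q) (z : Matching col) :
    4 * (h.E z).length + 2 * numCl (SameCycle.setoid q) Set.univ
      + 2 * numCl (SameCycle.setoid (circ x' z)) Set.univ =
    Fintype.card S + 2 * numCl (SameCycle.setoid (circ x z)) Set.univ := by
  have := h.count z Set.univ (by simp) (by simp) (by simp)
  rw [List.countP_eq_length.2 (by simp)] at this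
  simpa [Set.ncard_univ] using this

theorem edgeProd_homog (E : List (V × V)) :
    IsWeightedHomogeneous (fun _ => (2 : ℤ)) (edgeProd E) (2 * E.length) := by
  induction E with
  | nil => simpa using isWeightedHomogeneous_one ℤ (fun _ : V => (2 : ℤ))
  | cons e E ih =>
    rw [edgeProd_cons]
    have := ((isWeightedHomogeneous_X ℤ (fun _ : V => (2 : ℤ)) e.1).add
      (isWeightedHomogeneous_X ℤ (fun _ : V => (2 : ℤ)) e.2)).mul ih
    convert this using 1
    push_cast [List.length_cons]; ring

theorem numCl_univ (r : Setoid V) : numCl r Set.univ = Nat.card (Quotient r) := by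
  rw [numCl, Set.image_univ, Set.range_eq_univ.2 Quotient.mk_surjective, Set.ncard_univ]

end Identities

section Pairing
variable {V S : Type} [Fintype V] [DecidableEq V] [Fintype S] [DecidableEq S] {col : V → Bool}

/-- `A^{⊗ circles}` for the closed curve `g`. -/
abbrev TQFT (g : Perm V) : Type := MvPolynomial V ℤ ⧸ circIdeal (SameCycle.setoid g)

/-- The quotient map from polynomials in the dots `X_v`. -/
abbrev TQFT.mk (g : Perm V) : MvPolynomial V ℤ →+* TQFT g := Ideal.Quotient.mk _

theorem portMul_wd {ι : S → V} {x x' : Matching col} {b b' : S → S} {y : Perm V} {q : Perm S}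
    (h : IsPort ι x x' b b' y q) (z : Matching col) :
    (∀ f ∈ circIdeal (SameCycle.setoid q),
      contr col (circ x z) y * rename ι f ∈ circIdeal (SameCycle.setoid (circ x z))) ∧
    (∀ f ∈ circIdeal (SameCycle.setoid (circ x' z)),
      contr col (circ x z) y * f ∈ circIdeal (SameCycle.setoid (circ x z))) := by
  rw [h.contr_eq]
  constructor
  · intro f hf
    refine mul_mem_of_gens (rename ι : MvPolynomial S ℤ →ₐ[ℤ] MvPolynomial V ℤ).toRingHom
      ?_ ?_ hf
    · intro v
      simpa using Ideal.mul_mem_left _ _ (sq_mem _ _)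
    · intro u v huv
      simpa using edgeProd_sub_mem _ _ (h.q_le_conn z huv)
  · intro f hf
    refine mul_mem_of_gens (RingHom.id _) ?_ ?_ hf
    · intro v
      simpa using Ideal.mul_mem_left _ _ (sq_mem _ _)
    · intro u v huv
      simpa using edgeProd_sub_mem _ _ (h.cyc_le_conn z huv)

/-- The map `A^{⊗ circles of q} ⊗ A^{⊗ circles of x' z} → A^{⊗ circles of x z}` induced by the minimal
contraction cobordism: the product of the two elements and of the value of the cobordism at `1`. -/
def portMul {ι : S → V} {x x' : Matching col} {b b' : S → S} {y : Perm V} {q : Perm S}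
    (h : IsPort ι x x' b b' y q) (z : Matching col) :
    TQFT q → TQFT (circ x' z) → TQFT (circ x z) :=
  Quotient.map₂ (fun f m => contr col (circ x z) y * (rename ι f * m)) (by
    intro f f' hf m m' hm
    have hf : f - f' ∈ _ := (Submodule.quotientRel_def _).1 hf
    have hm : m - m' ∈ _ := (Submodule.quotientRel_def _).1 hm
    refine (Submodule.quotientRel_def _).2 ?_
    have h1 := (portMul_wd h z).1 _ hf
    have h2 := (portMul_wd h z).2 _ hm
    have := add_mem (Ideal.mul_mem_right m _ h1) (Ideal.mul_mem_left _ (rename ι f') h2)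
    convert this using 1
    rw [map_sub]; ring)

theorem portMul_mk {ι : S → V} {x x' : Matching col} {b b' : S → S} {y : Perm V} {q : Perm S}
    (h : IsPort ι x x' b b' y q) (z : Matching col) (f : MvPolynomial S ℤ) (m : MvPolynomial V ℤ) :
    portMul h z (TQFT.mk q f) (TQFT.mk _ m) =
      TQFT.mk _ (contr col (circ x z) y * (rename ι f * m)) := rfl

theorem portMul_add_left {ι : S → V} {x x' : Matching col} {b b' : S → S} {y : Perm V}
    {q : Perm S} (h : IsPort ι x x' b b' y q) (z : Matching col) (f g : TQFT q)
    (m : TQFT (circ x' z)) : portMul h z (f + g) m = portMul h z f m + portMul h z g m := by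
  obtain ⟨f, rfl⟩ := Ideal.Quotient.mk_surjective f
  obtain ⟨g, rfl⟩ := Ideal.Quotient.mk_surjective g
  obtain ⟨m, rfl⟩ := Ideal.Quotient.mk_surjective m
  rw [← map_add, portMul_mk, portMul_mk, portMul_mk, ← map_add, map_add]
  congr 1; ring

theorem portMul_add_right {ι : S → V} {x x' : Matching col} {b b' : S → S} {y : Perm V}
    {q : Perm S} (h : IsPort ι x x' b b' y q) (z : Matching col) (f : TQFT q)
    (m n : TQFT (circ x' z)) : portMul h z f (m + n) = portMul h z f m + portMul h z f n := by
  obtain ⟨f, rfl⟩ := Ideal.Quotient.mk_surjective f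
  obtain ⟨n, rfl⟩ := Ideal.Quotient.mk_surjective n
  obtain ⟨m, rfl⟩ := Ideal.Quotient.mk_surjective m
  rw [← map_add, portMul_mk, portMul_mk, portMul_mk, ← map_add]
  congr 1; ring

section
variable {ι : S → V} {x x' : Matching col} {b b' : S → S} {y : Perm V}
    {q : Perm S} (h : IsPort ι x x' b b' y q) (z : Matching col)

/-- `portMul` as a biadditive map. -/
def portHom : TQFT q →+ TQFT (circ x' z) →+ TQFT (circ x z) :=
  AddMonoidHom.mk' (fun f => AddMonoidHom.mk' (portMul h z f) (portMul_add_right h z f))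
    (fun f g => AddMonoidHom.ext fun m => portMul_add_left h z f g m)

theorem portMul_zero_left (m) : portMul h z 0 m = 0 :=
  congrArg (fun k : TQFT (circ x' z) →+ TQFT (circ x z) => k m) (map_zero (portHom h z))
theorem portMul_zero_right (f) : portMul h z f 0 = 0 := map_zero (portHom h z f)
theorem portMul_sum_left {α : Type} (s : Finset α) (f : α → TQFT q) (m) :
    portMul h z (∑ i ∈ s, f i) m = ∑ i ∈ s, portMul h z (f i) m := by
  have := congrArg (fun k : TQFT (circ x' z) →+ TQFT (circ x z) => k m)
    (map_sum (portHom h z) f s)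
  rw [AddMonoidHom.finsetSum_apply] at this
  exact this
theorem portMul_sum_right {α : Type} (s : Finset α) (f) (m : α → TQFT (circ x' z)) :
    portMul h z f (∑ i ∈ s, m i) = ∑ i ∈ s, portMul h z f (m i) := map_sum (portHom h z f) m s
end

theorem portMul_one {ι : S → V} {x : Matching col} {b : S → S} {y : Perm V}
    {q : Perm S} (h : IsPort ι x x b b y q) (z : Matching col) (m : TQFT (circ x z)) :
    portMul h z 1 m = m := by
  obtain ⟨m, rfl⟩ := Ideal.Quotient.mk_surjective m
  rw [← map_one (TQFT.mk q), portMul_mk, h.unit z (fun _ => rfl)]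
  simp

theorem rename_edgeProd (ι : S → V) (E : List (S × S)) :
    rename ι (edgeProd E) = edgeProd (E.map (Prod.map ι ι)) := by
  simp [edgeProd, map_list_prod, List.map_map, Function.comp_def]

theorem portMul_assoc_aux {ι : S → V} {b b' b'' : S → S} {x₀ x₁ x₂ z : Matching col}
    {y₀ y₁ : Perm V} {q₁₀ q₂₁ q₂₀ : Perm S} (h₁₀ : IsPort ι x₁ x₀ b b' y₀ q₁₀)
    (h₂₁ : IsPort ι x₂ x₁ b' b'' y₁ q₂₁) (h₂₀ : IsPort ι x₂ x₀ b b'' y₀ q₂₀)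
    {colS : S → Bool} {u u' w : Matching colS} {c c' : S → S} {v q : Perm S}
    (hS : IsPort id u u' c c' v q) (hu : circ u w = q₂₀) (hv : ∀ s, c s = b' s)
    (hu' : ∀ s, u.toPerm s = b s ∨ u.toPerm s = b'' s)
    (hw' : ∀ s, w.toPerm s = b s ∨ w.toPerm s = b'' s)
    (hcount : ∀ O, numCl (SameCycle.setoid q) O + numCl (SameCycle.setoid (circ u' w)) O =
      numCl (SameCycle.setoid q₂₁) O + numCl (SameCycle.setoid q₁₀) O)
    (f : MvPolynomial S ℤ) (m : MvPolynomial V ℤ) :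
    TQFT.mk (circ x₂ z) (contr col (circ x₂ z) y₀ * (rename ι (contr colS (circ u w) v * f) * m)) =
    TQFT.mk (circ x₂ z) (contr col (circ x₂ z) y₁ * contr col (circ x₁ z) y₀ * (rename ι f * m)) := by
  rw [h₂₀.contr_eq, h₂₁.contr_eq, h₁₀.contr_eq, hS.contr_eq]
  have key := assoc_port (z := z) h₁₀ h₂₁ h₂₀ (hS.E w) (fun s => by
      rw [← hu, ← hv]; exact hS.conn_arc w s) (fun e he => by
      obtain ⟨s, rfl⟩ := hS.E_mem w he
      exact hv s) (fun O ho ho' ho'' => by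
      have := hS.count w O (fun s hs => by rcases hu' s with e | e <;> rw [e] <;> [exact ho s hs; exact ho'' s hs])
        (fun s hs => by rcases hw' s with e | e <;> rw [e] <;> [exact ho s hs; exact ho'' s hs])
        (fun s hs => by
          have := hS.hy s
          simp only [id] at this
          rw [this, hv]; exact ho' s hs)
      rw [hu] at this
      have h2 := hcount O
      simp only [Set.preimage_id] at this
      omega)
  rw [Ideal.Quotient.eq]
  have := Ideal.mul_mem_right (rename ι f * m) _ key
  convert this using 1
  rw [map_mul, rename_edgeProd]
  ring

end Pairing

section Regular
variable {S : Type} [Fintype S] [DecidableEq S] {col : S → Bool}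

theorem isPort_id (x y : Matching col) :
    IsPort id x y y.toPerm x.toPerm y.toPerm (circ x y) where
  inj := Function.injective_id
  hy _ := rfl
  hy' v hv := absurd rfl (hv v)
  hx _ := rfl
  hx' _ := rfl
  hxx v hv := absurd rfl (hv v)
  hq _ := rfl

/-- The multiplication `F(W(x)y) ⊗ F(W(y)z) → F(W(x)z)`, contracting `y` against its mirror image. -/
def mulF (x y z : Matching col) : TQFT (circ x y) → TQFT (circ y z) → TQFT (circ x z) :=
  portMul (isPort_id x y) z

theorem mulF_one (x z : Matching col) (f : TQFT (circ x z)) : mulF x z z f 1 = f := by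
  obtain ⟨f, rfl⟩ := Ideal.Quotient.mk_surjective f
  rw [← map_one (TQFT.mk (circ z z)), mulF, portMul_mk]
  have : contr col (circ x z) z.toPerm = 1 := by
    rw [contr, saddles_eq, splits_eq_nil, edgeProd_nil]
    · exact arcs_ne
    · exact arcs_pairwise (fun v _ => z.col_ne v)
    · intro e he
      rw [mem_arcs] at he
      right
      rw [Perm.mul_apply, he.2, z.invol, circ_apply, he.1.1]; simp
  rw [this]
  simp

theorem portMul_assoc_left {V : Type} [Fintype V] [DecidableEq V] {colV : V → Bool}
    {ι : S → V} {b b' b'' : Matching col} {x₀ x₁ x₂ : Matching colV} {y₀ y₁ : Perm V}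
    (h₁₀ : IsPort ι x₁ x₀ b.toPerm b'.toPerm y₀ (circ b' b))
    (h₂₁ : IsPort ι x₂ x₁ b'.toPerm b''.toPerm y₁ (circ b'' b'))
    (h₂₀ : IsPort ι x₂ x₀ b.toPerm b''.toPerm y₀ (circ b'' b)) (z : Matching colV)
    (f : TQFT (circ b'' b')) (g : TQFT (circ b' b)) (m : TQFT (circ x₀ z)) :
    portMul h₂₀ z (mulF b'' b' b f g) m = portMul h₂₁ z f (portMul h₁₀ z g m) := by
  obtain ⟨f, rfl⟩ := Ideal.Quotient.mk_surjective f
  obtain ⟨g, rfl⟩ := Ideal.Quotient.mk_surjective g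
  obtain ⟨m, rfl⟩ := Ideal.Quotient.mk_surjective m
  rw [mulF, portMul_mk, portMul_mk, portMul_mk, portMul_mk]
  rw [rename_id_apply]
  have := portMul_assoc_aux (z := z) h₁₀ h₂₁ h₂₀ (isPort_id b'' b') (w := b) rfl (fun _ => rfl)
    (fun _ => Or.inr rfl) (fun _ => Or.inl rfl) (fun O => rfl) (f * g) m
  rw [this, map_mul (rename ι)]
  congr 1; ring

theorem portMul_assoc_right {V : Type} [Fintype V] [DecidableEq V] {colV : V → Bool}
    {ι : S → V} {a a' a'' : Matching col} {x₀ x₁ x₂ : Matching colV} {y₀ y₁ : Perm V}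
    (h₁₀ : IsPort ι x₁ x₀ a.toPerm a'.toPerm y₀ (circ a a'))
    (h₂₁ : IsPort ι x₂ x₁ a'.toPerm a''.toPerm y₁ (circ a' a''))
    (h₂₀ : IsPort ι x₂ x₀ a.toPerm a''.toPerm y₀ (circ a a'')) (z : Matching colV)
    (f : TQFT (circ a a')) (g : TQFT (circ a' a'')) (m : TQFT (circ x₀ z)) :
    portMul h₂₀ z (mulF a a' a'' f g) m = portMul h₂₁ z g (portMul h₁₀ z f m) := by
  obtain ⟨f, rfl⟩ := Ideal.Quotient.mk_surjective f
  obtain ⟨g, rfl⟩ := Ideal.Quotient.mk_surjective g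
  obtain ⟨m, rfl⟩ := Ideal.Quotient.mk_surjective m
  rw [mulF, portMul_mk, portMul_mk, portMul_mk, portMul_mk]
  rw [rename_id_apply]
  have := portMul_assoc_aux (z := z) h₁₀ h₂₁ h₂₀ (isPort_id a a') (w := a'') rfl (fun _ => rfl)
    (fun _ => Or.inl rfl) (fun _ => Or.inr rfl) (fun O => add_comm _ _) (f * g) m
  rw [this, map_mul (rename ι)]
  congr 1; ring

theorem mulF_assoc (x y z w : Matching col) (f : TQFT (circ x y)) (g : TQFT (circ y z))
    (k : TQFT (circ z w)) : mulF x z w (mulF x y z f g) k = mulF x y w f (mulF y z w g k) :=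
  portMul_assoc_left (isPort_id y z) (isPort_id x y) (isPort_id x z) w f g k

theorem portMul_comm {S₂ V : Type} [Fintype S₂] [DecidableEq S₂] [Fintype V] [DecidableEq V]
    {colV : V → Bool} {ι : S → V} {κ : S₂ → V} {b b' : S → S} {a a' : S₂ → S₂}
    {x₀₀ x₁₀ x₀₁ x₁₁ : Matching colV}
    {y w : Perm V} {q : Perm S} {r : Perm S₂}
    (hL₀ : IsPort ι x₁₀ x₀₀ b b' y q) (hR₁ : IsPort κ x₁₁ x₁₀ a a' w r)
    (hR₀ : IsPort κ x₀₁ x₀₀ a a' w r) (hL₁ : IsPort ι x₁₁ x₀₁ b b' y q) (z : Matching colV)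
    (f : TQFT q) (g : TQFT r) (m : TQFT (circ x₀₀ z)) :
    portMul hR₁ z g (portMul hL₀ z f m) = portMul hL₁ z f (portMul hR₀ z g m) := by
  obtain ⟨f, rfl⟩ := Ideal.Quotient.mk_surjective f
  obtain ⟨g, rfl⟩ := Ideal.Quotient.mk_surjective g
  obtain ⟨m, rfl⟩ := Ideal.Quotient.mk_surjective m
  simp only [portMul_mk]
  rw [Ideal.Quotient.eq]
  have := Ideal.mul_mem_right (rename ι f * (rename κ g * m)) _ (comm_port (z := z) hL₀ hR₁ hR₀ hL₁)
  rw [← hL₀.contr_eq, ← hR₁.contr_eq, ← hR₀.contr_eq, ← hL₁.contr_eq] at this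
  convert this using 1
  ring

end Regular

section Graded

theorem internal_induction {M : Type} [AddCommGroup M] {𝓜 : ℤ → AddSubgroup M}
    (h : DirectSum.IsInternal 𝓜) {p : M → Prop} (h0 : p 0) (hp : ∀ i, ∀ x ∈ 𝓜 i, p x)
    (ha : ∀ x y, p x → p y → p (x + y)) (x : M) : p x := by
  obtain ⟨f, rfl⟩ := h.2 x
  induction f using DirectSum.induction_on with
  | zero => simpa using h0
  | of i x => rw [DirectSum.coeAddMonoidHom_of]; exact hp i _ x.2
  | add f g hf hg => rw [map_add]; exact ha _ _ hf hg

theorem isInternal_iff_proj {M : Type} [AddCommGroup M] (𝓜 : ℤ → AddSubgroup M) :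
    DirectSum.IsInternal 𝓜 ↔ ∃ π : ℤ → M →+ M, (∀ i, ∀ x ∈ 𝓜 i, π i x = x) ∧
      (∀ i j, ∀ x ∈ 𝓜 j, j ≠ i → π i x = 0) ∧ ⨆ i, 𝓜 i = ⊤ := by
  constructor
  · intro h
    let e := AddEquiv.ofBijective (DirectSum.coeAddMonoidHom 𝓜) h
    have he : ∀ i (x : 𝓜 i), e.symm (x : M) = DirectSum.of (fun i => 𝓜 i) i x := by
      intro i x
      rw [AddEquiv.symm_apply_eq]
      exact (DirectSum.coeAddMonoidHom_of 𝓜 i x).symm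
    refine ⟨fun i => (𝓜 i).subtype.comp ((DFinsupp.evalAddMonoidHom i).comp e.symm.toAddMonoidHom),
      ?_, ?_, ?_⟩
    · intro i x hx
      change ((e.symm x) i : M) = x
      rw [he i ⟨x, hx⟩, DirectSum.of_eq_same]
    · intro i j x hx hij
      change ((e.symm x) i : M) = 0
      rw [he j ⟨x, hx⟩, DirectSum.of_eq_of_ne _ _ _ hij.symm]; rfl
    · rw [eq_top_iff]
      intro x _
      exact internal_induction h (p := fun x => x ∈ ⨆ i, 𝓜 i) (zero_mem _)
        (fun i x hx => AddSubgroup.mem_iSup_of_mem i hx) (fun _ _ => add_mem) x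
  · rintro ⟨π, h1, h2, h3⟩
    constructor
    · rw [injective_iff_map_eq_zero]
      intro f hf
      ext i
      have key : ∀ f : DirectSum ℤ fun i => 𝓜 i, π i (DirectSum.coeAddMonoidHom 𝓜 f) = f i := by
        intro f
        induction f using DirectSum.induction_on with
        | zero => simp
        | of j x =>
          rw [DirectSum.coeAddMonoidHom_of]
          by_cases hij : j = i
          · subst hij
            rw [h1 _ _ x.2, DirectSum.of_eq_same]
          · rw [h2 _ _ _ x.2 hij, DirectSum.of_eq_of_ne _ _ _ (Ne.symm hij)]; rfl
        | add f g hf hg => rw [map_add, map_add, hf, hg]; rfl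
      rw [← key f, hf, map_zero]; rfl
    · rw [← AddMonoidHom.range_eq_top, ← top_le_iff, ← h3, iSup_le_iff]
      intro i x hx
      exact ⟨DirectSum.of (fun i => 𝓜 i) i ⟨x, hx⟩, DirectSum.coeAddMonoidHom_of 𝓜 i ⟨x, hx⟩⟩

theorem isInternal_shift {M : Type} [AddCommGroup M] {𝓜 : ℤ → AddSubgroup M}
    (h : DirectSum.IsInternal 𝓜) (m : ℤ) : DirectSum.IsInternal fun d => 𝓜 (d - m) := by
  obtain ⟨π, h1, h2, h3⟩ := (isInternal_iff_proj _).1 h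
  refine (isInternal_iff_proj _).2 ⟨fun d => π (d - m), fun i => h1 _, fun i j x hx hij =>
    h2 _ _ x hx (by omega), ?_⟩
  rw [← h3]
  exact (Equiv.subRight m).iSup_comp (g := 𝓜)

theorem isInternal_pi {J : Type} [Fintype J] {M : J → Type} [∀ j, AddCommGroup (M j)]
    {𝓜 : ∀ j, ℤ → AddSubgroup (M j)} (h : ∀ j, DirectSum.IsInternal (𝓜 j)) :
    DirectSum.IsInternal fun d => AddSubgroup.pi Set.univ fun j => 𝓜 j d := by
  classical
  choose π h1 h2 h3 using fun j => (isInternal_iff_proj _).1 (h j)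
  refine (isInternal_iff_proj _).2 ⟨fun d => AddMonoidHom.mk' (fun f j => π j d (f j))
    (fun f g => by ext j; simp), ?_, ?_, ?_⟩
  · intro i x hx
    ext j
    exact h1 j i _ (hx j trivial)
  · intro i k x hx hik
    ext j
    exact h2 j i k _ (hx j trivial) hik
  · rw [eq_top_iff]
    intro f _
    rw [← Finset.univ_sum_single f]
    refine sum_mem fun j _ => ?_
    have hj : f j ∈ ⨆ i, 𝓜 j i := by rw [h3]; trivial
    have := AddSubgroup.mem_map_of_mem (AddMonoidHom.single M j) hj
    rw [AddSubgroup.map_iSup] at this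
    refine (iSup_mono fun d => ?_ : (⨆ i, (𝓜 j i).map (AddMonoidHom.single M j)) ≤ _) this
    rintro _ ⟨x, hx, rfl⟩ k _
    by_cases hk : k = j
    · subst hk
      simpa using hx
    · simp [hk]

theorem isInternal_fam {P J : Type} [AddCommGroup P] [Fintype J] {M : J → Type}
    [∀ j, AddCommGroup (M j)] {𝓜 : ∀ j, ℤ → AddSubgroup (M j)} {𝓟 : ℤ → AddSubgroup P}
    (ev : ∀ j, P →+ M j) (hb : Function.Bijective fun p j => ev j p)
    (hP : ∀ d p, p ∈ 𝓟 d ↔ ∀ j, ev j p ∈ 𝓜 j d) (h : ∀ j, DirectSum.IsInternal (𝓜 j)) :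
    DirectSum.IsInternal 𝓟 := by
  let e : P ≃+ ∀ j, M j := AddEquiv.ofBijective (AddMonoidHom.mk' (fun p j => ev j p)
    (fun p q => by ext j; simp)) hb
  have he : ∀ d p, p ∈ 𝓟 d ↔ e p ∈ AddSubgroup.pi Set.univ fun j => 𝓜 j d := fun d p =>
    (hP d p).trans ⟨fun k j _ => k j, fun k j => k j trivial⟩
  have hpi := isInternal_pi h
  obtain ⟨π, h1, h2, h3⟩ := (isInternal_iff_proj _).1 hpi
  refine (isInternal_iff_proj _).2
    ⟨fun d => e.symm.toAddMonoidHom.comp ((π d).comp e.toAddMonoidHom), ?_, ?_, ?_⟩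
  · intro i x hx
    change e.symm (π i (e x)) = x
    rw [h1 i _ ((he i x).1 hx), e.symm_apply_apply]
  · intro i j x hx hij
    change e.symm (π i (e x)) = 0
    rw [h2 i j _ ((he j x).1 hx) hij, map_zero]
  · rw [eq_top_iff]
    rintro x -
    have hx : e x ∈ (⊤ : AddSubgroup (∀ j, M j)) := trivial
    rw [← h3] at hx
    have := AddSubgroup.mem_map_of_mem e.symm.toAddMonoidHom hx
    rw [AddSubgroup.map_iSup] at this
    rw [show x = e.symm.toAddMonoidHom (e x) from (e.symm_apply_apply x).symm]
    refine (iSup_mono fun d => ?_ : (⨆ i, AddSubgroup.map _ _) ≤ _) this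
    rintro _ ⟨y, hy, rfl⟩
    rw [he]
    change e (e.symm y) ∈ _
    rw [e.apply_symm_apply]
    exact hy

theorem finite_fam {P J : Type} [AddCommGroup P] [Fintype J] {M : J → Type}
    [∀ j, AddCommGroup (M j)] (ev : ∀ j, P →+ M j) (hb : Function.Bijective fun p j => ev j p)
    (h : ∀ j, Module.Finite ℤ (M j)) : Module.Finite ℤ P := by
  let e : P ≃+ ∀ j, M j := AddEquiv.ofBijective (AddMonoidHom.mk' (fun p j => ev j p)
    (fun p q => by ext j; simp)) hb
  exact Module.Finite.equiv e.symm.toIntLinearEquiv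

/-- Finitely generated graded left modules over a graded ring. -/
structure GrMod (R : Type) [Ring R] (𝒜 : ℤ → AddSubgroup R) [GradedRing 𝒜] where
  carrier : Type
  [grp : AddCommGroup carrier]
  [mod : Module R carrier]
  deg : ℤ → AddSubgroup carrier
  internal : DirectSum.IsInternal deg
  smul_mem : ∀ i j, ∀ r ∈ 𝒜 i, ∀ x ∈ deg j, r • x ∈ deg (i + j)
  finite : Module.Finite R carrier

attribute [instance] GrMod.grp GrMod.mod

variable {R : Type} [Ring R] {𝒜 : ℤ → AddSubgroup R} [GradedRing 𝒜]
variable {R' : Type} [Ring R'] {𝒜' : ℤ → AddSubgroup R'} [GradedRing 𝒜']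

namespace GrMod

/-- Module homomorphisms of degree zero. -/
structure Hom (M N : GrMod R 𝒜) where
  toLin : M.carrier →ₗ[R] N.carrier
  map_deg : ∀ i, ∀ x ∈ M.deg i, toLin x ∈ N.deg i

theorem Hom.ext' {M N : GrMod R 𝒜} {f g : Hom M N} (h : f.toLin = g.toLin) : f = g := by
  cases f; cases g; cases h; rfl

instance : Category (GrMod R 𝒜) where
  Hom := Hom
  id M := ⟨LinearMap.id, fun _ _ h => h⟩
  comp f g := ⟨g.toLin ∘ₗ f.toLin, fun i x h => g.map_deg i _ (f.map_deg i x h)⟩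

/-- The zero module. -/
def zero (R : Type) [Ring R] (𝒜 : ℤ → AddSubgroup R) [GradedRing 𝒜] : GrMod R 𝒜 where
  carrier := PUnit
  deg _ := ⊤
  internal := (isInternal_iff_proj _).2 ⟨fun _ => 0, fun _ _ _ => rfl, fun _ _ _ _ _ => rfl, by
    rw [eq_top_iff]; intro x _; rw [show x = 0 from rfl]; exact zero_mem _⟩
  smul_mem _ _ _ _ _ _ := trivial
  finite := inferInstance

end GrMod

/-- Graded bimodules, finitely generated as left modules. -/
structure GrBimod (R' : Type) [Ring R'] (𝒜' : ℤ → AddSubgroup R') [GradedRing 𝒜']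
    (R : Type) [Ring R] (𝒜 : ℤ → AddSubgroup R) [GradedRing 𝒜] where
  carrier : Type
  [grp : AddCommGroup carrier]
  [left : Module R' carrier]
  [right : Module Rᵐᵒᵖ carrier]
  [comm : SMulCommClass R' Rᵐᵒᵖ carrier]
  deg : ℤ → AddSubgroup carrier
  internal : DirectSum.IsInternal deg
  smul_mem : ∀ i j, ∀ r ∈ 𝒜' i, ∀ x ∈ deg j, r • x ∈ deg (i + j)
  smul_mem' : ∀ i j, ∀ x ∈ deg i, ∀ r ∈ 𝒜 j, MulOpposite.op r • x ∈ deg (i + j)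
  finite : Module.Finite R' carrier

attribute [instance] GrBimod.grp GrBimod.left GrBimod.right GrBimod.comm

namespace GrBimod

variable (B : GrBimod R' 𝒜' R 𝒜)

/-- The relations `x r ⊗ m = x ⊗ r m`. -/
def rel (M : GrMod R 𝒜) : Submodule R' (B.carrier ⊗[ℤ] M.carrier) :=
  Submodule.span R' {t | ∃ (x : B.carrier) (r : R) (m : M.carrier),
    t = (MulOpposite.op r • x) ⊗ₜ[ℤ] m - x ⊗ₜ[ℤ] (r • m)}

/-- The tensor product `B ⊗_R M`, as a quotient of `B ⊗_ℤ M`. -/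
abbrev Tens (M : GrMod R 𝒜) : Type := (B.carrier ⊗[ℤ] M.carrier) ⧸ B.rel M

/-- The pure tensor `x ⊗ m`. -/
def tmul {M : GrMod R 𝒜} (x : B.carrier) (m : M.carrier) : B.Tens M :=
  (B.rel M).mkQ (x ⊗ₜ[ℤ] m)

/-- The grading of `B ⊗_R M`: `x ⊗ m` has degree `deg x + deg m`. -/
def tensDeg (M : GrMod R 𝒜) (d : ℤ) : AddSubgroup (B.Tens M) :=
  AddSubgroup.closure {t | ∃ i j, i + j = d ∧ ∃ x ∈ B.deg i, ∃ m ∈ M.deg j, t = B.tmul x m}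

variable {B}

theorem add_tmul {M : GrMod R 𝒜} (x y : B.carrier) (m : M.carrier) :
    B.tmul (x + y) m = B.tmul x m + B.tmul y m := by
  simp only [tmul, TensorProduct.add_tmul, map_add]
theorem tmul_add {M : GrMod R 𝒜} (x : B.carrier) (m n : M.carrier) :
    B.tmul x (m + n) = B.tmul x m + B.tmul x n := by
  simp only [tmul, TensorProduct.tmul_add, map_add]
theorem smul_tmul {M : GrMod R 𝒜} (r : R') (x : B.carrier) (m : M.carrier) :
    r • B.tmul x m = B.tmul (r • x) m := rfl
theorem op_tmul {M : GrMod R 𝒜} (r : R) (x : B.carrier) (m : M.carrier) :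
    B.tmul (MulOpposite.op r • x) m = B.tmul x (r • m) := by
  rw [tmul, tmul, ← sub_eq_zero, ← map_sub, Submodule.mkQ_apply, Submodule.Quotient.mk_eq_zero]
  exact Submodule.subset_span ⟨x, r, m, rfl⟩

/-- `tmul` as a biadditive map. -/
def tmulHom (B : GrBimod R' 𝒜' R 𝒜) (M : GrMod R 𝒜) : B.carrier →+ M.carrier →+ B.Tens M :=
  AddMonoidHom.mk' (fun x => AddMonoidHom.mk' (fun m => B.tmul x m) (tmul_add x))
    (fun x y => by ext m; exact add_tmul x y m)

theorem tens_induction {M : GrMod R 𝒜} {p : B.Tens M → Prop} (h0 : p 0)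
    (ht : ∀ x m, p (B.tmul x m)) (ha : ∀ s t, p s → p t → p (s + t)) (t : B.Tens M) : p t := by
  obtain ⟨t, rfl⟩ := Submodule.mkQ_surjective _ t
  induction t with
  | zero => simpa using h0
  | tmul x m => exact ht x m
  | add s t hs ht => rw [map_add]; exact ha _ _ hs ht

/-- Additive maps out of the tensor product. -/
def liftAdd {M : GrMod R 𝒜} {P : Type} [AddCommGroup P] (φ : B.carrier →+ M.carrier →+ P)
    (h : ∀ x (r : R) m, φ (MulOpposite.op r • x) m = φ x (r • m)) : B.Tens M →+ P :=
  QuotientAddGroup.lift (B.rel M).toAddSubgroup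
    (TensorProduct.liftAddHom φ (fun r x m => by
      rw [map_zsmul, AddMonoidHom.smul_apply, map_zsmul]))
    (by
      intro t ht
      change _ = _
      refine Submodule.closure_induction (p := fun t _ => TensorProduct.liftAddHom φ _ t = 0)
        (map_zero _) (fun a b _ _ ha hb => by rw [map_add, ha, hb, add_zero]) ?_ ht
      rintro r _ ⟨x, s, m, rfl⟩
      rw [smul_sub, TensorProduct.smul_tmul', TensorProduct.smul_tmul', map_sub,
        TensorProduct.liftAddHom_tmul, TensorProduct.liftAddHom_tmul, smul_comm, h, sub_self])

theorem liftAdd_tmul {M : GrMod R 𝒜} {P : Type} [AddCommGroup P] (φ : B.carrier →+ M.carrier →+ P)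
    (h : ∀ x (r : R) m, φ (MulOpposite.op r • x) m = φ x (r • m)) (x : B.carrier) (m : M.carrier) :
    liftAdd φ h (B.tmul x m) = φ x m := rfl

theorem tens_internal (B : GrBimod R' 𝒜' R 𝒜) (M : GrMod R 𝒜) :
    DirectSum.IsInternal (B.tensDeg M) := by
  classical
  obtain ⟨π, b1, b2, -⟩ := (isInternal_iff_proj _).1 B.internal
  let e := AddEquiv.ofBijective (DirectSum.coeAddMonoidHom M.deg) M.internal
  have he : ∀ j m (hm : m ∈ M.deg j), e.symm m = DirectSum.of (fun j => M.deg j) j ⟨m, hm⟩ := by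
    intro j m hm
    rw [AddEquiv.symm_apply_eq]
    exact (DirectSum.coeAddMonoidHom_of M.deg j ⟨m, hm⟩).symm
  let Ψ : ℤ → M.carrier →+ B.carrier →+ B.Tens M := fun d =>
    (DirectSum.toAddMonoid fun j =>
      (((B.tmulHom M).comp (π (d - j))).flip).comp (M.deg j).subtype).comp e.symm.toAddMonoidHom
  have hΨ : ∀ d j m (_ : m ∈ M.deg j) x, Ψ d m x = B.tmul (π (d - j) x) m := by
    intro d j m hm x
    change (DirectSum.toAddMonoid _ (e.symm m) : B.carrier →+ B.Tens M) x = _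
    rw [he j m hm, DirectSum.toAddMonoid_of]
    rfl
  have hbal : ∀ d x (r : R) m, (Ψ d).flip (MulOpposite.op r • x) m = (Ψ d).flip x (r • m) := by
    intro d x r m
    simp only [AddMonoidHom.flip_apply]
    refine internal_induction M.internal (p := fun m => Ψ d m (MulOpposite.op r • x) = Ψ d (r • m) x)
      (by simp) ?_ (fun a b ha hb => by
        rw [map_add, AddMonoidHom.add_apply, ha, hb, smul_add, map_add, AddMonoidHom.add_apply]) m
    intro j m hm
    refine internal_induction (DirectSum.Decomposition.isInternal 𝒜)
      (p := fun r => Ψ d m (MulOpposite.op r • x) = Ψ d (r • m) x) (by simp) ?_ (fun a b ha hb => by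
        rw [MulOpposite.op_add, add_smul, map_add, ha, hb, add_smul, map_add,
          AddMonoidHom.add_apply]) r
    intro i r hr
    rw [hΨ d j m hm, hΨ d (i + j) _ (M.smul_mem i j r hr m hm), ← op_tmul]
    congr 1
    refine internal_induction B.internal (p := fun x => π (d - j) (MulOpposite.op r • x) =
      MulOpposite.op r • π (d - (i + j)) x) (by simp) ?_
      (fun a b ha hb => by rw [smul_add, map_add, ha, hb, map_add, smul_add]) x
    intro k x hx
    have := B.smul_mem' k i x hx r hr
    by_cases hk : k + i = d - j
    · rw [← hk, b1 _ _ this, show d - (i + j) = k by omega, b1 _ _ hx]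
    · rw [b2 _ _ _ this hk, b2 _ _ _ hx (by omega), smul_zero]
  refine (isInternal_iff_proj _).2 ⟨fun d => liftAdd (Ψ d).flip (hbal d), ?_, ?_, ?_⟩
  · intro d t ht
    refine AddSubgroup.closure_induction (p := fun t _ => liftAdd (Ψ d).flip (hbal d) t = t) ?_
      (map_zero _) (fun a b _ _ ha hb => by rw [map_add, ha, hb])
      (fun a _ ha => by rw [map_neg, ha]) ht
    rintro _ ⟨i, j, rfl, x, hx, m, hm, rfl⟩
    rw [liftAdd_tmul, AddMonoidHom.flip_apply, hΨ _ j m hm, add_sub_cancel_right, b1 _ _ hx]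
  · intro d k t ht hk
    refine AddSubgroup.closure_induction (p := fun t _ => liftAdd (Ψ d).flip (hbal d) t = 0) ?_
      (map_zero _) (fun a b _ _ ha hb => by rw [map_add, ha, hb, add_zero])
      (fun a _ ha => by rw [map_neg, ha, neg_zero]) ht
    rintro _ ⟨i, j, rfl, x, hx, m, hm, rfl⟩
    rw [liftAdd_tmul, AddMonoidHom.flip_apply, hΨ _ j m hm, b2 _ _ _ hx (by omega)]
    exact congrArg (fun f : M.carrier →+ B.Tens M => f m) (map_zero (B.tmulHom M))
  · rw [eq_top_iff]
    intro t _
    refine tens_induction (p := fun t => t ∈ ⨆ d, B.tensDeg M d) (zero_mem _) ?_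
      (fun _ _ => add_mem) t
    intro x m
    refine internal_induction B.internal (p := fun x => B.tmul x m ∈ ⨆ d, B.tensDeg M d) ?_ ?_
      (fun a b ha hb => by rw [add_tmul]; exact add_mem ha hb) x
    · rw [show B.tmul 0 m = 0 from
        congrArg (fun f : M.carrier →+ B.Tens M => f m) (map_zero (B.tmulHom M))]
      exact zero_mem _
    intro i x hx
    refine internal_induction M.internal (p := fun m => B.tmul x m ∈ ⨆ d, B.tensDeg M d) ?_ ?_
      (fun a b ha hb => by rw [tmul_add]; exact add_mem ha hb) m
    · rw [show B.tmul x (0 : M.carrier) = 0 from map_zero (B.tmulHom M x)]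
      exact zero_mem _
    intro j m hm
    exact AddSubgroup.mem_iSup_of_mem (i + j)
      (AddSubgroup.subset_closure ⟨i, j, rfl, x, hx, m, hm, rfl⟩)

theorem tens_finite (B : GrBimod R' 𝒜' R 𝒜) (M : GrMod R 𝒜) : Module.Finite R' (B.Tens M) := by
  obtain ⟨s, hs⟩ := B.finite.fg_top
  obtain ⟨t, ht⟩ := M.finite.fg_top
  classical
  refine ⟨⟨Finset.image₂ (fun x m => B.tmul x m) s t, ?_⟩⟩
  rw [eq_top_iff]
  set N := Submodule.span R' (Finset.image₂ (fun x m => B.tmul x m) s t : Set (B.Tens M)) with hN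
  have h1 : ∀ m ∈ t, ∀ x, B.tmul x m ∈ N := by
    intro m hm x
    have hx : x ∈ Submodule.span R' (s : Set B.carrier) := by rw [hs]; trivial
    refine Submodule.span_induction (p := fun x _ => B.tmul x m ∈ N) ?_ ?_ ?_ ?_ hx
    · intro x hx
      exact Submodule.subset_span (Finset.mem_coe.2 (Finset.mem_image₂_of_mem hx hm))
    · rw [show B.tmul 0 m = 0 from
        congrArg (fun f : M.carrier →+ B.Tens M => f m) (map_zero (B.tmulHom M))]
      exact zero_mem _
    · intro a b _ _ ha hb; rw [add_tmul]; exact add_mem ha hb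
    · intro r a _ ha; rw [← smul_tmul]; exact N.smul_mem r ha
  have h2 : ∀ m x, B.tmul x m ∈ N := by
    intro m
    have hm : m ∈ Submodule.span R (t : Set M.carrier) := by rw [ht]; trivial
    refine Submodule.span_induction (p := fun m _ => ∀ x, B.tmul x m ∈ N) ?_ ?_ ?_ ?_ hm
    · intro m hm x; exact h1 m hm x
    · intro x
      rw [show B.tmul x (0 : M.carrier) = 0 from map_zero (B.tmulHom M x)]
      exact zero_mem _
    · intro a b _ _ ha hb x; rw [tmul_add]; exact add_mem (ha x) (hb x)
    · intro r a _ ha x; rw [← op_tmul]; exact ha _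
  intro y _
  exact tens_induction (p := fun y => y ∈ N) (zero_mem _) (fun x m => h2 m x)
    (fun _ _ => add_mem) y

/-- The graded module `B ⊗_R M`. -/
def tensObj (B : GrBimod R' 𝒜' R 𝒜) (M : GrMod R 𝒜) : GrMod R' 𝒜' where
  carrier := B.Tens M
  deg := B.tensDeg M
  internal := B.tens_internal M
  smul_mem := by
    intro i j r hr t ht
    refine AddSubgroup.closure_induction (p := fun t _ => r • t ∈ B.tensDeg M (i + j)) ?_
      (by rw [smul_zero]; exact zero_mem _) (fun a b _ _ ha hb => by rw [smul_add]; exact add_mem ha hb)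
      (fun a _ ha => by rw [smul_neg]; exact neg_mem ha) ht
    rintro _ ⟨k, l, rfl, x, hx, m, hm, rfl⟩
    exact AddSubgroup.subset_closure ⟨i + k, l, by omega, r • x, B.smul_mem i k r hr x hx, m, hm, rfl⟩
  finite := B.tens_finite M

/-- The map `B ⊗_R f`. -/
def tensMap (B : GrBimod R' 𝒜' R 𝒜) {M N : GrMod R 𝒜} (f : M ⟶ N) : B.tensObj M ⟶ B.tensObj N where
  toLin := Submodule.mapQ (B.rel M) (B.rel N)
    (TensorProduct.AlgebraTensorModule.map (A := R') (R := ℤ) LinearMap.id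
      (GrMod.Hom.toLin f).toAddMonoidHom.toIntLinearMap) (by
      rw [rel, Submodule.span_le]
      rintro _ ⟨x, r, m, rfl⟩
      refine Submodule.subset_span ⟨x, r, GrMod.Hom.toLin f m, ?_⟩
      simp)
  map_deg := by
    intro d t ht
    refine AddSubgroup.closure_induction (p := fun t _ => Submodule.mapQ (B.rel M) (B.rel N) _ _ t ∈
      B.tensDeg N d) ?_ (by rw [map_zero]; exact zero_mem _)
      (fun a b _ _ ha hb => by rw [map_add]; exact add_mem ha hb)
      (fun a _ ha => by rw [map_neg]; exact neg_mem ha) ht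
    rintro _ ⟨i, j, h, x, hx, m, hm, rfl⟩
    exact AddSubgroup.subset_closure
      ⟨i, j, h, x, hx, GrMod.Hom.toLin f m, GrMod.Hom.map_deg f j m hm, rfl⟩

/-- The functor `B ⊗_R -`. -/
def tensor (B : GrBimod R' 𝒜' R 𝒜) : GrMod R 𝒜 ⥤ GrMod R' 𝒜' where
  obj := B.tensObj
  map f := B.tensMap f
  map_id M := GrMod.Hom.ext' (LinearMap.ext fun t => by
    refine tens_induction (p := fun t => (B.tensMap (𝟙 M)).toLin t = t) (map_zero _)
      (fun x m => rfl)
      (fun s t hs ht => (LinearMap.map_add _ s t).trans (congrArg₂ (· + ·) hs ht)) t)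
  map_comp {M N P} f g := GrMod.Hom.ext' (LinearMap.ext fun t => by
    refine tens_induction (p := fun t => (B.tensMap (f ≫ g)).toLin t =
      (B.tensMap g).toLin ((B.tensMap f).toLin t)) rfl
      (fun x m => rfl) (fun s t hs ht => (LinearMap.map_add _ s t).trans
        ((congrArg₂ (· + ·) hs ht).trans
          (((B.tensMap f ≫ B.tensMap g : _ ⟶ _).toLin.map_add s t)).symm)) t)

end GrBimod
end Graded

section Degree
variable {V S : Type} [Fintype V] [DecidableEq V] [Fintype S] [DecidableEq S] {col : V → Bool}

/-- The number of circles of a closed curve. -/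
def circles (g : Perm V) : ℕ := Nat.card (Quotient (SameCycle.setoid g))

/-- The degree `d` part of `A^{⊗ circles}`, where `1` has degree `-1` and `X` has degree `1` in each
factor: a monomial in the `X_v` of polynomial degree `e` has degree `2 e - circles`. -/
def TQFT.deg (g : Perm V) (d : ℤ) : AddSubgroup (TQFT g) :=
  AddSubgroup.map (TQFT.mk g).toAddMonoidHom
    (weightedHomogeneousSubmodule ℤ (fun _ : V => (2 : ℤ)) (d + circles g)).toAddSubgroup

theorem TQFT.mk_mem_deg {g : Perm V} {p : MvPolynomial V ℤ} {d e : ℤ}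
    (h : IsWeightedHomogeneous (fun _ : V => (2 : ℤ)) p e) (he : e = d + circles g) :
    TQFT.mk g p ∈ TQFT.deg g d := ⟨p, by rw [he] at h; exact h, rfl⟩

theorem circIdeal_component {r : Setoid V} (d : ℤ) {p : MvPolynomial V ℤ} (hp : p ∈ circIdeal r) :
    weightedHomogeneousComponent (fun _ : V => (2 : ℤ)) d p ∈ circIdeal r := by
  let _ := MvPolynomial.weightedGradedAlgebra ℤ (fun _ : V => (2 : ℤ))
  refine weightedHomogeneousComponent_mem_of_mem ℤ (fun _ : V => (2 : ℤ)) ?_ hp d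
  refine Ideal.homogeneous_span _ _ ?_
  rintro f (⟨v, rfl⟩ | ⟨u, v, -, rfl⟩)
  · exact ⟨2 • 2, (isWeightedHomogeneous_X ℤ (fun _ : V => (2 : ℤ)) v).pow 2⟩
  · exact ⟨2, (isWeightedHomogeneous_X ℤ (fun _ : V => (2 : ℤ)) u).sub
      (isWeightedHomogeneous_X ℤ (fun _ : V => (2 : ℤ)) v)⟩

/-- Projection to a homogeneous component. -/
def TQFT.proj (g : Perm V) (d : ℤ) : TQFT g →+ TQFT g :=
  QuotientAddGroup.map (circIdeal (SameCycle.setoid g)).toAddSubgroup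
    (circIdeal (SameCycle.setoid g)).toAddSubgroup
    (weightedHomogeneousComponent (fun _ : V => (2 : ℤ)) d).toAddMonoidHom
    (fun _ hp => circIdeal_component d hp)

theorem TQFT.proj_mk (g : Perm V) (d : ℤ) (p : MvPolynomial V ℤ) : TQFT.proj g d (TQFT.mk g p) =
    TQFT.mk g (weightedHomogeneousComponent (fun _ : V => (2 : ℤ)) d p) := rfl

theorem TQFT.internal (g : Perm V) : DirectSum.IsInternal (TQFT.deg g) := by
  refine (isInternal_iff_proj _).2 ⟨fun d => TQFT.proj g (d + circles g), ?_, ?_, ?_⟩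
  · rintro d _ ⟨p, hp, rfl⟩
    change TQFT.proj g _ (TQFT.mk g p) = TQFT.mk g p
    rw [proj_mk, IsWeightedHomogeneous.weightedHomogeneousComponent_same hp]
  · rintro d e _ ⟨p, hp, rfl⟩ hde
    change TQFT.proj g _ (TQFT.mk g p) = 0
    rw [proj_mk, IsWeightedHomogeneous.weightedHomogeneousComponent_ne _ hp (by omega), map_zero]
  · rw [eq_top_iff]
    rintro f -
    obtain ⟨p, rfl⟩ := Ideal.Quotient.mk_surjective f
    induction p using MvPolynomial.induction_on' with
    | monomial u a =>
      refine AddSubgroup.mem_iSup_of_mem (Finsupp.weight (fun _ : V => (2 : ℤ)) u - circles g) ?_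
      exact TQFT.mk_mem_deg (isWeightedHomogeneous_monomial _ u a rfl) (by ring)
    | add p q hp hq => rw [map_add]; exact add_mem hp hq

theorem TQFT.finite (g : Perm V) : Module.Finite ℤ (TQFT g) := by
  have hint : Algebra.IsIntegral ℤ (TQFT g) := by
    constructor
    intro f
    obtain ⟨p, rfl⟩ := Ideal.Quotient.mk_surjective f
    induction p using MvPolynomial.induction_on with
    | C a => exact isIntegral_algebraMap (R := ℤ) (A := TQFT g) (x := a)
    | add p q hp hq => rw [map_add]; exact hp.add hq
    | mul_X p v hp =>
      rw [map_mul]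
      refine hp.mul (IsIntegral.of_pow (n := 2) (by norm_num) ?_)
      rw [← map_pow, (Ideal.Quotient.eq_zero_iff_mem).2 (sq_mem _ v)]
      exact isIntegral_zero
  have hft : Algebra.FiniteType ℤ (TQFT g) :=
    Algebra.FiniteType.of_surjective (Ideal.Quotient.mkₐ ℤ _) (Ideal.Quotient.mkₐ_surjective _ _)
  exact Algebra.IsIntegral.finite

theorem portMul_mem_deg {ι : S → V} {x x' : Matching col} {b b' : S → S} {y : Perm V} {q : Perm S}
    (h : IsPort ι x x' b b' y q) (z : Matching col) {d e l : ℤ} (hl : 2 * l = Fintype.card S)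
    {f : TQFT q} {m : TQFT (circ x' z)} (hf : f ∈ TQFT.deg q d) (hm : m ∈ TQFT.deg _ e) :
    portMul h z f m ∈ TQFT.deg _ (d + e + l) := by
  obtain ⟨f, hf, rfl⟩ := hf
  obtain ⟨m, hm, rfl⟩ := hm
  have hf' : IsWeightedHomogeneous (fun _ : V => (2 : ℤ)) (rename ι f) (d + circles q) := by
    intro c hc
    obtain ⟨u, rfl, hu⟩ := coeff_rename_ne_zero ι f c hc
    rw [← hf hu]
    rw [Finsupp.weight_apply, Finsupp.weight_apply, Finsupp.sum_mapDomain_index]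
    · intro _; exact zero_smul _ _
    · intro _ _ _; exact add_smul _ _ _
  have hlen := h.length z
  rw [numCl_univ, numCl_univ, numCl_univ] at hlen
  change TQFT.mk _ (contr col (circ x z) y * (rename ι f * m)) ∈ _
  rw [h.contr_eq]
  refine TQFT.mk_mem_deg ((edgeProd_homog (h.E z)).mul (hf'.mul hm)) ?_
  have : (4 * ((h.E z).length : ℤ) + 2 * circles q + 2 * circles (circ x' z)) =
    Fintype.card S + 2 * circles (circ x z) := by exact_mod_cast hlen
  linarith

theorem two_mul_circles (x : Matching col) : 2 * circles (circ x x) = Fintype.card V := by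
  have h := (isPort_id x x)
  have h1 := h.length x
  have h2 : h.E x = [] := by
    refine splits_eq_nil _ _ arcs_ne (arcs_pairwise (fun v _ => x.col_ne v)) ?_
    intro e he
    right
    rw [mem_arcs] at he
    rw [Perm.mul_apply, he.2, x.invol, circ_apply, he.1.1]; simp
  rw [h2, numCl_univ, List.length_nil] at h1
  change 4 * 0 + 2 * circles _ + 2 * circles _ = _ + 2 * circles _ at h1
  omega

end Degree

section ArcAlgebra
variable (S : Type) [Fintype S] [LinearOrder S]

/-- Crossingless matchings of a finite ordered set of points on a line. -/
@[ext] structure CMatching where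
  partner : Perm S
  invol : ∀ i, partner (partner i) = i
  ne : ∀ i, partner i ≠ i
  noncrossing : ∀ i j l p, i < j → j < l → l < p → ¬ (partner i = l ∧ partner j = p)

instance : Fintype (CMatching S) :=
  Fintype.ofInjective CMatching.partner fun _ _ h => CMatching.ext h

instance : DecidableEq (CMatching S) := Classical.decEq _

variable {S}

/-- The parity of the rank of a point. -/
def parity (s : S) : Bool := decide (Odd (Finset.univ.filter (· < s)).card)

theorem CMatching.parity_aux (a : CMatching S) {v w : S} (hvw : v < w) (h : a.partner v = w) :
    parity w = !parity v := by
  have hw : a.partner w = v := by rw [← h, a.invol]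
  have hmem : ∀ u, v < u ∧ u < w → v < a.partner u ∧ a.partner u < w := by
    rintro u ⟨h1, h2⟩
    constructor
    · by_contra hc
      rcases (not_lt.1 hc).lt_or_eq with hc | hc
      · exact a.noncrossing _ _ _ _ hc h1 h2 ⟨a.invol u, h⟩
      · exact h2.ne (by rw [← h, ← hc, a.invol])
    · by_contra hc
      rcases (not_lt.1 hc).lt_or_eq with hc | hc
      · exact a.noncrossing _ _ _ _ h1 h2 hc ⟨h, rfl⟩
      · exact h1.ne (by rw [← hw, hc, a.invol])
  have heven : (((Finset.univ.filter fun u => v < u ∧ u < w).card : ℕ) : ZMod 2) = 0 := by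
    rw [Finset.card_eq_sum_ones, Nat.cast_sum]
    refine Finset.sum_involution (fun u _ => a.partner u) ?_ ?_ ?_ ?_
    · intro u _; decide
    · intro u _ _; exact a.ne u
    · intro u hu
      simp only [Finset.mem_filter, Finset.mem_univ, true_and] at hu ⊢
      exact hmem u hu
    · intro u _; exact a.invol u
  have heven' : Even (Finset.univ.filter fun u => v < u ∧ u < w).card := by
    rw [even_iff_two_dvd]
    exact (ZMod.natCast_eq_zero_iff _ _).1 heven
  have hsplit : (Finset.univ.filter (· < w)) =
      insert v ((Finset.univ.filter (· < v)) ∪ (Finset.univ.filter fun u => v < u ∧ u < w)) := by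
    ext u
    simp only [Finset.mem_filter, Finset.mem_univ, true_and, Finset.mem_insert, Finset.mem_union]
    constructor
    · intro hu
      rcases lt_trichotomy u v with k | k | k
      · exact Or.inr (Or.inl k)
      · exact Or.inl k
      · exact Or.inr (Or.inr ⟨k, hu⟩)
    · rintro (rfl | k | k)
      · exact hvw
      · exact k.trans hvw
      · exact k.2
  have hcard : (Finset.univ.filter (· < w)).card = (Finset.univ.filter (· < v)).card +
      (Finset.univ.filter fun u => v < u ∧ u < w).card + 1 := by
    rw [hsplit, Finset.card_insert_of_notMem, Finset.card_union_of_disjoint]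
    · rw [Finset.disjoint_filter]
      intro u _ h1 h2
      exact lt_asymm h1 h2.1
    · simp
  rw [parity, parity, hcard, ← decide_not, decide_eq_decide]
  rw [Nat.odd_add_one, Nat.odd_add]
  simp [heven']

theorem CMatching.parity_partner (a : CMatching S) (v : S) :
    parity (a.partner v) = !parity v := by
  rcases lt_trichotomy v (a.partner v) with h | h | h
  · exact a.parity_aux h rfl
  · exact absurd h.symm (a.ne v)
  · rw [a.parity_aux h (a.invol v), Bool.not_not]

/-- A crossingless matching joins points of opposite parity. -/
def CMatching.toMatching (a : CMatching S) : Matching (parity (S := S)) :=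
  ⟨a.partner, a.invol, a.parity_partner⟩

/-- `F(W(b)a)`, where `W(b)` is the mirror image of `b`. -/
abbrev CMatching.F (b a : CMatching S) : Type := TQFT (circ b.toMatching a.toMatching)

variable (S)
/-- The arc ring `H(S)`, the direct sum over all crossingless matchings `a`, `b` of `F(W(b)a)`, shifted
by half of the number of points (see `ArcRing.deg`).  The product of `F(W(c)b)` and `F(W(b')a)` is
zero unless `b = b'`, and is then the contraction of `b`. -/
def ArcRing : Type := ∀ b a : CMatching S, b.F a

instance : AddCommGroup (ArcRing S) := inferInstanceAs (AddCommGroup (∀ b a : CMatching S, b.F a))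

variable {S}

theorem ArcRing.ext {f g : ArcRing S} (h : ∀ b a, f b a = g b a) : f = g :=
  funext fun b => funext fun a => h b a

instance : Mul (ArcRing S) where
  mul f g c a := ∑ b : CMatching S, mulF c.toMatching b.toMatching a.toMatching (f c b) (g b a)

instance : One (ArcRing S) where
  one b a := if b = a then 1 else 0

theorem ArcRing.mul_apply (f g : ArcRing S) (c a : CMatching S) : (f * g) c a =
    ∑ b : CMatching S, mulF c.toMatching b.toMatching a.toMatching (f c b) (g b a) := rfl
theorem ArcRing.one_apply (b a : CMatching S) :
    (1 : ArcRing S) b a = if b = a then 1 else 0 := rfl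
theorem ArcRing.add_apply (f g : ArcRing S) (b a : CMatching S) :
    (f + g) b a = f b a + g b a := rfl
theorem ArcRing.zero_apply (b a : CMatching S) : (0 : ArcRing S) b a = 0 := rfl

instance : Ring (ArcRing S) :=
  { (inferInstance : AddCommGroup (ArcRing S)), (inferInstance : Mul (ArcRing S)),
    (inferInstance : One (ArcRing S)) with
    left_distrib := fun f g h => ArcRing.ext fun c a => by
      simp only [ArcRing.mul_apply, ArcRing.add_apply, mulF, portMul_add_right,
        Finset.sum_add_distrib]
    right_distrib := fun f g h => ArcRing.ext fun c a => by
      simp only [ArcRing.mul_apply, ArcRing.add_apply, mulF, portMul_add_left,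
        Finset.sum_add_distrib]
    zero_mul := fun f => ArcRing.ext fun c a => by
      simp only [ArcRing.mul_apply, ArcRing.zero_apply, mulF, portMul_zero_left,
        Finset.sum_const_zero]
    mul_zero := fun f => ArcRing.ext fun c a => by
      simp only [ArcRing.mul_apply, ArcRing.zero_apply, mulF, portMul_zero_right,
        Finset.sum_const_zero]
    mul_assoc := fun f g h => ArcRing.ext fun d a => by
      simp only [ArcRing.mul_apply]
      have h1 : ∀ c : CMatching S, mulF d.toMatching c.toMatching a.toMatching
          (∑ b : CMatching S, mulF d.toMatching b.toMatching c.toMatching (f d b) (g b c)) (h c a) =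
          ∑ b : CMatching S, mulF d.toMatching c.toMatching a.toMatching
            (mulF d.toMatching b.toMatching c.toMatching (f d b) (g b c)) (h c a) :=
        fun c => portMul_sum_left _ _ _ _ _
      have h2 : ∀ b : CMatching S, mulF d.toMatching b.toMatching a.toMatching (f d b)
          (∑ c : CMatching S, mulF b.toMatching c.toMatching a.toMatching (g b c) (h c a)) =
          ∑ c : CMatching S, mulF d.toMatching b.toMatching a.toMatching (f d b)
            (mulF b.toMatching c.toMatching a.toMatching (g b c) (h c a)) :=
        fun b => portMul_sum_right _ _ _ _ _
      simp only [h1, h2, mulF_assoc]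
      exact Finset.sum_comm
    one_mul := fun f => ArcRing.ext fun c a => by
      rw [ArcRing.mul_apply, Finset.sum_eq_single c]
      · rw [ArcRing.one_apply, if_pos rfl]; exact portMul_one _ _ _
      · intro b _ hb
        rw [ArcRing.one_apply, if_neg hb.symm]; exact portMul_zero_left _ _ _
      · simp
    mul_one := fun f => ArcRing.ext fun c a => by
      rw [ArcRing.mul_apply, Finset.sum_eq_single a]
      · rw [ArcRing.one_apply, if_pos rfl]; exact mulF_one _ _ _
      · intro b _ hb
        rw [ArcRing.one_apply, if_neg hb]; exact portMul_zero_right _ _ _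
      · simp }

variable (S) in
/-- Half of the number of points, the number of arcs of a matching. -/
def half : ℕ := Fintype.card S / 2

theorem CMatching.card_eq (a : CMatching S) : 2 * half S = Fintype.card S := by
  have := two_mul_circles a.toMatching
  rw [half]; omega

theorem CMatching.card_eq' (a : CMatching S) : 2 * (half S : ℤ) = Fintype.card S := by
  exact_mod_cast a.card_eq

/-- The component at `(b, a)`. -/
def ArcRing.ev (b a : CMatching S) : ArcRing S →+ b.F a where
  toFun f := f b a
  map_zero' := rfl
  map_add' _ _ := rfl

/-- The grading of the arc ring: the component `F(W(b)a)` is shifted up by the number of arcs. -/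
def ArcRing.deg (S : Type) [Fintype S] [LinearOrder S] (d : ℤ) : AddSubgroup (ArcRing S) :=
  ⨅ b : CMatching S, ⨅ a : CMatching S,
    (TQFT.deg (circ b.toMatching a.toMatching) (d - half S)).comap (ArcRing.ev b a)

theorem ArcRing.mem_deg {d : ℤ} {f : ArcRing S} : f ∈ ArcRing.deg S d ↔ ∀ b a : CMatching S,
    f b a ∈ TQFT.deg (circ b.toMatching a.toMatching) (d - half S) := by
  simp only [ArcRing.deg, AddSubgroup.mem_iInf, AddSubgroup.mem_comap]
  rfl

theorem ArcRing.internal : DirectSum.IsInternal (ArcRing.deg S) :=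
  isInternal_fam (J := CMatching S × CMatching S)
    (𝓜 := fun p d => TQFT.deg (circ p.1.toMatching p.2.toMatching) (d - half S))
    (fun p => ArcRing.ev p.1 p.2)
    ⟨fun _ _ h => ArcRing.ext fun b a => congrFun h (b, a), fun f => ⟨fun b a => f (b, a), rfl⟩⟩
    (fun _ _ => ArcRing.mem_deg.trans ⟨fun h p => h p.1 p.2, fun h b a => h (b, a)⟩)
    (fun p => isInternal_shift (TQFT.internal (circ p.1.toMatching p.2.toMatching)) (half S))

instance : GradedRing (ArcRing.deg S) :=
  { ArcRing.internal.chooseDecomposition with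
    one_mem := by
      rw [ArcRing.mem_deg]
      intro b a
      rw [ArcRing.one_apply]
      split_ifs with h
      · subst h
        have := two_mul_circles b.toMatching
        have h2 := b.card_eq
        rw [← map_one (TQFT.mk _)]
        exact TQFT.mk_mem_deg (isWeightedHomogeneous_one ℤ _) (by omega)
      · exact zero_mem _
    mul_mem := by
      intro i j f g hf hg
      rw [ArcRing.mem_deg] at *
      intro c a
      rw [ArcRing.mul_apply]
      refine sum_mem fun b _ => ?_
      have := portMul_mem_deg (isPort_id c.toMatching b.toMatching) a.toMatching a.card_eq'
        (hf c b) (hg b a)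
      rwa [show i - (half S : ℤ) + (j - half S) + half S = i + j - half S by ring] at this }

/-- The module underlying the balanced indecomposable projective `Q_a`, the direct sum of `F(W(b)a)` over
all `b`; the arc ring acts as on its column `H 1_a`. -/
def CMatching.QCarrier (a : CMatching S) : Type := ∀ b : CMatching S, b.F a

instance (a : CMatching S) : AddCommGroup a.QCarrier :=
  inferInstanceAs (AddCommGroup (∀ b : CMatching S, b.F a))

instance (a : CMatching S) : SMul (ArcRing S) a.QCarrier where
  smul f m c := ∑ b : CMatching S, mulF c.toMatching b.toMatching a.toMatching (f c b) (m b)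

theorem CMatching.smul_apply {a : CMatching S} (f : ArcRing S) (m : a.QCarrier) (c : CMatching S) :
    (f • m) c = ∑ b : CMatching S, mulF c.toMatching b.toMatching a.toMatching (f c b) (m b) := rfl

theorem CMatching.add_apply {a : CMatching S} (m n : a.QCarrier) (c : CMatching S) :
    (m + n) c = m c + n c := rfl
theorem CMatching.zero_apply {a : CMatching S} (c : CMatching S) : (0 : a.QCarrier) c = 0 := rfl

instance (a : CMatching S) : Module (ArcRing S) a.QCarrier where
  one_smul m := funext fun c => by
    rw [CMatching.smul_apply, Finset.sum_eq_single c]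
    · rw [ArcRing.one_apply, if_pos rfl]; exact portMul_one _ _ _
    · intro b _ hb
      rw [ArcRing.one_apply, if_neg hb.symm]; exact portMul_zero_left _ _ _
    · simp
  mul_smul f g m := funext fun d => by
    simp only [CMatching.smul_apply, ArcRing.mul_apply]
    have h1 : ∀ c : CMatching S, mulF d.toMatching c.toMatching a.toMatching
        (∑ b : CMatching S, mulF d.toMatching b.toMatching c.toMatching (f d b) (g b c)) (m c) =
        ∑ b : CMatching S, mulF d.toMatching c.toMatching a.toMatching
          (mulF d.toMatching b.toMatching c.toMatching (f d b) (g b c)) (m c) :=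
      fun c => portMul_sum_left _ _ _ _ _
    have h2 : ∀ b : CMatching S, mulF d.toMatching b.toMatching a.toMatching (f d b)
        (∑ c : CMatching S, mulF b.toMatching c.toMatching a.toMatching (g b c) (m c)) =
        ∑ c : CMatching S, mulF d.toMatching b.toMatching a.toMatching (f d b)
          (mulF b.toMatching c.toMatching a.toMatching (g b c) (m c)) :=
      fun b => portMul_sum_right _ _ _ _ _
    simp only [h1, h2, mulF_assoc]
    exact Finset.sum_comm
  smul_zero f := funext fun c => by
    simp only [CMatching.smul_apply, CMatching.zero_apply, mulF, portMul_zero_right,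
      Finset.sum_const_zero]
  zero_smul m := funext fun c => by
    simp only [CMatching.smul_apply, CMatching.zero_apply, ArcRing.zero_apply, mulF,
      portMul_zero_left, Finset.sum_const_zero]
  smul_add f m n := funext fun c => by
    simp only [CMatching.smul_apply, CMatching.add_apply, mulF, portMul_add_right,
      Finset.sum_add_distrib]
  add_smul f g m := funext fun c => by
    simp only [CMatching.smul_apply, CMatching.add_apply, ArcRing.add_apply, mulF,
      portMul_add_left, Finset.sum_add_distrib]

/-- The component at `b`. -/
def CMatching.ev (a b : CMatching S) : a.QCarrier →+ b.F a where
  toFun f := f b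
  map_zero' := rfl
  map_add' _ _ := rfl

/-- The grading of `Q_a`: that of `F(W(b)a)`, without shift. -/
def CMatching.Qdeg (a : CMatching S) (d : ℤ) : AddSubgroup a.QCarrier :=
  ⨅ b : CMatching S, (TQFT.deg (circ b.toMatching a.toMatching) d).comap (a.ev b)

theorem CMatching.mem_Qdeg {a : CMatching S} {d : ℤ} {f : a.QCarrier} : f ∈ a.Qdeg d ↔
    ∀ b : CMatching S, f b ∈ TQFT.deg (circ b.toMatching a.toMatching) d := by
  simp only [CMatching.Qdeg, AddSubgroup.mem_iInf, AddSubgroup.mem_comap]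
  rfl

/-- The balanced indecomposable projective graded module `Q_a = H 1_a {-m}` over the arc ring. -/
def CMatching.Q (a : CMatching S) : GrMod (ArcRing S) (ArcRing.deg S) where
  carrier := a.QCarrier
  deg := a.Qdeg
  internal := isInternal_fam (𝓜 := fun b d => TQFT.deg (circ b.toMatching a.toMatching) d)
    (fun b => a.ev b) ⟨fun _ _ h => funext fun b => congrFun h b, fun f => ⟨f, rfl⟩⟩
    (fun _ _ => CMatching.mem_Qdeg) (fun b => TQFT.internal _)
  smul_mem := by
    intro i j f hf m hm
    rw [ArcRing.mem_deg] at hf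
    rw [CMatching.mem_Qdeg] at *
    intro c
    rw [CMatching.smul_apply]
    refine sum_mem fun b _ => ?_
    have := portMul_mem_deg (isPort_id c.toMatching b.toMatching) a.toMatching a.card_eq'
        (hf c b) (hm b)
    rwa [show i - (half S : ℤ) + j + half S = i + j by ring] at this
  finite := by
    have h : Module.Finite ℤ a.QCarrier := finite_fam (fun b => a.ev b)
      ⟨fun _ _ h => funext fun b => congrFun h b, fun f => ⟨f, rfl⟩⟩ (fun b => TQFT.finite _)
    exact Module.Finite.of_restrictScalars_finite ℤ _ _

end ArcAlgebra

section TangleBimodule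
variable {S S' : Type} [Fintype S] [LinearOrder S] [Fintype S'] [LinearOrder S']

/-- Colours of the endpoints of a flat tangle from the points `S` (bottom, on the left of `⊕`) to the
points `S'` (top): parity at the top, opposite parity at the bottom. -/
def tangleCol (S S' : Type) [Fintype S] [LinearOrder S] [Fintype S'] [LinearOrder S'] :
    S ⊕ S' → Bool :=
  Sum.elim (fun s => !parity s) (fun s => parity s)

/-- A flat tangle without circles, as the matching of its endpoints. -/
abbrev Tangle (S S' : Type) [Fintype S] [LinearOrder S] [Fintype S'] [LinearOrder S'] : Type :=
  Matching (tangleCol S S')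

/-- The outer boundary `W(b)`, `a`, as a matching of the endpoints of a flat tangle. -/
def join (b : CMatching S') (a : CMatching S) : Tangle S S' where
  toPerm := Equiv.sumCongr a.partner b.partner
  invol v := by rcases v with s | s <;> simp [a.invol, b.invol]
  col_ne v := by rcases v with s | s <;> simp [tangleCol, a.parity_partner, b.parity_partner]

theorem leftPort (b' b : CMatching S') (a : CMatching S) :
    IsPort (Sum.inr : S' → S ⊕ S') (join b' a) (join b a) b.partner b'.partner
      (Equiv.sumCongr (1 : Perm S) b.partner) (circ b'.toMatching b.toMatching) where
  inj := Sum.inr_injective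
  hy _ := rfl
  hy' v hv := by
    rcases v with s | s
    · rfl
    · exact absurd rfl (hv s)
  hx _ := rfl
  hx' _ := rfl
  hxx v hv := by
    rcases v with s | s
    · rfl
    · exact absurd rfl (hv s)
  hq _ := rfl

theorem rightPort (b : CMatching S') (a' a : CMatching S) :
    IsPort (Sum.inl : S → S ⊕ S') (join b a') (join b a) a.partner a'.partner
      (Equiv.sumCongr a.partner (1 : Perm S')) (circ a.toMatching a'.toMatching) where
  inj := Sum.inl_injective
  hy _ := rfl
  hy' v hv := by
    rcases v with s | s
    · exact absurd rfl (hv s)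
    · rfl
  hx _ := rfl
  hx' _ := rfl
  hxx v hv := by
    rcases v with s | s
    · exact absurd rfl (hv s)
    · rfl
  hq s := by
    rw [circ_apply]
    cases h : parity s <;> simp [tangleCol, h, CMatching.toMatching]

namespace Tangle

/-- The group underlying the bimodule of a flat tangle `T`: the direct sum over `a`, `b` of
`F(W(b)Ta)`.  The arc rings of the top and of the bottom endpoints act by contraction. -/
def Carrier (T : Tangle S S') : Type :=
  ∀ (b : CMatching S') (a : CMatching S), TQFT (circ (join b a) T)

variable (T : Tangle S S')

instance : AddCommGroup (Carrier T) :=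
  inferInstanceAs (AddCommGroup (∀ (b : CMatching S') (a : CMatching S), TQFT (circ (join b a) T)))

variable {T}

theorem ext {m n : Carrier T} (h : ∀ b a, m b a = n b a) : m = n :=
  funext fun b => funext fun a => h b a
theorem add_apply (m n : Carrier T) (b : CMatching S') (a : CMatching S) :
    (m + n) b a = m b a + n b a := rfl
theorem zero_apply (b : CMatching S') (a : CMatching S) : (0 : Carrier T) b a = 0 := rfl

instance : SMul (ArcRing S') (Carrier T) where
  smul h m c a := ∑ b : CMatching S', portMul (leftPort c b a) T (h c b) (m b a)

instance : SMul (ArcRing S)ᵐᵒᵖ (Carrier T) where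
  smul h m b c := ∑ a : CMatching S, portMul (rightPort b c a) T (h.unop a c) (m b a)

theorem smul_apply (h : ArcRing S') (m : Carrier T) (c : CMatching S') (a : CMatching S) :
    (h • m) c a = ∑ b : CMatching S', portMul (leftPort c b a) T (h c b) (m b a) := rfl
theorem op_smul_apply (h : (ArcRing S)ᵐᵒᵖ) (m : Carrier T) (b : CMatching S') (c : CMatching S) :
    (h • m) b c = ∑ a : CMatching S, portMul (rightPort b c a) T (h.unop a c) (m b a) := rfl

instance : Module (ArcRing S') (Carrier T) where
  one_smul m := ext fun c a => by
    rw [smul_apply, Finset.sum_eq_single c]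
    · rw [ArcRing.one_apply, if_pos rfl]; exact portMul_one _ _ _
    · intro b _ hb
      rw [ArcRing.one_apply, if_neg hb.symm]; exact portMul_zero_left _ _ _
    · simp
  mul_smul f g m := ext fun d a => by
    simp only [smul_apply, ArcRing.mul_apply]
    have h1 : ∀ c : CMatching S', portMul (leftPort d c a) T
        (∑ b : CMatching S', mulF d.toMatching b.toMatching c.toMatching (f d b) (g b c)) (m c a) =
        ∑ b : CMatching S', portMul (leftPort d b a) T (f d b)
          (portMul (leftPort b c a) T (g b c) (m c a)) := fun c => by
      rw [portMul_sum_left]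
      exact Finset.sum_congr rfl fun b _ => portMul_assoc_left (b := c.toMatching)
        (b' := b.toMatching) (b'' := d.toMatching) (leftPort b c a) (leftPort d b a)
        (leftPort d c a) T (f d b) (g b c) (m c a)
    have h2 : ∀ b : CMatching S', portMul (leftPort d b a) T (f d b)
        (∑ c : CMatching S', portMul (leftPort b c a) T (g b c) (m c a)) =
        ∑ c : CMatching S', portMul (leftPort d b a) T (f d b)
          (portMul (leftPort b c a) T (g b c) (m c a)) :=
      fun b => portMul_sum_right _ _ _ _ _
    simp only [h1, h2]
    exact Finset.sum_comm
  smul_zero f := ext fun c a => by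
    simp only [smul_apply, zero_apply, portMul_zero_right, Finset.sum_const_zero]
  zero_smul m := ext fun c a => by
    simp only [smul_apply, zero_apply, ArcRing.zero_apply, portMul_zero_left,
      Finset.sum_const_zero]
  smul_add f m n := ext fun c a => by
    simp only [smul_apply, add_apply, portMul_add_right, Finset.sum_add_distrib]
  add_smul f g m := ext fun c a => by
    simp only [smul_apply, add_apply, ArcRing.add_apply, portMul_add_left, Finset.sum_add_distrib]

instance : Module (ArcRing S)ᵐᵒᵖ (Carrier T) where
  one_smul m := ext fun b c => by
    rw [op_smul_apply, Finset.sum_eq_single c]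
    · rw [MulOpposite.unop_one, ArcRing.one_apply, if_pos rfl]; exact portMul_one _ _ _
    · intro a _ ha
      rw [MulOpposite.unop_one, ArcRing.one_apply, if_neg ha]; exact portMul_zero_left _ _ _
    · simp
  mul_smul f g m := ext fun b d => by
    simp only [op_smul_apply, MulOpposite.unop_mul, ArcRing.mul_apply]
    have h1 : ∀ a : CMatching S, portMul (rightPort b d a) T
        (∑ c : CMatching S, mulF a.toMatching c.toMatching d.toMatching (g.unop a c) (f.unop c d))
          (m b a) =
        ∑ c : CMatching S, portMul (rightPort b d c) T (f.unop c d)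
          (portMul (rightPort b c a) T (g.unop a c) (m b a)) := fun a => by
      rw [portMul_sum_left]
      exact Finset.sum_congr rfl fun c _ => portMul_assoc_right (a := a.toMatching)
        (a' := c.toMatching) (a'' := d.toMatching) (rightPort b c a) (rightPort b d c)
        (rightPort b d a) T (g.unop a c) (f.unop c d) (m b a)
    have h2 : ∀ c : CMatching S, portMul (rightPort b d c) T (f.unop c d)
        (∑ a : CMatching S, portMul (rightPort b c a) T (g.unop a c) (m b a)) =
        ∑ a : CMatching S, portMul (rightPort b d c) T (f.unop c d)
          (portMul (rightPort b c a) T (g.unop a c) (m b a)) :=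
      fun c => portMul_sum_right _ _ _ _ _
    simp only [h1, h2]
    exact Finset.sum_comm
  smul_zero f := ext fun b c => by
    simp only [op_smul_apply, zero_apply, portMul_zero_right, Finset.sum_const_zero]
  zero_smul m := ext fun b c => by
    simp only [op_smul_apply, zero_apply, MulOpposite.unop_zero, ArcRing.zero_apply,
      portMul_zero_left, Finset.sum_const_zero]
  smul_add f m n := ext fun b c => by
    simp only [op_smul_apply, add_apply, portMul_add_right, Finset.sum_add_distrib]
  add_smul f g m := ext fun b c => by
    simp only [op_smul_apply, add_apply, MulOpposite.unop_add, ArcRing.add_apply,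
      portMul_add_left, Finset.sum_add_distrib]

instance : SMulCommClass (ArcRing S') (ArcRing S)ᵐᵒᵖ (Carrier T) where
  smul_comm f g m := ext fun d c => by
    simp only [smul_apply, op_smul_apply]
    have h1 : ∀ b : CMatching S', portMul (leftPort d b c) T (f d b)
        (∑ a : CMatching S, portMul (rightPort b c a) T (g.unop a c) (m b a)) =
        ∑ a : CMatching S, portMul (leftPort d b c) T (f d b)
          (portMul (rightPort b c a) T (g.unop a c) (m b a)) :=
      fun b => portMul_sum_right _ _ _ _ _
    have h2 : ∀ a : CMatching S, portMul (rightPort d c a) T (g.unop a c)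
        (∑ b : CMatching S', portMul (leftPort d b a) T (f d b) (m b a)) =
        ∑ b : CMatching S', portMul (leftPort d b c) T (f d b)
          (portMul (rightPort b c a) T (g.unop a c) (m b a)) := fun a => by
      rw [portMul_sum_right]
      exact Finset.sum_congr rfl fun b _ => portMul_comm (leftPort d b a) (rightPort d c a)
        (rightPort b c a) (leftPort d b c) T (f d b) (g.unop a c) (m b a)
    simp only [h1, h2]
    exact Finset.sum_comm

variable (T) in
/-- The component at `(b, a)`. -/
def ev (b : CMatching S') (a : CMatching S) : Carrier T →+ TQFT (circ (join b a) T) where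
  toFun m := m b a
  map_zero' := rfl
  map_add' _ _ := rfl

variable (T) in
/-- The grading: `F(W(b)Ta)` is shifted up by half of the number of bottom endpoints. -/
def deg (d : ℤ) : AddSubgroup (Carrier T) :=
  ⨅ b : CMatching S', ⨅ a : CMatching S,
    (TQFT.deg (circ (join b a) T) (d - half S)).comap (ev T b a)

theorem mem_deg {d : ℤ} {m : Carrier T} : m ∈ deg T d ↔ ∀ (b : CMatching S') (a : CMatching S),
    m b a ∈ TQFT.deg (circ (join b a) T) (d - half S) := by
  simp only [deg, AddSubgroup.mem_iInf, AddSubgroup.mem_comap]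
  rfl

variable (T) in
/-- The graded bimodule `F(T)`. -/
def bimod : GrBimod (ArcRing S') (ArcRing.deg S') (ArcRing S) (ArcRing.deg S) where
  carrier := Carrier T
  deg := deg T
  internal := isInternal_fam (J := CMatching S' × CMatching S)
    (𝓜 := fun p d => TQFT.deg (circ (join p.1 p.2) T) (d - half S)) (fun p => ev T p.1 p.2)
    ⟨fun _ _ h => ext fun b a => congrFun h (b, a), fun f => ⟨fun b a => f (b, a), rfl⟩⟩
    (fun _ _ => mem_deg.trans ⟨fun h p => h p.1 p.2, fun h b a => h (b, a)⟩)
    (fun p => isInternal_shift (TQFT.internal (circ (join p.1 p.2) T)) (half S))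
  smul_mem := by
    intro i j f hf m hm
    rw [ArcRing.mem_deg] at hf
    rw [mem_deg] at *
    intro c a
    rw [smul_apply]
    refine sum_mem fun b _ => ?_
    have := portMul_mem_deg (leftPort c b a) T c.card_eq' (hf c b) (hm b a)
    rwa [show i - (half S' : ℤ) + (j - half S) + half S' = i + j - half S by ring] at this
  smul_mem' := by
    intro i j m hm f hf
    rw [ArcRing.mem_deg] at hf
    rw [mem_deg] at *
    intro b c
    rw [op_smul_apply]
    refine sum_mem fun a _ => ?_
    have := portMul_mem_deg (rightPort b c a) T c.card_eq' (hf a c) (hm b a)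
    rwa [show j - (half S : ℤ) + (i - half S) + half S = i + j - half S by ring] at this
  finite := by
    have h : Module.Finite ℤ (Carrier T) := finite_fam (J := CMatching S' × CMatching S)
      (M := fun p => TQFT (circ (join p.1 p.2) T)) (fun p => ev T p.1 p.2)
      ⟨fun _ _ h => ext fun b a => congrFun h (b, a), fun f => ⟨fun b a => f (b, a), rfl⟩⟩
      (fun p => TQFT.finite _)
    exact Module.Finite.of_restrictScalars_finite ℤ _ _

end Tangle
end TangleBimodule

section Elementary
variable {n : ℕ}

/-- The bottom endpoints `S` and the top endpoints `S'` of an elementary flat tangle: they differ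
exactly at the two neighbouring positions `l`, `r = l + 1`. -/
structure Flip (S S' : Finset (Fin n)) (l r : Fin n) : Prop where
  succ : (r : ℕ) = l + 1
  left : l ∈ S ↔ l ∉ S'
  right : r ∈ S ↔ r ∉ S'
  other : ∀ j, j ≠ l → j ≠ r → (j ∈ S ↔ j ∈ S')

namespace Flip
variable {S S' : Finset (Fin n)} {l r : Fin n}

theorem symm (h : Flip S S' l r) : Flip S' S l r :=
  ⟨h.succ, by rw [h.left, not_not], by rw [h.right, not_not],
    fun j h1 h2 => (h.other j h1 h2).symm⟩

theorem ne (h : Flip S S' l r) : l ≠ r := fun e => by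
  have := h.succ
  rw [e] at this; omega

/-- The endpoint at a position that belongs to exactly one of `S`, `S'`. -/
def point (j : Fin n) (h : j ∈ S ∨ j ∈ S') : S ⊕ S' :=
  if hj : j ∈ S then Sum.inl ⟨j, hj⟩ else Sum.inr ⟨j, h.resolve_left hj⟩

theorem mem_l (h : Flip S S' l r) : l ∈ S ∨ l ∈ S' := by rw [h.left]; tauto
theorem mem_r (h : Flip S S' l r) : r ∈ S ∨ r ∈ S' := by rw [h.right]; tauto

/-- The elementary tangle: the two endpoints at the positions `l` and `r` are joined, and all other
endpoints are joined vertically.  This is a shifted line if one of the two is at the bottom and the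
other at the top, a cap if both are at the bottom, a cup if both are at the top. -/
def partner (h : Flip S S' l r) (v : S ⊕ S') : S ⊕ S' :=
  if hl : Sum.elim (fun s : S => (s : Fin n)) (fun s : S' => (s : Fin n)) v = l then
    point r h.mem_r
  else if hr : Sum.elim (fun s : S => (s : Fin n)) (fun s : S' => (s : Fin n)) v = r then
    point l h.mem_l
  else match v with
    | .inl s => .inr ⟨s, (h.other s hl hr).1 s.2⟩
    | .inr s => .inl ⟨s, (h.other s hl hr).2 s.2⟩

theorem elim_point (j : Fin n) (h : j ∈ S ∨ j ∈ S') :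
    Sum.elim (fun s : S => (s : Fin n)) (fun s : S' => (s : Fin n)) (point j h) = j := by
  rw [point]; split_ifs <;> rfl

theorem point_eq (v : S ⊕ S') {j : Fin n} (h : j ∈ S ↔ j ∉ S') (hj : j ∈ S ∨ j ∈ S')
    (hv : Sum.elim (fun s : S => (s : Fin n)) (fun s : S' => (s : Fin n)) v = j) :
    point j hj = v := by
  subst hv
  rcases v with s | s
  · exact dif_pos s.2
  · exact dif_neg fun e => h.1 e s.2

theorem partner_partner (h : Flip S S' l r) (v : S ⊕ S') : h.partner (h.partner v) = v := by
  by_cases hl : Sum.elim (fun s : S => (s : Fin n)) (fun s : S' => (s : Fin n)) v = l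
  · have e : h.partner v = point r h.mem_r := by rw [partner, dif_pos hl]
    rw [e, partner, dif_neg, dif_pos (elim_point _ _)]
    · exact point_eq v h.left _ hl
    · rw [elim_point]; exact h.ne.symm
  · by_cases hr : Sum.elim (fun s : S => (s : Fin n)) (fun s : S' => (s : Fin n)) v = r
    · have e : h.partner v = point l h.mem_l := by rw [partner, dif_neg hl, dif_pos hr]
      rw [e, partner, dif_pos (elim_point _ _)]
      exact point_eq v h.right _ hr
    · rcases v with s | s
      · have e : h.partner (.inl s) = .inr ⟨s, (h.other s hl hr).1 s.2⟩ := by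
          rw [partner, dif_neg hl, dif_neg hr]
        rw [e, partner, dif_neg (by exact hl), dif_neg (by exact hr)]
      · have e : h.partner (.inr s) = .inl ⟨s, (h.other s hl hr).2 s.2⟩ := by
          rw [partner, dif_neg hl, dif_neg hr]
        rw [e, partner, dif_neg (by exact hl), dif_neg (by exact hr)]

/-- The number of elements of `S` before a position. -/
def below (S : Finset (Fin n)) (t : ℕ) : ℕ := (S.filter fun i : Fin n => (i : ℕ) < t).card

theorem parity_eq (s : S) : parity s = decide (Odd (below S (s : Fin n))) := by
  rw [parity, below]
  have : (Finset.univ.filter (· < s)).card = (S.filter fun i : Fin n => (i : ℕ) < (s : Fin n)).card := by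
    rw [← Finset.card_map (Function.Embedding.subtype _)]
    congr 1
    ext j
    simp only [Finset.mem_map, Finset.mem_filter, Finset.mem_univ, true_and]
    constructor
    · rintro ⟨t, ht, rfl⟩
      exact ⟨t.2, ht⟩
    · rintro ⟨h1, h2⟩
      exact ⟨⟨j, h1⟩, h2, rfl⟩
  rw [this]

theorem below_succ (S : Finset (Fin n)) (j : Fin n) :
    below S (j + 1) = below S j + if j ∈ S then 1 else 0 := by
  have h : (S.filter fun i : Fin n => (i : ℕ) < j + 1) =
      (S.filter fun i : Fin n => (i : ℕ) < j) ∪ S.filter fun i : Fin n => i = j := by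
    ext i
    simp only [Finset.mem_filter, Finset.mem_union, Nat.lt_succ_iff, le_iff_lt_or_eq, Fin.ext_iff]
    tauto
  rw [below, h, Finset.card_union_of_disjoint]
  · rw [Finset.filter_eq']
    split_ifs <;> rfl
  · rw [Finset.disjoint_filter]
    rintro i - h1 rfl
    exact lt_irrefl _ h1

theorem below_le (h : Flip S S' l r) {t : ℕ} (ht : t ≤ l) : below S t = below S' t := by
  rw [below, below]
  congr 1
  ext i
  simp only [Finset.mem_filter]
  refine and_congr_left fun hi => h.other i ?_ ?_
  · rintro rfl; omega
  · rintro rfl; have := h.succ; omega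

theorem below_r (h : Flip S S' l r) : below S r = below S l + if l ∈ S then 1 else 0 := by
  rw [h.succ, below_succ]

theorem odd_below (h : Flip S S' l r) (k : ℕ) (hk : r + 1 + k < n + 1) :
    Odd (below S (r + 1 + k)) ↔ Odd (below S' (r + 1 + k)) := by
  induction k with
  | zero =>
    rw [add_zero, below_succ, below_succ, h.below_r, h.symm.below_r, h.below_le le_rfl]
    have h1 := h.left
    have h2 := h.right
    by_cases a : l ∈ S' <;> by_cases b : r ∈ S' <;> simp [h1, h2, a, b, Nat.odd_add_one]
  | succ k ih =>
    have := ih (by omega)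
    have e := below_succ S ⟨r + 1 + k, by omega⟩
    have e' := below_succ S' ⟨r + 1 + k, by omega⟩
    have hs := h.succ
    have hm := h.other ⟨r + 1 + k, by omega⟩ (fun q => by have := congrArg Fin.val q; simp at this; omega)
      (fun q => by have := congrArg Fin.val q; simp at this; omega)
    simp only [← hm] at e'
    change below S (r + 1 + k + 1) = below S (r + 1 + k) + _ at e
    change below S' (r + 1 + k + 1) = below S' (r + 1 + k) + _ at e'
    rw [← add_assoc, e, e']
    split_ifs
    · rw [Nat.odd_add_one, Nat.odd_add_one, this]
    · exact this

theorem odd_below' (h : Flip S S' l r) (j : Fin n) (hl : j ≠ l) (hr : j ≠ r) :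
    Odd (below S j) ↔ Odd (below S' j) := by
  have hs := h.succ
  have hl' : (j : ℕ) ≠ l := fun e => hl (Fin.ext e)
  have hr' : (j : ℕ) ≠ r := fun e => hr (Fin.ext e)
  by_cases hj : (j : ℕ) ≤ l
  · rw [h.below_le hj]
  · have := h.odd_below (j - (r + 1)) (by omega)
    rwa [show (r : ℕ) + 1 + (j - (r + 1)) = j by omega] at this

theorem tangleCol_inl (s : S) :
    tangleCol S S' (.inl s) = !decide (Odd (below S (s : Fin n))) := by
  rw [← parity_eq]; rfl
theorem tangleCol_inr (s : S') :
    tangleCol S S' (.inr s) = decide (Odd (below S' (s : Fin n))) := by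
  rw [← parity_eq]; rfl

theorem col_point (h : Flip S S' l r) :
    tangleCol S S' (point r h.mem_r) = !tangleCol S S' (point l h.mem_l) := by
  have e1 := h.below_r
  have e2 := h.symm.below_r
  have e3 := h.below_le le_rfl
  have hl := h.left
  have hr := h.right
  rw [point, point]
  split_ifs with a b b <;>
    simp only [tangleCol_inl, tangleCol_inr, ← decide_not, decide_eq_decide, e1, e2] <;>
    simp_all [Nat.odd_add_one]

theorem partner_col (h : Flip S S' l r) (v : S ⊕ S') :
    tangleCol S S' (h.partner v) = !tangleCol S S' v := by
  by_cases hl : Sum.elim (fun s : S => (s : Fin n)) (fun s : S' => (s : Fin n)) v = l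
  · have e : h.partner v = point r h.mem_r := by rw [partner, dif_pos hl]
    rw [e, h.col_point, point_eq v h.left _ hl]
  · by_cases hr : Sum.elim (fun s : S => (s : Fin n)) (fun s : S' => (s : Fin n)) v = r
    · have e : h.partner v = point l h.mem_l := by rw [partner, dif_neg hl, dif_pos hr]
      rw [e, ← Bool.not_not (tangleCol S S' (point l h.mem_l)), ← h.col_point,
        point_eq v h.right _ hr]
    · rcases v with s | s
      · have e : h.partner (.inl s) = .inr ⟨s, (h.other s hl hr).1 s.2⟩ := by
          rw [partner, dif_neg hl, dif_neg hr]
        rw [e, tangleCol_inl, tangleCol_inr, Bool.not_not, decide_eq_decide]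
        exact (h.odd_below' s hl hr).symm
      · have e : h.partner (.inr s) = .inl ⟨s, (h.other s hl hr).2 s.2⟩ := by
          rw [partner, dif_neg hl, dif_neg hr]
        rw [e, tangleCol_inl, tangleCol_inr]
        refine congrArg _ (decide_eq_decide.2 ?_)
        exact h.odd_below' s hl hr

/-- The elementary flat tangle. -/
def tangle (h : Flip S S' l r) : Tangle S S' :=
  ⟨⟨h.partner, h.partner, h.partner_partner, h.partner_partner⟩, h.partner_partner, h.partner_col⟩

end Flip
end Elementary

section Main
variable {n k : ℕ}

/-- The admissible weights: sequences of `n` numbers from `{0, 1, 2}` with sum `2 k`.  (These are the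
weights of the irreducible representation of `sl_n` with highest weight `2 ω_k`.) -/
def Weight (n k : ℕ) : Type :=
  {w : Fin n → ℕ // (∀ j, w j ≤ 2) ∧ ∑ j, w j = 2 * k}

namespace Weight

/-- The positions of the ones of a weight. -/
def ones (w : Weight n k) : Finset (Fin n) := Finset.univ.filter fun j => w.1 j = 1

theorem mem_ones {w : Weight n k} {j : Fin n} : j ∈ w.ones ↔ w.1 j = 1 := by simp [ones]

/-- The position `i`. -/
def left (i : Fin (n - 1)) : Fin n := ⟨i, by omega⟩
/-- The position `i + 1`. -/
def right (i : Fin (n - 1)) : Fin n := ⟨i + 1, by omega⟩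

theorem left_ne_right (i : Fin (n - 1)) : left i ≠ right i := by
  simp [left, right, Fin.ext_iff]

/-- The weight `w + c ε_i`, which has `c` more at position `i` and `c` less at position `i + 1`. -/
def raise (w : Weight n k) (i : Fin (n - 1)) (c : ℕ)
    (h : w.1 (left i) + c ≤ 2 ∧ c ≤ w.1 (right i)) : Weight n k :=
  ⟨fun j => if j = left i then w.1 j + c else if j = right i then w.1 j - c else w.1 j, by
    refine ⟨fun j => ?_, ?_⟩
    · have := w.2.1 j
      dsimp only
      split_ifs with h1 h2
      · subst h1; exact h.1
      · omega
      · exact this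
    · have key : ∀ f : Fin n → ℕ, ∑ j, f j = f (left i) + f (right i) +
          ∑ j ∈ (Finset.univ.erase (left i)).erase (right i), f j := by
        intro f
        rw [add_assoc, Finset.add_sum_erase _ _ (by simp [(left_ne_right i).symm]),
          Finset.add_sum_erase _ _ (by simp)]
      refine Eq.trans ?_ w.2.2
      rw [key, key w.1, if_pos rfl, if_neg (left_ne_right i).symm, if_pos rfl]
      have e : ∀ j ∈ (Finset.univ.erase (left i)).erase (right i),
          (if j = left i then w.1 j + c else if j = right i then w.1 j - c else w.1 j) = w.1 j := by
        intro j hj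
        simp only [Finset.mem_erase, Finset.mem_univ, and_true] at hj
        rw [if_neg hj.2, if_neg hj.1]
      rw [Finset.sum_congr rfl e]
      have e2 : ∀ s : ℕ, w.1 (left i) + c + (w.1 (right i) - c) + s =
          w.1 (left i) + w.1 (right i) + s := fun s => by omega
      exact e2 _⟩

theorem raise_apply (w : Weight n k) (i : Fin (n - 1)) (c : ℕ)
    (h : w.1 (left i) + c ≤ 2 ∧ c ≤ w.1 (right i)) (j : Fin n) : (w.raise i c h).1 j =
    if j = left i then w.1 j + c else if j = right i then w.1 j - c else w.1 j := rfl

theorem flip_raise (w : Weight n k) (i : Fin (n - 1))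
    (h : w.1 (left i) + 1 ≤ 2 ∧ 1 ≤ w.1 (right i)) :
    Flip (w.raise i 1 h).ones w.ones (left i) (right i) where
  succ := rfl
  left := by
    rw [mem_ones, mem_ones, raise_apply, if_pos rfl]
    omega
  right := by
    have := w.2.1 (right i)
    rw [mem_ones, mem_ones, raise_apply, if_neg (left_ne_right i).symm, if_pos rfl]
    omega
  other j h1 h2 := by rw [mem_ones, mem_ones, raise_apply, if_neg h1, if_neg h2]

theorem ones_raise_two (w : Weight n k) (i : Fin (n - 1))
    (h : w.1 (left i) + 2 ≤ 2 ∧ 2 ≤ w.1 (right i)) : (w.raise i 2 h).ones = w.ones := by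
  have := w.2.1 (right i)
  ext j
  rw [mem_ones, mem_ones, raise_apply]
  split_ifs with h1 h2
  · subst h1; omega
  · subst h2; omega
  · rfl

end Weight

/-- Finitely generated graded modules over the arc ring of the points `S`. -/
abbrev ModCat (S : Finset (Fin n)) : Type 1 := GrMod (ArcRing S) (ArcRing.deg S)

/-- The category `𝒞 = ⊕ 𝒞(w)` over all admissible weights `w`, where `𝒞(w)` is the category of
finitely generated graded modules over `H_w`, the arc ring of the positions of the ones of `w`. -/
abbrev Cat (n k : ℕ) : Type 1 := ∀ w : Weight n k, ModCat w.ones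

/-- The identification of the module categories of one and the same arc ring. -/
def castFunctor {S S' : Finset (Fin n)} (h : S = S') : ModCat S ⥤ ModCat S' :=
  h ▸ 𝟭 (ModCat S)

open Weight in
/-- The functor `F_i`, lowering the weight by `ε_i`: its component at `w` is the tensor product of the
component at `w + ε_i` with the bimodule of the elementary tangle from the ones of `w + ε_i` to those
of `w`, and is zero if `w + ε_i` is not admissible. -/
def funF (i : Fin (n - 1)) : Cat n k ⥤ Cat n k :=
  Functor.pi' fun w =>
    if h : w.1 (left i) + 1 ≤ 2 ∧ 1 ≤ w.1 (right i) then
      Pi.eval _ (w.raise i 1 h) ⋙ (Tangle.bimod (w.flip_raise i h).tangle).tensor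
    else (Functor.const _).obj (GrMod.zero _ _)

open Weight in
/-- The functor `F_i^{(2)}`, lowering the weight by `2 ε_i`: its component at `w` is zero unless
`(w_i, w_{i+1}) = (0, 2)`; then `w + 2 ε_i`, with entries `(2, 0)`, has the same ones as `w`, hence the
same arc ring, and the component at `w + 2 ε_i` is carried over. -/
def funF₂ (i : Fin (n - 1)) : Cat n k ⥤ Cat n k :=
  Functor.pi' fun w =>
    if h : w.1 (left i) + 2 ≤ 2 ∧ 2 ≤ w.1 (right i) then
      Pi.eval _ (w.raise i 2 h) ⋙ castFunctor (w.ones_raise_two i h)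
    else (Functor.const _).obj (GrMod.zero _ _)

open Classical in
/-- The object `Q_{w,a}`: the module `Q_a` at the weight `w`, and zero at all other weights. -/
def Q (w : Weight n k) (a : CMatching w.ones) : Cat n k := fun v =>
  if h : w = v then h ▸ a.Q else GrMod.zero _ _

/-- The functors `F_i^{(j)}` for `j = 1, 2`.  (Also `F_i^{(0)} = Id`, and `F_i^{(j)} = 0` for
`j > 2`.) -/
def divF (i : Fin (n - 1)) : ℕ → (Cat n k ⥤ Cat n k)
  | 0 => 𝟭 _
  | 1 => funF i
  | 2 => funF₂ i
  | _ => (Functor.const _).obj fun _ => GrMod.zero _ _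

/-- The highest weight `2 ω_k = (2, …, 2, 0, …, 0)`, with `k` twos. -/
def Weight.top (h : k ≤ n) : Weight n k :=
  ⟨fun j => if (j : ℕ) < k then 2 else 0, by
    refine ⟨fun j => by dsimp only; split_ifs <;> omega, ?_⟩
    rw [Fin.sum_univ_eq_sum_range (fun j => if j < k then 2 else 0) n, Finset.sum_ite,
      Finset.sum_const_zero, add_zero, Finset.sum_const, smul_eq_mul, mul_comm,
      show (Finset.range n).filter (· < k) = Finset.range k from ?_, Finset.card_range]
    ext j
    simp only [Finset.mem_filter, Finset.mem_range]
    omega⟩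

theorem Weight.ones_top (h : k ≤ n) : (Weight.top h).ones = ∅ := by
  ext j
  rw [mem_ones]
  change (if (j : ℕ) < k then 2 else 0) = 1 ↔ _
  split_ifs <;> simp

/-- The empty matching. -/
def CMatching.empty {S : Type} [Fintype S] [LinearOrder S] (h : IsEmpty S) : CMatching S where
  partner := 1
  invol := h.elim
  ne := h.elim
  noncrossing := h.elim

/-- The projective of the empty matching is `ℤ` in degree zero. -/
theorem CMatching.empty_Q {S : Type} [Fintype S] [LinearOrder S] (h : IsEmpty S) :
    Nonempty ((CMatching.empty h).Q.carrier ≃+ ℤ) ∧ (CMatching.empty h).Q.deg 0 = ⊤ := by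
  have hs : Subsingleton (CMatching S) := ⟨fun a b => CMatching.ext (Subsingleton.elim _ _)⟩
  let a := CMatching.empty h
  let g : Perm S := circ a.toMatching a.toMatching
  have hI : circIdeal (SameCycle.setoid g) = ⊥ := by
    rw [circIdeal, Ideal.span_eq_bot]
    rintro f (⟨v, -⟩ | ⟨v, -⟩) <;> exact (h.false v).elim
  refine ⟨⟨?_⟩, ?_⟩
  · let u : Unique (CMatching S) := ⟨⟨a⟩, fun b => Subsingleton.elim _ _⟩
    let e1 : a.QCarrier ≃+ a.F a :=
      { toFun := a.ev a
        invFun := fun x b => Subsingleton.elim a b ▸ x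
        left_inv := fun m => funext fun b => by
          obtain rfl := Subsingleton.elim a b
          rfl
        right_inv := fun x => rfl
        map_add' := map_add _ }
    let e2 : a.F a ≃+* MvPolynomial S ℤ :=
      (Ideal.quotEquivOfEq hI).trans (RingEquiv.quotientBot _)
    exact (e1.trans e2.toAddEquiv).trans (isEmptyRingEquiv ℤ S).toAddEquiv
  · rw [eq_top_iff]
    rintro m -
    refine CMatching.mem_Qdeg.2 fun b => ?_
    obtain rfl := Subsingleton.elim a b
    obtain ⟨p, hp⟩ := Ideal.Quotient.mk_surjective (m a)
    rw [← hp]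
    have hc : circles g = 0 := by
      have : IsEmpty (Quotient (SameCycle.setoid g)) := ⟨fun x => by
        obtain ⟨v, -⟩ := Quotient.exists_rep x
        exact h.false v⟩
      exact Nat.card_of_isEmpty
    have hp0 : IsWeightedHomogeneous (fun _ : S => (2 : ℤ)) p 0 := by
      rw [eq_C_of_isEmpty p]
      exact isWeightedHomogeneous_C _ _
    exact TQFT.mk_mem_deg hp0 (by rw [hc]; rfl)
/-- The object `Q_{2ω_k}` of `𝒞(2ω_k)`: the balanced projective of the empty matching, which is `ℤ` in
degree zero over the ring `H(∅) = ℤ` (see `CMatching.empty_Q`). -/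
def Qtop (h : k ≤ n) : Cat n k :=
  Q (Weight.top h) (CMatching.empty (by rw [Weight.ones_top]; infer_instance))

/-- Balanced indecomposable projectives of `𝒞`: the objects isomorphic to some `Q_{w,a}`. -/
def IsBalancedIndecProj (P : Cat n k) : Prop :=
  ∃ (w : Weight n k) (a : CMatching w.ones), Nonempty (P ≅ Q w a)

end Main

end

end Arc

/-! The functors are run backwards, from an arbitrary pair (w, a) up to the highest weight, by
induction on the height ∑ j·w_j. Passing from w to w + cε_i moves c units from position i+1 to
position i, so it lowers the height by c. It therefore suffices to write every Q_{w,a} with w ≠ 2ω_k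
as F_i^{(c)} Q_{w',a'}, where w' = w + cε_i and c is 1 or 2; this is `eq_top_or_exists_divF_iso_Q`.

The choice of i is combinatorial. If w is not weakly decreasing, there is an i with (w_i, w_{i+1})
equal to (0,1), (1,2) or (0,2). The first two arise from (1,0) and (2,1) by the tangle with one
shifted line, the third from (2,0) by F_i^{(2)}. If w is weakly decreasing, it consists of twos,
then ones, then zeros. Without ones it is 2ω_k. With ones, these occupy consecutive positions, so an
innermost arc of a joins two neighbouring positions i, i+1 (`Weight.exists_cup`). Then (1,1) arises
from (2,0) by a cup, and a' is a with that arc removed. Hence no cap is ever needed.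

The algebraic input is one computation, `IsClosure.tensorIso`: if T is a flat tangle in which every
bottom endpoint runs to the top, and closing T from below by a gives the matching a', then F(T) ⊗
Q_a is Q_{a'}, without any shift. Indeed Q_a is the column H 1_a of the arc ring, so the tensor
product extracts the column F(T) 1_a = ⊕_b F(W(b)Ta). Sliding the bottom strands along the lines of
T identifies the circles of W(b)Ta with those of W(b)a', hence the two summands. The left actions
agree as well: both contraction cobordisms of b have as value at 1 a product of factors X_p + X_q,
and by `edge_lemma` such a product depends, modulo the circle relations, only on the connectivity
that its edges create and on the number of edges in each connected component. Connectivity is the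
same because both contract the arcs of b; the numbers agree by the Euler characteristic count
`IsPort.count`. Finally, the upward shift of F(T) by half the number of bottom endpoints cancels the
downward shift of Q_a.

At every weight other than w the object F_i^{(c)} Q_{w',a'} vanishes, because the weight w'
determines w. -/

namespace Arc

open MvPolynomial Equiv Equiv.Perm CategoryTheory
open scoped TensorProduct

noncomputable section

set_option linter.unusedSectionVars false

/-! ### Maps between circle algebras induced by maps of strands -/

section Transport
variable {V W : Type}

/-- The ring map induced by a map of strands that respects the circles. -/
def circMap {r : Setoid V} {r' : Setoid W} (f : V → W) (h : r ≤ r'.comap f) :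
    MvPolynomial V ℤ ⧸ circIdeal r →+* MvPolynomial W ℤ ⧸ circIdeal r' :=
  Ideal.quotientMap (circIdeal r') (rename f : MvPolynomial V ℤ →ₐ[ℤ] MvPolynomial W ℤ).toRingHom (by
    intro p hp
    -- No saddle is involved here, so the factor `c`, which elsewhere is the value of a cobordism,
    -- is 1.
    have := mul_mem_of_gens (I := circIdeal r') (c := 1)
      (rename f : MvPolynomial V ℤ →ₐ[ℤ] MvPolynomial W ℤ).toRingHom
      (fun v => by simpa using sq_mem r' (f v))
      (fun u v huv => by simpa using sub_mem_of_rel (r := r') (h huv)) hp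
    rwa [one_mul] at this)

theorem circMap_mk {r : Setoid V} {r' : Setoid W} (f : V → W) (h : r ≤ r'.comap f)
    (p : MvPolynomial V ℤ) : circMap f h (Ideal.Quotient.mk (circIdeal r) p) =
      Ideal.Quotient.mk (circIdeal r') (rename f p) := rfl

/-- The composite `g ∘ f` need only return a strand to its own circle, since strands of one circle
give the same variable in the quotient. Thus curves with strand sets of different sizes can have
isomorphic algebras. -/
theorem circMap_comp_eq_id {r : Setoid V} {r' : Setoid W} (f : V → W) (h : r ≤ r'.comap f)
    (g : W → V) (h' : r' ≤ r.comap g) (hgf : ∀ v, r (g (f v)) v)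
    (x : MvPolynomial V ℤ ⧸ circIdeal r) : circMap g h' (circMap f h x) = x := by
  obtain ⟨p, rfl⟩ := Ideal.Quotient.mk_surjective x
  rw [circMap_mk, circMap_mk]
  have : ((Ideal.Quotient.mk (circIdeal r)).comp
      ((rename g : MvPolynomial W ℤ →ₐ[ℤ] MvPolynomial V ℤ).toRingHom.comp
        (rename f : MvPolynomial V ℤ →ₐ[ℤ] MvPolynomial W ℤ).toRingHom)) =
      Ideal.Quotient.mk (circIdeal r) := by
    refine MvPolynomial.ringHom_ext (fun a => by simp) (fun v => ?_)
    simp only [RingHom.comp_apply, AlgHom.toRingHom_eq_coe, RingHom.coe_coe, rename_X]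
    exact Ideal.Quotient.eq.2 (sub_mem_of_rel (hgf v))
  exact congrArg (fun k => k p) this

/-- All variables have the same weight, so identifying some of them does not change the weight of a
monomial; `f` need not be injective. -/
theorem isWeightedHomogeneous_rename (f : V → W) {p : MvPolynomial V ℤ} {d : ℤ}
    (hp : IsWeightedHomogeneous (fun _ : V => (2 : ℤ)) p d) :
    IsWeightedHomogeneous (fun _ : W => (2 : ℤ)) (rename f p) d := by
  intro c hc
  obtain ⟨u, rfl, hu⟩ := coeff_rename_ne_zero f p c hc
  rw [← hp hu, Finsupp.weight_apply, Finsupp.weight_apply, Finsupp.sum_mapDomain_index]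
  · intro _; exact zero_smul _ _
  · intro _ _ _; exact add_smul _ _ _

/-- The degree is the weight of a polynomial minus the number of circles, and renaming preserves the
weight; hence the condition `hc`. -/
theorem circMap_mem_deg [Fintype V] [DecidableEq V] [Fintype W] [DecidableEq W] {g : Perm V}
    {g' : Perm W} (f : V → W) (h : SameCycle.setoid g ≤ (SameCycle.setoid g').comap f)
    (hc : circles g = circles g') {d : ℤ} {x : TQFT g} (hx : x ∈ TQFT.deg g d) :
    (circMap f h x : TQFT g') ∈ TQFT.deg g' d := by
  obtain ⟨p, hp, rfl⟩ := hx
  exact TQFT.mk_mem_deg (isWeightedHomogeneous_rename f hp) (by rw [hc])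

end Transport

/-! ### Comparison of W(b)Ta with W(b)a' -/

section Closure
variable {S S' : Type} [Fintype S] [LinearOrder S] [Fintype S'] [LinearOrder S']

/-- The tangle `T`, closed from below by the matching `a`, is the matching `a'`, without circles.  The
lines of `T` from bottom to top run along `e`. -/
structure IsClosure (T : Tangle S S') (a : CMatching S) (a' : CMatching S') (e : S → S') : Prop where
  line : ∀ s, T.toPerm (.inl s) = .inr (e s)
  arc : ∀ s, a'.partner (e s) = e (a.partner s)
  cup : ∀ t, t ∉ Set.range e → T.toPerm (.inr t) = .inr (a'.partner t)

namespace IsClosure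
variable {T : Tangle S S'} {a : CMatching S} {a' : CMatching S'} {e : S → S'}

theorem line' (h : IsClosure T a a' e) (s : S) : T.toPerm (.inr (e s)) = .inl s := by
  rw [← h.line, T.invol]

/-- Slide the strands at the bottom along the lines to the top. -/
def retr (_ : IsClosure T a a' e) : S ⊕ S' → S' := Sum.elim e id

/-- By `cyc_circ_le` single arcs suffice. After sliding, an arc of `a` becomes an arc of `a'`, a
line of `T` shrinks to a point, and the arcs of `b` and the cups of `T` stay arcs of `b` and of
`a'`. -/
theorem cyc_le_comap_retr (h : IsClosure T a a' e) (b : CMatching S') :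
    SameCycle.setoid (circ (join b a) T) ≤
      (SameCycle.setoid (circ b.toMatching a'.toMatching)).comap h.retr := by
  refine cyc_circ_le ?_ ?_
  · rintro (s | t)
    · have := cyc_right b.toMatching a'.toMatching (e s)
      rwa [show a'.toMatching.toPerm (e s) = e (a.partner s) from h.arc s] at this
    · exact cyc_left b.toMatching a'.toMatching t
  · rintro (s | t)
    · rw [h.line]
      exact Setoid.refl' (SameCycle.setoid (circ b.toMatching a'.toMatching)) (e s)
    · by_cases ht : t ∈ Set.range e
      · obtain ⟨s, rfl⟩ := ht
        rw [h.line']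
        exact Setoid.refl' (SameCycle.setoid (circ b.toMatching a'.toMatching)) (e s)
      · rw [h.cup t ht]; exact cyc_right b.toMatching a'.toMatching t

theorem rel_retr (h : IsClosure T a a' e) (b : CMatching S') (v : S ⊕ S') :
    SameCycle.setoid (circ (join b a) T) v (.inr (h.retr v)) := by
  rcases v with s | t
  · have := cyc_right (join b a) T (.inl s)
    rwa [h.line] at this
  · exact Setoid.refl' _ _

/-- An arc of `a'` is either a cup of `T` or is traced inside W(b)Ta as a line downwards, an arc of
`a`, and a line upwards. -/
theorem rel_partner (h : IsClosure T a a' e) (b : CMatching S') (t : S') :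
    SameCycle.setoid (circ (join b a) T) (.inr t) (.inr (a'.partner t)) := by
  by_cases ht : t ∈ Set.range e
  · obtain ⟨s, rfl⟩ := ht
    rw [h.arc]
    refine Setoid.trans' _ (Setoid.symm' _ (h.rel_retr b (.inl s))) ?_
    exact Setoid.trans' _ (cyc_left (join b a) T (.inl s)) (h.rel_retr b (.inl (a.partner s)))
  · rw [← h.cup t ht]; exact cyc_right (join b a) T _

theorem cyc_le_comap_inr (h : IsClosure T a a' e) (b : CMatching S') :
    SameCycle.setoid (circ b.toMatching a'.toMatching) ≤
      (SameCycle.setoid (circ (join b a) T)).comap Sum.inr :=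
  cyc_circ_le (fun t => cyc_left (join b a) T (.inr t)) fun t => h.rel_partner b t

theorem cyc_iff (h : IsClosure T a a' e) (b : CMatching S') (u v : S') :
    SameCycle.setoid (circ (join b a) T) (.inr u) (.inr v) ↔
      SameCycle.setoid (circ b.toMatching a'.toMatching) u v :=
  ⟨fun k => h.cyc_le_comap_retr b k, fun k => h.cyc_le_comap_inr b k⟩

/-- `edge_lemma` asks for a count in each component, so circles are compared inside a part `O` of
the picture and not only in total. Closure of `O` under sliding guarantees that each circle meeting
`O` has a top strand in `O`. -/
theorem numCl_eq (h : IsClosure T a a' e) (b : CMatching S') (O : Set (S ⊕ S'))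
    (hO : ∀ v ∈ O, .inr (h.retr v) ∈ O) :
    numCl (SameCycle.setoid (circ b.toMatching a'.toMatching)) (Sum.inr ⁻¹' O) =
      numCl (SameCycle.setoid (circ (join b a) T)) O :=
  numCl_congr Sum.inr (fun _ hv => hv) (fun u _ v _ => (h.cyc_iff b u v).symm)
    fun w hw => ⟨h.retr w, hO w hw, Setoid.symm' _ (h.rel_retr b w)⟩

theorem circles_eq (h : IsClosure T a a' e) (b : CMatching S') :
    circles (circ b.toMatching a'.toMatching) = circles (circ (join b a) T) := by
  have := h.numCl_eq b Set.univ (fun _ _ => trivial)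
  rwa [Set.preimage_univ, numCl_univ, numCl_univ] at this

/-- The isomorphism `F(W(b)a') ≃ F(W(b)Ta)`. -/
def ringEquiv (h : IsClosure T a a' e) (b : CMatching S') : b.F a' ≃+* TQFT (circ (join b a) T) :=
  { circMap Sum.inr (h.cyc_le_comap_inr b) with
    invFun := circMap h.retr (h.cyc_le_comap_retr b)
    left_inv := circMap_comp_eq_id _ _ _ _ fun _ => Setoid.refl' _ _
    right_inv := circMap_comp_eq_id _ _ _ _ fun v => Setoid.symm' _ (h.rel_retr b v) }

theorem ringEquiv_mk (h : IsClosure T a a' e) (b : CMatching S') (p : MvPolynomial S' ℤ) :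
    h.ringEquiv b (TQFT.mk _ p) = TQFT.mk _ (rename Sum.inr p) := rfl

theorem ringEquiv_mem_deg (h : IsClosure T a a' e) (b : CMatching S') {d : ℤ} {x : b.F a'}
    (hx : x ∈ TQFT.deg _ d) : h.ringEquiv b x ∈ TQFT.deg (circ (join b a) T) d :=
  circMap_mem_deg _ (h.cyc_le_comap_inr b) (h.circles_eq b) hx

theorem ringEquiv_symm_mem_deg (h : IsClosure T a a' e) (b : CMatching S') {d : ℤ}
    {x : TQFT (circ (join b a) T)} (hx : x ∈ TQFT.deg _ d) :
    (h.ringEquiv b).symm x ∈ TQFT.deg (circ b.toMatching a'.toMatching) d :=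
  circMap_mem_deg _ (h.cyc_le_comap_retr b) (h.circles_eq b).symm hx

/-- The heart of the comparison of the two left actions. Both sides list the saddles that split a
circle when the arcs of `b` are contracted, but the order of the saddles, and with it the set of
splitting ones, may differ. `edge_lemma` makes this irrelevant: both lists connect the two ends of
every arc of `b` and nothing more, and they have equally many edges in each component. -/
theorem edgeProd_sub_edgeProd_mem (h : IsClosure T a a' e) (c b : CMatching S') :
    edgeProd ((leftPort c b a).E T) - edgeProd
      (((isPort_id c.toMatching b.toMatching).E a'.toMatching).map (Prod.map Sum.inr Sum.inr)) ∈
      circIdeal (SameCycle.setoid (circ (join c a) T)) := by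
  set h1 := leftPort c b a
  set h2 := isPort_id c.toMatching b.toMatching
  set r := SameCycle.setoid (circ (join c a) T)
  set E := h1.E T
  set F := h2.E a'.toMatching
  -- Connectivity among the top strands, computed with `a'`, persists in the larger picture with `T`
  -- and `a`.
  have hF : conn (SameCycle.setoid (circ c.toMatching a'.toMatching)) F ≤
      (conn r (F.map (Prod.map Sum.inr Sum.inr))).comap Sum.inr :=
    conn_le (fun u v k => le_conn _ _ (h.cyc_le_comap_inr c k))
      fun e he => conn_rel (List.mem_map.2 ⟨e, he, rfl⟩)
  have hconn : conn r E = conn r (F.map (Prod.map Sum.inr Sum.inr)) := by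
    apply le_antisymm
    · refine conn_le (le_conn _ _) fun e he => ?_
      obtain ⟨s, rfl⟩ := h1.E_mem T he
      exact hF (h2.conn_arc a'.toMatching s)
    · refine conn_le (le_conn _ _) fun e he => ?_
      obtain ⟨f, hf, rfl⟩ := List.mem_map.1 he
      obtain ⟨s, rfl⟩ := h2.E_mem a'.toMatching hf
      exact h1.conn_arc T s
  refine edge_lemma _ r E _ rfl hconn fun w => ?_
  set L := conn r E with hL
  -- The component of `w`. It is stable under all arcs involved, so `count` applies to it on both
  -- sides; `numCl_eq` then matches the numbers of circles, and only the numbers of edges remain.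
  set O : Set (S ⊕ S') := {v | L w v} with hO
  have cl : ∀ {f : S ⊕ S' → S ⊕ S'}, (∀ v, L v (f v)) → ∀ v ∈ O, f v ∈ O :=
    fun hf v hv => Setoid.trans' _ hv (hf v)
  have cl' : ∀ {f : S' → S'}, (∀ v, L (.inr v) (.inr (f v))) →
      ∀ v ∈ Sum.inr ⁻¹' O, f v ∈ Sum.inr ⁻¹' O := fun hf v hv => Setoid.trans' _ hv (hf v)
  have cr : ∀ v ∈ O, .inr (h.retr v) ∈ O := fun v hv => Setoid.trans' _ hv (le_conn _ _ (h.rel_retr c v))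
  have k1 := h1.count T O (cl fun v => le_conn _ _ (cyc_left (join c a) T v))
    (cl fun v => le_conn _ _ (cyc_right (join c a) T v)) (cl (closed_of_port h1 (J := L) (h1.conn_arc T)))
  have k2 := h2.count a'.toMatching (Sum.inr ⁻¹' O)
    (cl' fun v => le_conn _ _ (cyc_left (join c a) T (.inr v)))
    (cl' fun v => le_conn _ _ (h.rel_partner c v)) (cl' fun v => h1.conn_arc T v)
  rw [Set.preimage_id, h.numCl_eq b O cr, h.numCl_eq c O cr] at k2
  rw [List.countP_map]
  -- The `change` steps unify the decidability instances and the predicates, so that `omega` sees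
  -- the same terms.
  change E.countP (fun e => Classical.propDecidable (e.1 ∈ O) |>.decide) =
    F.countP (fun e => Classical.propDecidable (e.1 ∈ Sum.inr ⁻¹' O) |>.decide)
  change 4 * E.countP (fun e => Classical.propDecidable (e.1 ∈ O) |>.decide) + _ + _ = _ at k1
  change 4 * F.countP (fun e => Classical.propDecidable (e.1 ∈ Sum.inr ⁻¹' O) |>.decide) + _ + _
    = _ at k2
  omega

/-- The isomorphisms `F(W(b)a') ≃ F(W(b)Ta)` respect the action of the arc ring of the top endpoints. -/
theorem ringEquiv_mulF (h : IsClosure T a a' e) (c b : CMatching S') (f : c.F b) (m : b.F a') :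
    h.ringEquiv c (mulF c.toMatching b.toMatching a'.toMatching f m) =
      portMul (leftPort c b a) T f (h.ringEquiv b m) := by
  obtain ⟨f, rfl⟩ := Ideal.Quotient.mk_surjective f
  obtain ⟨m, rfl⟩ := Ideal.Quotient.mk_surjective m
  rw [mulF, portMul_mk, ringEquiv_mk, ringEquiv_mk, portMul_mk, (leftPort c b a).contr_eq,
    (isPort_id c.toMatching b.toMatching).contr_eq, rename_id_apply,
    map_mul (rename Sum.inr), map_mul (rename Sum.inr), rename_edgeProd]
  -- Both sides are a value of the cobordism times the same product of renamed polynomials.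
  rw [eq_comm, Ideal.Quotient.eq, ← sub_mul]
  exact Ideal.mul_mem_right _ _ (h.edgeProd_sub_edgeProd_mem c b)

end IsClosure
end Closure

/-! ### Isomorphisms of graded modules, and vanishing -/

section GradedIso
variable {R : Type} [Ring R] {𝒜 : ℤ → AddSubgroup R} [GradedRing 𝒜]
variable {R' : Type} [Ring R'] {𝒜' : ℤ → AddSubgroup R'} [GradedRing 𝒜']

/-- A linear equivalence that preserves degrees in both directions is an isomorphism. -/
def GrMod.isoOfEquiv {M N : GrMod R 𝒜} (f : M.carrier ≃ₗ[R] N.carrier)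
    (h : ∀ i, ∀ x ∈ M.deg i, f x ∈ N.deg i) (h' : ∀ i, ∀ x ∈ N.deg i, f.symm x ∈ M.deg i) :
    M ≅ N where
  hom := ⟨f.toLinearMap, h⟩
  inv := ⟨f.symm.toLinearMap, h'⟩
  hom_inv_id := GrMod.Hom.ext' (LinearMap.ext f.symm_apply_apply)
  inv_hom_id := GrMod.Hom.ext' (LinearMap.ext f.apply_symm_apply)

/-- A tensor product with a zero module is zero without being literally `GrMod.zero`, so the
vanishing of components is recorded as `Subsingleton` of the carrier. -/
theorem GrMod.iso_of_subsingleton (M N : GrMod R 𝒜) (hM : Subsingleton M.carrier)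
    (hN : Subsingleton N.carrier) : Nonempty (M ≅ N) :=
  ⟨⟨⟨0, fun _ _ _ => zero_mem _⟩, ⟨0, fun _ _ _ => zero_mem _⟩,
    GrMod.Hom.ext' (LinearMap.ext fun _ => Subsingleton.elim (α := M.carrier) _ _),
    GrMod.Hom.ext' (LinearMap.ext fun _ => Subsingleton.elim (α := N.carrier) _ _)⟩⟩

theorem GrBimod.subsingleton_tens (B : GrBimod R' 𝒜' R 𝒜) (M : GrMod R 𝒜)
    (hM : Subsingleton M.carrier) : Subsingleton (B.Tens M) := by
  refine ⟨fun s t => ?_⟩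
  have h0 : ∀ t : B.Tens M, t = 0 := GrBimod.tens_induction rfl (fun x m => by
    rw [Subsingleton.elim m 0]; exact map_zero (B.tmulHom M x)) fun s t hs ht => by
      rw [hs, ht, add_zero]
  rw [h0 s, h0 t]

end GradedIso

/-! ### Columns of the arc ring and of a tangle bimodule -/

section Column
variable {S S' : Type} [Fintype S] [LinearOrder S] [Fintype S'] [LinearOrder S']

/-- The column of the arc ring with index `a`. -/
def CMatching.column (a : CMatching S) : a.QCarrier →+ ArcRing S where
  toFun q c := Pi.single a (q c)
  map_zero' := ArcRing.ext fun _ d => congrFun (Pi.single_zero a) d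
  map_add' p q := ArcRing.ext fun c d => congrFun (Pi.single_add a (p c) (q c)) d

theorem CMatching.column_same (a : CMatching S) (q : a.QCarrier) (c : CMatching S) :
    a.column q c a = q c := Pi.single_eq_same (M := fun d => c.F d) a (q c)

theorem CMatching.column_ne (a : CMatching S) (q : a.QCarrier) (c d : CMatching S) (h : d ≠ a) :
    a.column q c d = 0 := Pi.single_eq_of_ne (M := fun d => c.F d) h (q c)

/-- Left multiplication acts on each column separately; `column` thus embeds Q_a in the arc ring as
the left ideal H 1_a. -/
theorem CMatching.column_smul (a : CMatching S) (r : ArcRing S) (q : a.QCarrier) :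
    a.column (r • q) = r * a.column q := by
  refine ArcRing.ext fun c d => ?_
  rw [ArcRing.mul_apply]
  by_cases h : d = a
  · subst h
    simp only [CMatching.column_same, CMatching.smul_apply]
  · rw [a.column_ne _ _ _ h]
    refine (Finset.sum_eq_zero fun b _ => ?_).symm
    rw [a.column_ne _ _ _ h]
    exact portMul_zero_right _ _ _

/-- The idempotent `1_a`, as the generator of `Q_a`. -/
def CMatching.gen (a : CMatching S) : a.QCarrier := fun b => (1 : ArcRing S) b a

theorem CMatching.gen_apply (a b : CMatching S) : a.gen b = (1 : ArcRing S) b a := rfl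

/-- Q_a is cyclic, generated by 1_a, with an explicit additive choice of coefficient for each
element. This is what moves every pure tensor `m ⊗ q` into the form `x ⊗ 1_a`. -/
theorem CMatching.column_smul_gen (a : CMatching S) (q : a.QCarrier) : a.column q • a.gen = q := by
  funext c
  -- The action on `gen` is, by definition, column `a` of the product with 1.
  have h : (a.column q * 1 : ArcRing S) c a = a.column q c a := by rw [mul_one]
  rw [a.column_same] at h
  exact h

/-- The unit of the arc ring has degree 0, and Q_a is the column shifted down by half the number of
points. -/
theorem CMatching.gen_mem_deg (a : CMatching S) : a.gen ∈ a.Qdeg (-half S) := by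
  rw [CMatching.mem_Qdeg]
  intro b
  have h := ArcRing.mem_deg.1 (SetLike.one_mem_graded (ArcRing.deg S)) b a
  rwa [zero_sub] at h

/-- The element of the bimodule of `T` with column `x` at the index `a`, and zero elsewhere. -/
def Tangle.column (T : Tangle S S') (a : CMatching S)
    (x : ∀ b : CMatching S', TQFT (circ (join b a) T)) : Tangle.Carrier T :=
  fun b => Pi.single (M := fun d => TQFT (circ (join b d) T)) a (x b)

theorem Tangle.column_same (T : Tangle S S') (a : CMatching S)
    (x : ∀ b : CMatching S', TQFT (circ (join b a) T)) (b : CMatching S') :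
    T.column a x b a = x b := Pi.single_eq_same (M := fun d => TQFT (circ (join b d) T)) a (x b)

theorem Tangle.column_ne (T : Tangle S S') (a : CMatching S)
    (x : ∀ b : CMatching S', TQFT (circ (join b a) T)) (b : CMatching S')
    (d : CMatching S) (h : d ≠ a) : T.column a x b d = 0 :=
  Pi.single_eq_of_ne (M := fun d => TQFT (circ (join b d) T)) h (x b)

theorem Tangle.column_mem_deg (T : Tangle S S') (a : CMatching S) {d : ℤ}
    {x : ∀ b : CMatching S', TQFT (circ (join b a) T)} (hx : ∀ b, x b ∈ TQFT.deg _ (d - half S)) :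
    T.column a x ∈ Tangle.deg T d := by
  rw [Tangle.mem_deg]
  intro b c
  by_cases h : c = a
  · subst h
    rw [T.column_same]; exact hx b
  · rw [T.column_ne _ _ _ _ h]; exact zero_mem _

/-- Right multiplication by an element of H 1_a has its image in column `a`, so extracting that
column loses nothing. -/
theorem Tangle.column_op_smul (T : Tangle S S') (a : CMatching S) (q : a.QCarrier)
    (m : Tangle.Carrier T) :
    T.column a (fun b => (MulOpposite.op (a.column q) • m) b a) =
      MulOpposite.op (a.column q) • m := by
  refine Tangle.ext fun b d => ?_
  by_cases h : d = a
  · subst h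
    rw [T.column_same]
  · rw [T.column_ne _ _ _ _ h, Tangle.op_smul_apply]
    refine (Finset.sum_eq_zero fun c _ => ?_).symm
    rw [MulOpposite.unop_op, a.column_ne _ _ _ h]
    exact portMul_zero_left _ _ _

end Column

/-! ### The isomorphism F(T) ⊗ Q_a ≅ Q_{a'} -/

namespace IsClosure
variable {S S' : Type} [Fintype S] [LinearOrder S] [Fintype S'] [LinearOrder S']
variable {T : Tangle S S'} {a : CMatching S} {a' : CMatching S'} {e : S → S'}

/-- The column of the bimodule of `T` that corresponds to an element of `Q_{a'}`. -/
def toColumn (h : IsClosure T a a' e) (x : a'.QCarrier) : Tangle.Carrier T :=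
  T.column a fun b => h.ringEquiv b (x b)

theorem toColumn_same (h : IsClosure T a a' e) (x : a'.QCarrier) (b : CMatching S') :
    h.toColumn x b a = h.ringEquiv b (x b) := T.column_same a _ b

theorem toColumn_ne (h : IsClosure T a a' e) (x : a'.QCarrier) (b : CMatching S')
    (d : CMatching S) (hd : d ≠ a) : h.toColumn x b d = 0 := T.column_ne a _ b d hd

theorem toColumn_add (h : IsClosure T a a' e) (x y : a'.QCarrier) :
    h.toColumn (x + y) = h.toColumn x + h.toColumn y := by
  refine Tangle.ext fun c d => ?_
  rw [Tangle.add_apply]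
  by_cases k : d = a
  · subst k
    rw [toColumn_same, toColumn_same, toColumn_same, CMatching.add_apply, map_add]
  · rw [h.toColumn_ne _ _ _ k, h.toColumn_ne _ _ _ k, h.toColumn_ne _ _ _ k, add_zero]

theorem toColumn_zero (h : IsClosure T a a' e) : h.toColumn 0 = 0 := by
  have := h.toColumn_add 0 0
  rwa [add_zero, left_eq_add] at this

/-- The left action does not mix columns, and on column `a` it is matched summand by summand through
`ringEquiv_mulF`. -/
theorem toColumn_smul (h : IsClosure T a a' e) (f : ArcRing S') (x : a'.QCarrier) :
    h.toColumn (f • x) = f • h.toColumn x := by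
  refine Tangle.ext fun c d => ?_
  rw [Tangle.smul_apply]
  by_cases k : d = a
  · subst k
    rw [toColumn_same, CMatching.smul_apply, map_sum]
    refine Finset.sum_congr rfl fun b _ => ?_
    rw [toColumn_same, h.ringEquiv_mulF]
  · rw [h.toColumn_ne _ _ _ k]
    refine (Finset.sum_eq_zero fun b _ => ?_).symm
    rw [h.toColumn_ne _ _ _ k]
    exact portMul_zero_right _ _ _

/-- The pairing `F(T) × Q_a → Q_{a'}`. -/
def pairing (h : IsClosure T a a' e) : Tangle.Carrier T →+ a.QCarrier →+ a'.QCarrier :=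
  AddMonoidHom.mk' (fun m => AddMonoidHom.mk'
    (fun q b => (h.ringEquiv b).symm ((MulOpposite.op (a.column q) • m) b a))
    (fun p q => funext fun b => by
      rw [map_add, MulOpposite.op_add, add_smul, Tangle.add_apply, map_add]; rfl))
    (fun m n => AddMonoidHom.ext fun q => funext fun b => by
      change (h.ringEquiv b).symm ((MulOpposite.op (a.column q) • (m + n)) b a) = _
      rw [smul_add, Tangle.add_apply, map_add]; rfl)

theorem pairing_apply (h : IsClosure T a a' e) (m : Tangle.Carrier T) (q : a.QCarrier)
    (b : CMatching S') :
    h.pairing m q b = (h.ringEquiv b).symm ((MulOpposite.op (a.column q) • m) b a) := rfl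

/-- The element `q` enters only through right multiplication by its column, and the column of `r •
q` is `r` times that of `q`. Balancedness is then associativity of the right action. -/
theorem pairing_balanced (h : IsClosure T a a' e) (m : Tangle.Carrier T) (r : ArcRing S)
    (q : a.QCarrier) : h.pairing (MulOpposite.op r • m) q = h.pairing m (r • q) := by
  funext b
  rw [pairing_apply, pairing_apply, a.column_smul, MulOpposite.op_mul, mul_smul]

/-- The column of `gen` is the idempotent 1_a, which fixes column `a`; only the summand with index
`a` contributes. -/
theorem pairing_toColumn_gen (h : IsClosure T a a' e) (x : a'.QCarrier) :
    h.pairing (h.toColumn x) a.gen = x := by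
  funext b
  rw [pairing_apply, RingEquiv.symm_apply_eq, Tangle.op_smul_apply, Finset.sum_eq_single a]
  · rw [MulOpposite.unop_op, a.column_same, a.gen_apply, ArcRing.one_apply, if_pos rfl,
      portMul_one, h.toColumn_same]
  · intro c _ hc
    rw [h.toColumn_ne _ _ _ hc]
    exact portMul_zero_right _ _ _
  · simp

/-- The product of `m` with the column of `q` lies in column `a`, so passing to Q_{a'} and back
recovers all of it. -/
theorem toColumn_pairing (h : IsClosure T a a' e) (m : Tangle.Carrier T) (q : a.QCarrier) :
    h.toColumn (h.pairing m q) = MulOpposite.op (a.column q) • m := by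
  rw [← T.column_op_smul]
  refine congrArg (T.column a) (funext fun b => ?_)
  rw [pairing_apply, RingEquiv.apply_symm_apply]

/-- The isomorphism `Q_{a'} ≃ F(T) ⊗ Q_a`. -/
def linearEquiv (h : IsClosure T a a' e) :
    a'.QCarrier ≃ₗ[ArcRing S'] (Tangle.bimod T).Tens a.Q where
  toFun x := (Tangle.bimod T).tmul (M := a.Q) (h.toColumn x) a.gen
  map_add' x y := by
    rw [toColumn_add]; exact GrBimod.add_tmul (B := Tangle.bimod T) (M := a.Q) _ _ _
  map_smul' f x := by
    rw [toColumn_smul]; rfl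
  invFun := GrBimod.liftAdd (B := Tangle.bimod T) (M := a.Q) h.pairing h.pairing_balanced
  left_inv x := h.pairing_toColumn_gen x
  right_inv t := by
    refine GrBimod.tens_induction (B := Tangle.bimod T) (M := a.Q)
      (p := fun t => (Tangle.bimod T).tmul (M := a.Q) (h.toColumn
        (GrBimod.liftAdd (B := Tangle.bimod T) (M := a.Q) h.pairing h.pairing_balanced t)) a.gen = t)
      ?_ ?_ ?_ t
    · rw [map_zero, h.toColumn_zero]
      exact congrArg (fun k : a.Q.carrier →+ (Tangle.bimod T).Tens a.Q => k a.gen)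
        (map_zero ((Tangle.bimod T).tmulHom a.Q))
    · intro m q
      -- Here `m ⊗ q = m ⊗ (column q) 1_a = m (column q) ⊗ 1_a`, read from right to left.
      refine (congrArg (fun k => (Tangle.bimod T).tmul (M := a.Q) k a.gen)
        (h.toColumn_pairing m q)).trans ?_
      refine (GrBimod.op_tmul (B := Tangle.bimod T) (M := a.Q) _ _ _).trans ?_
      exact congrArg _ (a.column_smul_gen q)
    · intro s t hs ht
      rw [map_add, toColumn_add]
      exact (GrBimod.add_tmul (B := Tangle.bimod T) (M := a.Q) _ _ _).trans
        (congrArg₂ (· + ·) hs ht)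

/-- The shifts cancel here: an element of degree `d` in Q_{a'} has degree `d + half S` in F(T), and
1_a has degree `-half S` in Q_a. -/
theorem linearEquiv_mem_deg (h : IsClosure T a a' e) (d : ℤ) (x : a'.QCarrier)
    (hx : x ∈ a'.Qdeg d) : h.linearEquiv x ∈ (Tangle.bimod T).tensDeg a.Q d := by
  refine AddSubgroup.subset_closure ⟨d + half S, -half S, by ring, h.toColumn x, ?_, a.gen,
    a.gen_mem_deg, rfl⟩
  refine T.column_mem_deg a fun b => ?_
  rw [add_sub_cancel_right]
  exact h.ringEquiv_mem_deg b (CMatching.mem_Qdeg.1 hx b)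

theorem pairing_mem_deg (h : IsClosure T a a' e) {i j : ℤ} {m : Tangle.Carrier T} {q : a.QCarrier}
    (hm : m ∈ Tangle.deg T i) (hq : q ∈ a.Qdeg j) : h.pairing m q ∈ a'.Qdeg (i + j) := by
  rw [CMatching.mem_Qdeg] at *
  rw [Tangle.mem_deg] at hm
  intro b
  refine h.ringEquiv_symm_mem_deg b ?_
  rw [Tangle.op_smul_apply]
  refine sum_mem fun c _ => ?_
  rw [MulOpposite.unop_op, a.column_same]
  -- The contraction at the bottom raises the degree by the number of arcs `half S`, which offsets
  -- the shift of F(T).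
  have := portMul_mem_deg (rightPort b a c) T a.card_eq' (hq c) (hm b c)
  rwa [show j + (i - (half S : ℤ)) + half S = i + j by ring] at this

theorem linearEquiv_symm_mem_deg (h : IsClosure T a a' e) (d : ℤ)
    (t : (Tangle.bimod T).Tens a.Q) (ht : t ∈ (Tangle.bimod T).tensDeg a.Q d) :
    h.linearEquiv.symm t ∈ a'.Qdeg d := by
  refine AddSubgroup.closure_induction (p := fun t _ => h.linearEquiv.symm t ∈ a'.Qdeg d) ?_
    (by rw [map_zero]; exact zero_mem _) (fun s t _ _ hs ht => by rw [map_add]; exact add_mem hs ht)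
    (fun t _ ht => by rw [map_neg]; exact neg_mem ht) ht
  rintro _ ⟨i, j, rfl, m, hm, q, hq, rfl⟩
  exact h.pairing_mem_deg hm hq

/-- The tensor product of the bimodule of `T` with `Q_a` is `Q_{a'}`. -/
def tensorIso (h : IsClosure T a a' e) : (Tangle.bimod T).tensor.obj a.Q ≅ a'.Q :=
  (GrMod.isoOfEquiv (M := a'.Q) (N := (Tangle.bimod T).tensObj a.Q) h.linearEquiv
    h.linearEquiv_mem_deg h.linearEquiv_symm_mem_deg).symm

end IsClosure

/-! ### Elementary tangles without caps -/

/-- A matching restricts to a set of points that is a union of its arcs. -/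
theorem CMatching.exists_restrict {S S' : Type} [Fintype S] [LinearOrder S] [Fintype S']
    [LinearOrder S'] (a' : CMatching S') {e : S → S'} (he : StrictMono e)
    (h : ∀ s, a'.partner (e s) ∈ Set.range e) :
    ∃ a : CMatching S, ∀ s, a'.partner (e s) = e (a.partner s) := by
  choose f hf using h
  have hff : ∀ s, f (f s) = s := fun s => he.injective (by rw [hf, hf, a'.invol])
  refine ⟨⟨⟨f, f, hff, hff⟩, hff, fun s hs => a'.ne (e s) ?_, ?_⟩, fun s => (hf s).symm⟩
  · rw [← hf]; exact congrArg e hs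
  -- Since `e` preserves the order, a crossing of the restriction would be a crossing of `a'`.
  · rintro i j l p hij hjl hlp ⟨h1, h2⟩
    refine a'.noncrossing _ _ _ _ (he hij) (he hjl) (he hlp) ⟨?_, ?_⟩
    · rw [← hf]; exact congrArg e h1
    · rw [← hf]; exact congrArg e h2

namespace Flip
variable {n : ℕ} {S S' : Finset (Fin n)} {l r : Fin n}

/-- At `l` and at `r` exactly one of `S`, `S'` has a point. Without a cap, a point of `S` at one of
the two positions forces a point of `S'` at the other, and this is where its line ends. -/
theorem swap_mem (h : Flip S S' l r) (hS : ¬ (l ∈ S ∧ r ∈ S)) {j : Fin n} (hj : j ∈ S) :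
    swap l r j ∈ S' := by
  have hl := h.left
  have hr := h.right
  by_cases h1 : j = l
  · subst h1
    rw [swap_apply_left]; tauto
  · by_cases h2 : j = r
    · subst h2
      rw [swap_apply_right]; tauto
    · rw [swap_apply_of_ne_of_ne h1 h2]
      exact (h.other j h1 h2).1 hj

/-- The top endpoint of the line of an elementary tangle that starts at a given bottom endpoint, if the
tangle has no cap. -/
def slide (h : Flip S S' l r) (hS : ¬ (l ∈ S ∧ r ∈ S)) (s : S) : S' :=
  ⟨swap l r s, h.swap_mem hS s.2⟩

/-- A transposition of neighbouring positions reverses the order of the pair `(l, r)` only, and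
without a cap these are not both in `S`. -/
theorem slide_strictMono (h : Flip S S' l r) (hS : ¬ (l ∈ S ∧ r ∈ S)) :
    StrictMono (h.slide hS) := by
  rintro ⟨s, hs⟩ ⟨t, ht⟩ hst
  have hst : s < t := hst
  change swap l r s < swap l r t
  have hsucc := h.succ
  rw [swap_apply_def, swap_apply_def]
  split_ifs with h1 h2 h3 h4 h5 h6 h7 <;> simp only [Fin.lt_def, Fin.ext_iff] at *
  all_goals try omega
  -- The one remaining case is `s = l` and `t = r`.
  all_goals
    exfalso
    have e1 := Fin.ext h1
    have e2 := Fin.ext ‹(t : ℕ) = r›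
    exact hS ⟨e1 ▸ hs, e2 ▸ ht⟩

theorem partner_inl (h : Flip S S' l r) (hS : ¬ (l ∈ S ∧ r ∈ S)) (s : S) :
    h.partner (.inl s) = .inr (h.slide hS s) := by
  obtain ⟨s, hs⟩ := s
  rw [partner]
  split_ifs with h1 h2
  · have h1 : s = l := h1
    subst h1
    rw [point, dif_neg fun k => hS ⟨hs, k⟩]
    exact congrArg _ (Subtype.ext (swap_apply_left _ _).symm)
  · have h2 : s = r := h2
    subst h2
    rw [point, dif_neg fun k => hS ⟨k, hs⟩]
    exact congrArg _ (Subtype.ext (swap_apply_right _ _).symm)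
  · exact congrArg _ (Subtype.ext (swap_apply_of_ne_of_ne h1 h2).symm)

/-- The transposition is its own inverse, so `t` is hit exactly when its image under it lies in `S`.
The missed points are therefore the two ends of the cup, if there is one. -/
theorem notMem_range_slide (h : Flip S S' l r) (hS : ¬ (l ∈ S ∧ r ∈ S)) (t : S') :
    t ∉ Set.range (h.slide hS) ↔ (l ∈ S' ∧ r ∈ S') ∧ ((t : Fin n) = l ∨ (t : Fin n) = r) := by
  obtain ⟨t, ht⟩ := t
  have hl := h.left
  have hr := h.right
  have key : ⟨t, ht⟩ ∈ Set.range (h.slide hS) ↔ swap l r t ∈ S := by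
    constructor
    · rintro ⟨s, hs⟩
      have hs : swap l r s = t := congrArg Subtype.val hs
      rw [← hs, swap_apply_self]
      exact s.2
    · intro k
      exact ⟨⟨_, k⟩, Subtype.ext (swap_apply_self _ _ _)⟩
  rw [key]
  by_cases h1 : t = l
  · subst h1
    rw [swap_apply_left]
    simp only [true_or, and_true]; tauto
  · by_cases h2 : t = r
    · subst h2
      rw [swap_apply_right]
      simp only [or_true, and_true]; tauto
    · rw [swap_apply_of_ne_of_ne h1 h2, h.other t h1 h2]
      tauto

/-- A matching is the closure of an elementary tangle without caps by another matching, provided that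
it contains the cup of the tangle, if there is one. -/
theorem exists_closure (h : Flip S S' l r) (hS : ¬ (l ∈ S ∧ r ∈ S)) (a' : CMatching S')
    (hc : ∀ (hl : l ∈ S') (hr : r ∈ S'), a'.partner ⟨l, hl⟩ = ⟨r, hr⟩) :
    ∃ (a : CMatching S) (e : S → S'), IsClosure h.tangle a a' e := by
  -- The points off the lines are the ends of the cup, which `a'` pairs with each other. As `a'` is
  -- an involution, it also preserves the set of points on the lines, and so restricts to a matching
  -- below.
  have hrange : ∀ t ∉ Set.range (h.slide hS), a'.partner t ∉ Set.range (h.slide hS) := by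
    rintro ⟨t, ht⟩ k
    rw [notMem_range_slide] at k ⊢
    obtain ⟨⟨hl, hr⟩, rfl | rfl⟩ := k
    · rw [hc hl hr]; exact ⟨⟨hl, hr⟩, Or.inr rfl⟩
    · have e : a'.partner ⟨t, ht⟩ = ⟨l, hl⟩ := by rw [← hc hl hr, a'.invol]
      rw [e]; exact ⟨⟨hl, hr⟩, Or.inl rfl⟩
  obtain ⟨a, ha⟩ := a'.exists_restrict (h.slide_strictMono hS) fun s => by
    by_contra k
    have := hrange _ k
    rw [a'.invol] at this
    exact this ⟨s, rfl⟩
  refine ⟨a, h.slide hS, fun s => h.partner_inl hS s, ha, ?_⟩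
  rintro ⟨t, ht⟩ k
  change h.partner (.inr ⟨t, ht⟩) = _
  obtain ⟨⟨hl, hr⟩, rfl | rfl⟩ := (h.notMem_range_slide hS _).1 k
  · rw [hc hl hr, partner, dif_pos (by rfl), point, dif_neg fun k => h.right.1 k hr]
  · have e : a'.partner ⟨t, ht⟩ = ⟨l, hl⟩ := by rw [← hc hl hr, a'.invol]
    rw [e, partner, dif_neg (by exact h.ne.symm), dif_pos (by rfl), point,
      dif_neg fun k => h.left.1 k hl]

end Flip

/-! ### Combinatorics of weights -/

section Functors
variable {n k : ℕ}

namespace Weight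

/-- Needed to see that F_i^{(c)} sends an object supported at one weight to an object supported at
one weight. The subtraction is not truncated, because both weights have at least `c` units at
position i+1. -/
theorem raise_injective {v w : Weight n k} {i : Fin (n - 1)} {c : ℕ}
    (hv : v.1 (left i) + c ≤ 2 ∧ c ≤ v.1 (right i)) (hw : w.1 (left i) + c ≤ 2 ∧ c ≤ w.1 (right i))
    (h : v.raise i c hv = w.raise i c hw) : v = w := by
  refine Subtype.ext (funext fun j => ?_)
  have hj := congrFun (congrArg Subtype.val h) j
  rw [raise_apply, raise_apply] at hj
  split_ifs at hj with h1 h2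
  · omega
  · subst h2; omega
  · exact hj

/-- The sum of the positions of the units of a weight. -/
def height (w : Weight n k) : ℕ := ∑ j : Fin n, (j : ℕ) * w.1 j

/-- The `c` units move one position to the left. This is the measure for the induction; the form
with `+ c` avoids truncated subtraction. -/
theorem height_raise (w : Weight n k) (i : Fin (n - 1)) (c : ℕ)
    (h : w.1 (left i) + c ≤ 2 ∧ c ≤ w.1 (right i)) : (w.raise i c h).height + c = w.height := by
  -- Both sides describe the weight before the move with the `c` units at position i counted in
  -- addition.
  have key : ∀ j : Fin n, (w.raise i c h).1 j + (if j = right i then c else 0) =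
      w.1 j + (if j = left i then c else 0) := by
    intro j
    rw [raise_apply]
    have hne := left_ne_right i
    by_cases h1 : j = left i
    · subst h1
      rw [if_pos rfl, if_neg hne, if_pos rfl, add_zero]
    · by_cases h2 : j = right i
      · subst h2
        rw [if_neg h1, if_pos rfl, if_pos rfl, if_neg h1]; omega
      · rw [if_neg h1, if_neg h2, if_neg h2, if_neg h1]
  have hs := Finset.sum_congr (rfl : (Finset.univ : Finset (Fin n)) = Finset.univ)
    fun j _ => congrArg (fun x => (j : ℕ) * x) (key j)
  simp only [mul_add, Finset.sum_add_distrib, mul_ite, mul_zero, Finset.sum_ite_eq',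
    Finset.mem_univ, if_true] at hs
  have e1 : ((right i : Fin n) : ℕ) * c = ((left i : Fin n) : ℕ) * c + c := Nat.succ_mul _ _
  rw [e1] at hs
  change (w.raise i c h).height + _ = w.height + _ at hs
  omega

theorem antitone_of_step {w : Weight n k} (h : ∀ i, w.1 (right i) ≤ w.1 (left i)) :
    Antitone w.1 := by
  have key : ∀ (d : ℕ) (i j : Fin n), (j : ℕ) = i + d → w.1 j ≤ w.1 i := by
    intro d
    induction d with
    | zero => intro i j hij; rw [show j = i from Fin.ext hij]
    | succ d ih =>
      intro i j hij
      have hj := j.2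
      refine le_trans ?_ (ih i ⟨i + d, by omega⟩ rfl)
      have := h ⟨i + d, by omega⟩
      rwa [show right ⟨i + d, by omega⟩ = j from Fin.ext (by simp only [right]; omega)] at this
  exact fun i j hij => key (j - i) i j (by have : (i : ℕ) ≤ j := hij; omega)

/-- Only the values 0 and 2 occur, so the positions of the twos form an initial segment, and the sum
2k gives it k elements. -/
theorem eq_top_of_antitone {w : Weight n k} (hkn : k ≤ n) (h : Antitone w.1) (h1 : ∀ j, w.1 j ≠ 1) :
    w = top hkn := by
  classical
  let A : Finset (Fin n) := Finset.univ.filter fun j => w.1 j = 2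
  have h02 : ∀ j, w.1 j = if j ∈ A then 2 else 0 := by
    intro j
    have := w.2.1 j
    have := h1 j
    simp only [A, Finset.mem_filter, Finset.mem_univ, true_and]
    split_ifs with k
    · exact k
    · omega
  have hA : A.card = k := by
    have hs := w.2.2
    rw [Finset.sum_congr rfl fun j _ => h02 j, Finset.sum_ite_mem, Finset.univ_inter,
      Finset.sum_const, smul_eq_mul] at hs
    omega
  refine Subtype.ext (funext fun j => ?_)
  change w.1 j = if (j : ℕ) < k then 2 else 0
  rw [h02 j]
  -- A position `j` in `A` brings all of `Iic j` with it, so `j + 1 ≤ k`; a position outside `A`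
  -- confines `A` to `Iio j`, so `k ≤ j`.
  refine if_congr ⟨fun hj => ?_, fun hj => ?_⟩ rfl rfl
  · have hsub : Finset.Iic j ⊆ A := by
      intro i hi
      have h2 := h (Finset.mem_Iic.1 hi)
      have := w.2.1 i
      simp only [A, Finset.mem_filter, Finset.mem_univ, true_and] at hj ⊢
      omega
    have := Finset.card_le_card hsub
    rw [Fin.card_Iic, hA] at this
    omega
  · by_contra hj'
    have hsub : A ⊆ Finset.Iio j := by
      intro i hi
      rw [Finset.mem_Iio]
      by_contra hij
      have h2 := h (not_lt.1 hij)
      have h3 := h02 j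
      rw [if_neg hj'] at h3
      simp only [A, Finset.mem_filter, Finset.mem_univ, true_and] at hi
      omega
    have := Finset.card_le_card hsub
    rw [Fin.card_Iio, hA] at this
    omega

/-- A matching of the ones of a weakly decreasing weight joins two neighbouring positions. -/
theorem exists_cup {w : Weight n k} (h : Antitone w.1) (a : CMatching w.ones) {j : Fin n}
    (hj : w.1 j = 1) : ∃ (i : Fin (n - 1)) (hl : left i ∈ w.ones) (hr : right i ∈ w.ones),
      a.partner ⟨left i, hl⟩ = ⟨right i, hr⟩ := by
  classical
  -- The left ends of arcs. The largest of them, `s`, is the left end of the desired arc.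
  let A : Finset w.ones := Finset.univ.filter fun s => s < a.partner s
  have hA : A.Nonempty := by
    let s : w.ones := ⟨j, mem_ones.2 hj⟩
    rcases lt_trichotomy s (a.partner s) with k | k | k
    · exact ⟨s, by simpa [A] using k⟩
    · exact absurd k.symm (a.ne s)
    · exact ⟨a.partner s, by simpa [A, a.invol] using k⟩
  obtain ⟨s, hs, hmax⟩ := A.exists_max_image id hA
  simp only [A, Finset.mem_filter, Finset.mem_univ, true_and, id] at hs hmax
  have hst : ((s : Fin n) : ℕ) < (a.partner s : Fin n) := hs
  have hlt := (a.partner s : Fin n).2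
  let i : Fin (n - 1) := ⟨(s : Fin n), by omega⟩
  have hle : right i ≤ (a.partner s : Fin n) := hst
  -- Position s+1 lies between two ones of a weakly decreasing weight, hence is a one.
  have hr : right i ∈ w.ones := by
    have h1 := h hle
    have h2 : w.1 (right i) ≤ w.1 (s : Fin n) := h (Nat.le_succ _)
    rw [mem_ones.1 s.2] at h2
    rw [mem_ones.1 (a.partner s).2] at h1
    exact mem_ones.2 (le_antisymm h2 h1)
  refine ⟨i, s.2, hr, ?_⟩
  let t : w.ones := ⟨right i, hr⟩
  have hsucc : ∀ u : w.ones, u < t → u ≤ s := fun u hu => Nat.lt_succ_iff.1 hu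
  have hst' : s < t := Nat.lt_succ_self _
  have hts : t ≤ a.partner s := hle
  change a.partner s = t
  -- If s+1 came strictly before the partner of `s`, it would be a right end by maximality of `s`.
  -- Its arc would start before `s` and cross the arc of `s`.
  rcases hts.lt_or_eq with k | k
  · exfalso
    have hne : a.partner t ≠ s := fun e => by
      rw [← e, a.invol] at k
      exact lt_irrefl _ k
    have h1 : a.partner t < t := by
      rcases lt_trichotomy (a.partner t) t with c | c | c
      · exact c
      · exact absurd c (a.ne t)
      · exact absurd (hmax t c) (not_le.2 hst')
    exact a.noncrossing _ _ _ _ (lt_of_le_of_ne (hsucc _ h1) hne) hst' k ⟨a.invol t, rfl⟩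
  · exact k.symm

end Weight

/-! ### The functors on the objects Q_{w,a} -/

open Weight

theorem Q_same (w : Weight n k) (a : CMatching w.ones) : Q w a w = a.Q := dif_pos rfl

theorem subsingleton_Q {w v : Weight n k} (a : CMatching w.ones) (h : w ≠ v) :
    Subsingleton (Q w a v).carrier := by
  rw [Q, dif_neg h]
  exact inferInstanceAs (Subsingleton PUnit)

/-- The component is indexed by the target weight `v`, so the source weight appears as `v.raise i 1
h`. -/
theorem funF_obj_of_raise {i : Fin (n - 1)} (X : Cat n k) {v : Weight n k}
    (h : v.1 (left i) + 1 ≤ 2 ∧ 1 ≤ v.1 (right i)) : (funF i).obj X v =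
      (Tangle.bimod (v.flip_raise i h).tangle).tensor.obj (X (v.raise i 1 h)) := by
  change (dite _ _ _ : Cat n k ⥤ ModCat v.ones).obj X = _
  rw [dif_pos h]
  rfl

theorem funF_obj_of_not {i : Fin (n - 1)} (X : Cat n k) {v : Weight n k}
    (h : ¬ (v.1 (left i) + 1 ≤ 2 ∧ 1 ≤ v.1 (right i))) :
    (funF i).obj X v = GrMod.zero _ _ := by
  change (dite _ _ _ : Cat n k ⥤ ModCat v.ones).obj X = _
  rw [dif_neg h]
  rfl

theorem funF₂_obj_of_raise {i : Fin (n - 1)} (X : Cat n k) {v : Weight n k}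
    (h : v.1 (left i) + 2 ≤ 2 ∧ 2 ≤ v.1 (right i)) : (funF₂ i).obj X v =
      (castFunctor (v.ones_raise_two i h)).obj (X (v.raise i 2 h)) := by
  change (dite _ _ _ : Cat n k ⥤ ModCat v.ones).obj X = _
  rw [dif_pos h]
  rfl

theorem funF₂_obj_of_not {i : Fin (n - 1)} (X : Cat n k) {v : Weight n k}
    (h : ¬ (v.1 (left i) + 2 ≤ 2 ∧ 2 ≤ v.1 (right i))) :
    (funF₂ i).obj X v = GrMod.zero _ _ := by
  change (dite _ _ _ : Cat n k ⥤ ModCat v.ones).obj X = _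
  rw [dif_neg h]
  rfl

theorem subsingleton_castFunctor {S S' : Finset (Fin n)} (h : S = S') (M : ModCat S)
    (hM : Subsingleton M.carrier) : Subsingleton ((castFunctor h).obj M).carrier := by
  subst h
  exact hM

/-- Stated as existence so that `subst` turns the transport into the identity functor, and no
transported matching has to be written down. -/
theorem exists_castFunctor_Q {S S' : Finset (Fin n)} (h : S = S') (a : CMatching S') :
    ∃ a' : CMatching S, (castFunctor h).obj a'.Q = a.Q := by
  subst h
  exact ⟨a, rfl⟩

/-- An object that is `Q_a` at the weight `w` and zero elsewhere is `Q_{w,a}`. -/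
theorem nonempty_iso_Q {w : Weight n k} (a : CMatching w.ones) {X : Cat n k}
    (hw : Nonempty (X w ≅ a.Q)) (h : ∀ v, w ≠ v → Subsingleton (X v).carrier) :
    Nonempty (X ≅ Q w a) := by
  have key : ∀ v, Nonempty (X v ≅ Q w a v) := by
    intro v
    by_cases hv : w = v
    · subst hv
      rwa [Q_same]
    · exact GrMod.iso_of_subsingleton _ _ (h v hv) (subsingleton_Q a hv)
  exact ⟨Pi.isoMk fun v => (key v).some⟩

/-- `hS` says that the elementary tangle has no cap, and `hc` that its cup, if any, is an arc of
`a`. At `w` the claim is `tensorIso`. At another weight `v`, either v + ε_i is not admissible or, by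
`raise_injective`, it differs from w + ε_i, where alone the source is supported. -/
theorem exists_funF_iso_Q (w : Weight n k) (i : Fin (n - 1))
    (h : w.1 (left i) + 1 ≤ 2 ∧ 1 ≤ w.1 (right i))
    (hS : ¬ (left i ∈ (w.raise i 1 h).ones ∧ right i ∈ (w.raise i 1 h).ones))
    (a : CMatching w.ones)
    (hc : ∀ (hl : left i ∈ w.ones) (hr : right i ∈ w.ones), a.partner ⟨_, hl⟩ = ⟨_, hr⟩) :
    ∃ a' : CMatching (w.raise i 1 h).ones,
      Nonempty ((funF i).obj (Q (w.raise i 1 h) a') ≅ Q w a) := by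
  obtain ⟨a', e, ha'⟩ := (w.flip_raise i h).exists_closure hS a hc
  refine ⟨a', nonempty_iso_Q a ?_ fun v hv => ?_⟩
  · rw [funF_obj_of_raise _ h, Q_same]
    exact ⟨ha'.tensorIso⟩
  · by_cases hr : v.1 (left i) + 1 ≤ 2 ∧ 1 ≤ v.1 (right i)
    · rw [funF_obj_of_raise _ hr]
      exact GrBimod.subsingleton_tens _ _
        (subsingleton_Q a' fun k => hv (raise_injective _ _ k))
    · rw [funF_obj_of_not _ hr]
      exact inferInstanceAs (Subsingleton PUnit)

/-- The weights w and w + 2ε_i have the same ones, so the functor only relabels the module; the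
support is treated as for `exists_funF_iso_Q`. -/
theorem exists_funF₂_iso_Q (w : Weight n k) (i : Fin (n - 1))
    (h : w.1 (left i) + 2 ≤ 2 ∧ 2 ≤ w.1 (right i)) (a : CMatching w.ones) :
    ∃ a' : CMatching (w.raise i 2 h).ones,
      Nonempty ((funF₂ i).obj (Q (w.raise i 2 h) a') ≅ Q w a) := by
  obtain ⟨a', ha'⟩ := exists_castFunctor_Q (w.ones_raise_two i h) a
  refine ⟨a', nonempty_iso_Q a ?_ fun v hv => ?_⟩
  · rw [funF₂_obj_of_raise _ h, Q_same, ha']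
    exact ⟨Iso.refl _⟩
  · by_cases hr : v.1 (left i) + 2 ≤ 2 ∧ 2 ≤ v.1 (right i)
    · rw [funF₂_obj_of_raise _ hr]
      exact subsingleton_castFunctor _ _
        (subsingleton_Q a' fun k => hv (raise_injective _ _ k))
    · rw [funF₂_obj_of_not _ hr]
      exact inferInstanceAs (Subsingleton PUnit)

/-! ### Induction on the height -/

/-- Every `Q_{w,a}` other than `Q_{2ω_k}` comes from an object of the same kind with a higher weight. -/
theorem eq_top_or_exists_divF_iso_Q (hkn : k ≤ n) (w : Weight n k) (a : CMatching w.ones) :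
    w = top hkn ∨ ∃ (i : Fin (n - 1)) (j : ℕ) (w' : Weight n k) (a' : CMatching w'.ones),
      (j = 1 ∨ j = 2) ∧ w'.height < w.height ∧ Nonempty ((divF i j).obj (Q w' a') ≅ Q w a) := by
  have step : ∀ (i : Fin (n - 1)) (h : w.1 (left i) + 1 ≤ 2 ∧ 1 ≤ w.1 (right i)),
      ¬ (left i ∈ (w.raise i 1 h).ones ∧ right i ∈ (w.raise i 1 h).ones) →
      (∀ (hl : left i ∈ w.ones) (hr : right i ∈ w.ones), a.partner ⟨_, hl⟩ = ⟨_, hr⟩) →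
      ∃ (i : Fin (n - 1)) (j : ℕ) (w' : Weight n k) (a' : CMatching w'.ones),
        (j = 1 ∨ j = 2) ∧ w'.height < w.height ∧
          Nonempty ((divF i j).obj (Q w' a') ≅ Q w a) := by
    intro i h hS hc
    obtain ⟨a', ha'⟩ := exists_funF_iso_Q w i h hS a hc
    have := w.height_raise i 1 h
    exact ⟨i, 1, _, a', Or.inl rfl, by omega, ha'⟩
  by_cases hmono : ∀ i, w.1 (right i) ≤ w.1 (left i)
  · have hanti := antitone_of_step hmono
    by_cases h1 : ∃ j, w.1 j = 1
    · obtain ⟨j, hj⟩ := h1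
      obtain ⟨i, hl, hr, hc⟩ := exists_cup hanti a hj
      have hl' := mem_ones.1 hl
      have hr' := mem_ones.1 hr
      -- The entries (1,1) come from (2,0): position i carries a two before the step, so there is no
      -- cap, and the cup is the arc found by `exists_cup`.
      refine Or.inr (step i (by omega) ?_ fun _ _ => hc)
      rintro ⟨k, -⟩
      rw [mem_ones, raise_apply, if_pos rfl] at k
      omega
    · push Not at h1
      exact Or.inl (eq_top_of_antitone hkn hanti h1)
  · push Not at hmono
    obtain ⟨i, hi⟩ := hmono
    have h2 := w.2.1 (right i)
    -- The case (0,2) is separate because for it F_i would start from (1,1) and use a cap.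
    by_cases h02 : w.1 (left i) + 2 ≤ 2 ∧ 2 ≤ w.1 (right i)
    · obtain ⟨a', ha'⟩ := exists_funF₂_iso_Q w i h02 a
      have := w.height_raise i 2 h02
      exact Or.inr ⟨i, 2, _, a', Or.inr rfl, by omega, ha'⟩
    -- What remains is (0,1) from (1,0) or (1,2) from (2,1). The tangle is a shifted line, and the
    -- condition on the cup is vacuous.
    · refine Or.inr (step i (by omega) ?_ fun hl hr => ?_)
      · rintro ⟨k, k'⟩
        rw [mem_ones, raise_apply, if_pos rfl] at k
        rw [mem_ones, raise_apply, if_neg (left_ne_right i).symm, if_pos rfl] at k'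
        omega
      · have hl' := mem_ones.1 hl
        have hr' := mem_ones.1 hr
        omega

/-- The base of the induction: a set without points has only one matching. -/
theorem Q_top (hkn : k ≤ n) (a : CMatching (top hkn : Weight n k).ones) :
    Q (top hkn) a = Qtop hkn := by
  have : IsEmpty ((top hkn : Weight n k).ones) := by rw [ones_top]; infer_instance
  exact congrArg (Q (top hkn)) (CMatching.ext (Subsingleton.elim _ _))

theorem exists_foldl_iso_Q (hkn : k ≤ n) (w : Weight n k) (a : CMatching w.ones) :
    ∃ l : List (Fin (n - 1) × ℕ), (∀ p ∈ l, p.2 = 1 ∨ p.2 = 2) ∧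
      Nonempty (l.foldl (fun Y p => (divF p.1 p.2).obj Y) (Qtop hkn) ≅ Q w a) := by
  induction hN : w.height using Nat.strong_induction_on generalizing w with
  | _ N ih =>
    subst hN
    rcases eq_top_or_exists_divF_iso_Q hkn w a with rfl | ⟨i, j, w', a', hj, hlt, ⟨f⟩⟩
    · exact ⟨[], by simp, ⟨eqToIso (Q_top hkn a).symm⟩⟩
    · obtain ⟨l, hl, ⟨g⟩⟩ := ih _ hlt w' a' rfl
      -- `foldl` applies the head of the list first, so the functor applied last goes to the end.
      refine ⟨l ++ [(i, j)], ?_, ⟨?_⟩⟩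
      · intro p hp
        rcases List.mem_append.1 hp with hp | hp
        · exact hl p hp
        · rw [List.mem_singleton.1 hp]; exact hj
      · rw [List.foldl_append]
        exact (divF i j).mapIso g ≪≫ f

end Functors

end

end Arc

theorem mainTheorem8 (n k : ℕ) (hk : 1 ≤ k) (hkn : k < n) (P : Arc.Cat n k)
    (hP : Arc.IsBalancedIndecProj P) :
    ∃ l : List (Fin (n - 1) × ℕ), (∀ p ∈ l, p.2 = 1 ∨ p.2 = 2) ∧
      Nonempty (CategoryTheory.Iso P
        (l.foldl (fun Y p => (Arc.divF p.1 p.2).obj Y) (Arc.Qtop hkn.le))) := by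
  obtain ⟨w, a, ⟨f⟩⟩ := hP
  obtain ⟨l, hl, ⟨g⟩⟩ := Arc.exists_foldl_iso_Q hkn.le w a
  exact ⟨l, hl, ⟨f.trans g.symm⟩⟩
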